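/- Let $(C,0)\subset(\mathbb C^n,0)$ be a germ of a reduced analytic curve with $r\ge 1$ irreducible components (branches) $C_1,\dots,C_r$, and let $\varphi_i:(\mathbb C,0)\to(\mathbb C^n,0)$ be uniformizations of the branches, i.e. germs of analytic maps with image $C_i$ which are isomorphisms onto $C_i$ outside of the origin. For a germ $g\in\mathcal O_{\mathbb C^n,0}$ of a holomorphic function let $v_i(g)\in\mathbb Z_{\ge0}\cup\{\infty\}$ be the order of zero at the origin of $g\circ\varphi_i$ and, if $v_i(g)<\infty$, let $a_i(g)\in\mathbb C^*$ be its leading coefficient, so that $g(\varphi_i(\tau))=a_i(g)\tau^{v_i(g)}+\text{terms of higher degree}$. For $\underline v\in\mathbb Z_{\ge0}^r$ let $F_{\underline v}\subset(\mathbb C^*)^r$ be the set of all $(a_1(g),\dots,a_r(g))$ with $g\in\mathcal O_{\mathbb C^n,0}$ and $v_i(g)=v_i$ for all $i$ (the fibre over $\underline v$ of the extended semigroup of $C$), let $\mathbb PF_{\underline v}=F_{\underline v}/\mathbb C^*\subset\mathbb P(\mathbb C^r)$ be its projectivization, and let $$X_C(t_1,\dots,t_r)=\sum_{\underline v\in\mathbb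 Z_{\ge0}^r}\chi(\mathbb PF_{\underline v})\,\underline t^{\underline v},$$ where $\chi(X)=\sum_{q\ge0}(-1)^q\dim H_q(X^*,*;\mathbb R)$ with $X^*$ the one-point compactification of $X$ and $*$ the added point. For $\underline v\in\mathbb Z^r$ let $J(\underline v)=\{g\in\mathcal O_{\mathbb C^n,0}: v_i(g)\ge v_i,\ i=1,\dots,r\}$, let $c(\underline v)=\dim_{\mathbb C} J(\underline v)/J(\underline v+\underline 1)$ with $\underline 1=(1,\dots,1)$, and let $\mathcal L=\sum_{\underline v\in\mathbb Z^r}c(\underline v)\,\underline t^{\underline v}$ and $P'_C=\mathcal L\cdot\prod_{i=1}^r(t_i-1)$. Then all the numbers $c(\underline v)$ are finite; all the spaces $\mathbb PF_{\underline v}$ have finite-dimensional total homology $H_\bullet((\mathbb PF_{\underline v})^*,*;\mathbb R)$; $P'_C$ is a polynomial; the Poincaré series $P_C(t_1,\dots,t_r)=P'_C(t_1,\dots,t_r)/(t_1\cdots t_r-1)$, which is an element of $\mathbb Z[[t_1,\dots,t_r]]$, is a polynomial if $r>1$; and $$X_C(t_1,\dots,t_r)=P_C(t_1,\dots,t_r).$$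 -/

import Mathlib

open Filter Topology CategoryTheory
open scoped LinearAlgebra.Projectivization

noncomputable section

namespace CurveGerm

/-! ### Germs of analytic sets, curve singularities and their uniformizations -/

/-- `A` represents a germ at the origin of an analytic subset of `ℂⁿ`: near `0` it is the set of
common zeros of finitely many holomorphic functions. -/
def IsAnalyticGerm {n : ℕ} (A : Set (Fin n → ℂ)) : Prop :=
  ∃ U : Set (Fin n → ℂ), IsOpen U ∧ 0 ∈ U ∧ ∃ (k : ℕ) (f : Fin k → (Fin n → ℂ) → ℂ),
    (∀ j, AnalyticOnNhd ℂ (f j) U) ∧ A ∩ U = {z ∈ U | ∀ j, f j z = 0}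

/-- `A` and `B` represent the same germ at the origin of a subset of `ℂⁿ`. -/
def SameGerm {n : ℕ} (A B : Set (Fin n → ℂ)) : Prop := ∀ᶠ z in 𝓝 (0 : Fin n → ℂ), z ∈ A ↔ z ∈ B

/-- The germ of `A` at the origin is contained in the germ of `B`. -/
def GermLE {n : ℕ} (A B : Set (Fin n → ℂ)) : Prop := ∀ᶠ z in 𝓝 (0 : Fin n → ℂ), z ∈ A → z ∈ B

/-- `A` represents an irreducible (nonempty) analytic germ at the origin: it is not the union of two
analytic germs both different from it. -/
def IsIrreducibleGerm {n : ℕ} (A : Set (Fin n → ℂ)) : Prop :=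
  IsAnalyticGerm A ∧ 0 ∈ A ∧
    ∀ B B' : Set (Fin n → ℂ), IsAnalyticGerm B → IsAnalyticGerm B' →
      SameGerm A (B ∪ B') → SameGerm A B ∨ SameGerm A B'

/-- `φ` represents a germ of an analytic map `(ℂ, 0) → (ℂⁿ, 0)` which is a uniformization of the
germ `B`: as a germ, its image is `B`, and it is an isomorphism onto `B` outside of the origin. -/
structure IsUniformization {n : ℕ} (φ : ℂ → Fin n → ℂ) (B : Set (Fin n → ℂ)) : Prop where
  analyticAt : AnalyticAt ℂ φ 0
  map_zero : φ 0 = 0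
  /-- The image germ is `B`: small disks are mapped into `B`, and the images of small disks are
  exactly the small neighbourhoods of the origin in `B`. -/
  map_nhds : Filter.map φ (𝓝 0) = 𝓝[B] 0
  /-- Outside of the origin `φ` is, near the origin, an injective immersion (and, by `map_nhds`
  and compactness of small closed disks, a homeomorphism onto its image). -/
  iso_off_zero : ∃ D ∈ 𝓝 (0 : ℂ), Set.InjOn φ D ∧ ∀ τ ∈ D, τ ≠ 0 → deriv φ τ ≠ 0

end CurveGerm

open CurveGerm in
/-- A reduced curve singularity `(C, 0) ⊂ (ℂⁿ, 0)` with `r` branches, together with uniformizations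
of its branches. A reduced germ is given by its underlying germ of a set. -/
structure CurveSingularity (n r : ℕ) where
  /-- a representative of the germ `C` -/
  carrier : Set (Fin n → ℂ)
  /-- representatives of the irreducible components `C_i` -/
  branch : Fin r → Set (Fin n → ℂ)
  /-- representatives of the uniformizations `φ_i` -/
  param : Fin r → ℂ → Fin n → ℂ
  isAnalyticGerm : IsAnalyticGerm carrier
  zero_mem : 0 ∈ carrier
  branch_irreducible : ∀ i, IsIrreducibleGerm (branch i)
  /-- `C` is the union of its components -/
  eq_iUnion : SameGerm carrier (⋃ i, branch i)
  /-- no component is contained in another one -/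
  not_le : ∀ i j, i ≠ j → ¬ GermLE (branch i) (branch j)
  isUniformization : ∀ i, IsUniformization (param i) (branch i)

namespace CurveGerm

/-! ### Holomorphic germs and their orders along the branches -/

/-- The `ℂ`-vector space `𝒪_{ℂⁿ,0}` of germs at the origin of holomorphic functions on `ℂⁿ`. -/
def holoGerms (n : ℕ) : Submodule ℂ (Germ (𝓝 (0 : Fin n → ℂ)) ℂ) where
  carrier := {g | ∃ f : (Fin n → ℂ) → ℂ, AnalyticAt ℂ f 0 ∧ g = Germ.ofFun f}
  add_mem' := by
    rintro _ _ ⟨f, hf, rfl⟩ ⟨f', hf', rfl⟩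
    exact ⟨f + f', hf.add hf', rfl⟩
  zero_mem' := ⟨0, analyticAt_const, rfl⟩
  smul_mem' := by
    rintro c _ ⟨f, hf, rfl⟩
    exact ⟨c • f, hf.const_smul, rfl⟩

/-- The order of zero at the origin of a germ of a function on `(ℂ, 0)`. -/
def germOrder (G : Germ (𝓝 (0 : ℂ)) ℂ) : ℕ∞ :=
  G.liftOn (fun f => analyticOrderAt f 0) fun _ _ h => analyticOrderAt_congr h

/-- `G(τ) = a τ^k + terms of higher degree`, with `a ≠ 0`. -/
def HasLeadingTerm (G : Germ (𝓝 (0 : ℂ)) ℂ) (k : ℕ) (a : ℂ) : Prop :=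
  a ≠ 0 ∧ ∃ h : ℂ → ℂ, AnalyticAt ℂ h 0 ∧ h 0 = a ∧
    G = Germ.ofFun fun τ => τ ^ k * h τ

end CurveGerm

namespace CurveSingularity

open CurveGerm

variable {n r : ℕ} (C : CurveSingularity n r)

lemma param_tendsto (i : Fin r) : Tendsto (C.param i) (𝓝 0) (𝓝 0) := by
  have h := (C.isUniformization i).analyticAt.continuousAt.tendsto
  rwa [(C.isUniformization i).map_zero] at h

/-- The germ `g ∘ φ_i`. -/
def pullback (i : Fin r) (g : Germ (𝓝 (0 : Fin n → ℂ)) ℂ) : Germ (𝓝 (0 : ℂ)) ℂ :=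
  g.compTendsto (C.param i) (C.param_tendsto i)

/-- The order `v_i(g)` of `g` along the `i`-th branch; it is `⊤` if `g ∘ φ_i = 0`. -/
def order (i : Fin r) (g : Germ (𝓝 (0 : Fin n → ℂ)) ℂ) : ℕ∞ := germOrder (C.pullback i g)

lemma exists_rep {g : Germ (𝓝 (0 : Fin n → ℂ)) ℂ} (hg : g ∈ holoGerms n) :
    ∃ f : (Fin n → ℂ) → ℂ, AnalyticAt ℂ f 0 ∧ g = Germ.ofFun f ∧
      ∀ i, AnalyticAt ℂ (f ∘ C.param i) 0 ∧
        C.order i g = analyticOrderAt (f ∘ C.param i) 0 := by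
  obtain ⟨f, hf, hg⟩ := hg
  refine ⟨f, hf, hg, fun i => ⟨?_, ?_⟩⟩
  · have h0 := (C.isUniformization i).map_zero
    exact AnalyticAt.comp (by rwa [h0]) (C.isUniformization i).analyticAt
  · simp only [order, pullback, hg]
    rfl

/-! ### The extended semigroup and its projectivization -/

/-- The extended semigroup `Ŝ_C ⊂ ℤ_{≥0}^r × (ℂ^*)^r`. -/
def extendedSemigroup : Set ((Fin r → ℕ) × (Fin r → ℂ)) :=
  {p | ∃ g ∈ holoGerms n, ∀ i, HasLeadingTerm (C.pullback i g) (p.1 i) (p.2 i)}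

/-- The fibre `F_v ⊂ (ℂ^*)^r ⊂ ℂ^r` of the extended semigroup over `v`. -/
def fibre (v : Fin r → ℕ) : Set (Fin r → ℂ) := {a | (v, a) ∈ C.extendedSemigroup}

/-- The projectivization `ℙF_v ⊂ ℙ(ℂ^r)` of the fibre `F_v`. -/
def projFibre (v : Fin r → ℕ) : Set (ℙ ℂ (Fin r → ℂ)) :=
  {p | ∃ a : Fin r → ℂ, ∃ ha : a ≠ 0, a ∈ C.fibre v ∧ p = Projectivization.mk ℂ a ha}

end CurveSingularity

namespace CurveGerm

/-- The quotient topology on the complex projective space `ℙ(ℂ^r)`. -/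
instance projTopology (r : ℕ) : TopologicalSpace (ℙ ℂ (Fin r → ℂ)) :=
  TopologicalSpace.coinduced (Projectivization.mk' ℂ) inferInstance

/-! ### The Euler characteristic -/

/-- The relative singular chain complex `C_•(X^*, *; ℝ)`, where `X^*` is the one-point
compactification of `X` and `*` is the added point. -/
def onePointChains (X : Type) [TopologicalSpace X] : ChainComplex (ModuleCat.{0} ℝ) ℕ :=
  Limits.cokernel
    (((AlgebraicTopology.singularChainComplexFunctor (ModuleCat.{0} ℝ)).obj (ModuleCat.of ℝ ℝ)).map
      (TopCat.ofHom (ContinuousMap.const PUnit.{1} (OnePoint.infty : OnePoint X))))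

/-- The homology `H_•(X^*, *; ℝ)` is finite dimensional (in total). -/
def HasFiniteHomology (X : Type) [TopologicalSpace X] : Prop :=
  (∀ q, Module.Finite ℝ ((onePointChains X).homology q)) ∧
    ∃ N, ∀ q, N ≤ q → Subsingleton ((onePointChains X).homology q)

/-- The (additive) Euler characteristic `χ(X) = ∑_q (-1)^q dim H_q(X^*, *; ℝ)`. -/
def eulerChar (X : Type) [TopologicalSpace X] : ℤ := (onePointChains X).homologyEulerChar

/-! ### Laurent series infinite in all directions -/

/-- The set `ℤ[[t_1, …, t_r, t_1⁻¹, …, t_r⁻¹]]`: families of coefficients indexed by `ℤ^r`. -/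
abbrev LaurentSeries (r : ℕ) : Type := (Fin r → ℤ) → ℤ

/-- The product of a polynomial and a Laurent series. -/
def polyMul {r : ℕ} (p : MvPolynomial (Fin r) ℤ) (L : LaurentSeries r) : LaurentSeries r :=
  fun v => ∑ m ∈ p.support, p.coeff m * L (fun i => v i - (m i : ℤ))

/-- A power series seen as a Laurent series. -/
def toLaurent {r : ℕ} (P : MvPowerSeries (Fin r) ℤ) : LaurentSeries r :=
  fun v => if ∀ i, 0 ≤ v i then
    MvPowerSeries.coeff (Finsupp.equivFunOnFinite.symm fun i => (v i).toNat) P else 0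

end CurveGerm

namespace CurveSingularity

open CurveGerm

variable {n r : ℕ} (C : CurveSingularity n r)

/-- The series `X_C(t) = ∑_v χ(ℙF_v) t^v`. -/
def eulerSeries : MvPowerSeries (Fin r) ℤ := fun v => eulerChar (C.projFibre v)

/-! ### The Poincaré series -/

/-- The ideal `J(v) = {g | v_i(g) ≥ v_i for all i}` of `𝒪_{ℂⁿ,0}` for `v ∈ ℤ^r`,
as a vector space. (The condition on `v_i` is empty if `v_i ≤ 0`.) -/
def J (v : Fin r → ℤ) : Submodule ℂ (Germ (𝓝 (0 : Fin n → ℂ)) ℂ) where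
  carrier := {g | g ∈ holoGerms n ∧ ∀ i, ((v i).toNat : ℕ∞) ≤ C.order i g}
  add_mem' := by
    rintro g g' ⟨hO, hg⟩ ⟨hO', hg'⟩
    refine ⟨(holoGerms n).add_mem hO hO', fun i => ?_⟩
    obtain ⟨f, -, hf, h⟩ := C.exists_rep hO
    obtain ⟨f', -, hf', h'⟩ := C.exists_rep hO'
    have e : C.order i (g + g') = analyticOrderAt (f ∘ C.param i + f' ∘ C.param i) 0 := by
      rw [hf, hf']
      rfl
    rw [e]
    refine le_trans (le_min ?_ ?_) le_analyticOrderAt_add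
    · rw [← (h i).2]; exact hg i
    · rw [← (h' i).2]; exact hg' i
  zero_mem' := by
    refine ⟨(holoGerms n).zero_mem, fun i => ?_⟩
    have e : C.order i 0 = analyticOrderAt (0 : ℂ → ℂ) 0 := rfl
    rw [e, analyticOrderAt_eq_top.2 (by simp)]
    exact le_top
  smul_mem' := by
    rintro c g ⟨hO, hg⟩
    refine ⟨(holoGerms n).smul_mem c hO, fun i => ?_⟩
    obtain ⟨f, -, hf, h⟩ := C.exists_rep hO
    have e : C.order i (c • g) = analyticOrderAt ((fun _ => c) * f ∘ C.param i) 0 := by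
      rw [hf]
      rfl
    rw [e, analyticOrderAt_mul analyticAt_const (h i).1, ← (h i).2]
    exact le_trans (hg i) le_add_self

/-- The space `C(v) = J(v) / J(v + 1)`, where `1 = (1, …, 1)`. -/
abbrev gradedPiece (v : Fin r → ℤ) : Type := C.J v ⧸ (C.J (v + 1)).submoduleOf (C.J v)

/-- The Laurent series `ℒ(t) = ∑_{v ∈ ℤ^r} c(v) t^v`, where `c(v) = dim J(v) / J(v + 1)`. -/
def dimSeries : LaurentSeries r := fun v => (Module.finrank ℂ (C.gradedPiece v) : ℤ)

/-- `P'_C(t) = ℒ(t) ⋅ ∏ (t_i - 1)`. -/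
def poincareNumerator : LaurentSeries r :=
  polyMul (∏ i, (MvPolynomial.X i - 1)) C.dimSeries

/-- The Poincaré series `P_C(t) = P'_C(t) / (t_1 ⋯ t_r - 1)` (for `r > 0`): here `P'_C` is regarded
as a power series, and `t_1 ⋯ t_r - 1` is a unit of `ℤ[[t_1, …, t_r]]`, with constant term `-1`. -/
def poincareSeries : MvPowerSeries (Fin r) ℤ :=
  (show MvPowerSeries (Fin r) ℤ from fun m => C.poincareNumerator fun i => (m i : ℤ)) *
    MvPowerSeries.invOfUnit ((∏ i, MvPowerSeries.X i) - 1) (-1)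

/-- The Poincaré series is characterized by `(t_1 ⋯ t_r - 1) ⋅ P_C(t) = P'_C(t)`. -/
lemma mul_poincareSeries (hr : 0 < r) :
    ((∏ i, MvPowerSeries.X i) - 1) * C.poincareSeries =
      (show MvPowerSeries (Fin r) ℤ from fun m => C.poincareNumerator fun i => (m i : ℤ)) := by
  have : Nonempty (Fin r) := ⟨⟨0, hr⟩⟩
  rw [poincareSeries, mul_left_comm, MvPowerSeries.mul_invOfUnit, mul_one]
  simp [map_prod, Finset.prod_const, hr.ne']

end CurveSingularity

end

noncomputable section

namespace EulerCalculus

section LongExactSequence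

variable {K : Type*} [DivisionRing K]

lemma finite_of_exact {X Y Z : Type*} [AddCommGroup X] [Module K X] [AddCommGroup Y] [Module K Y]
    [AddCommGroup Z] [Module K Z] {f : X →ₗ[K] Y} {g : Y →ₗ[K] Z} (h : Function.Exact f g)
    [Module.Finite K X] [Module.Finite K Z] : Module.Finite K Y := by
  have h1 : Module.Finite K (LinearMap.ker g) := by
    rw [h.linearMap_ker_eq]
    infer_instance
  have h2 : Module.Finite K (Y ⧸ LinearMap.ker g) :=
    Module.Finite.equiv g.quotKerEquivRange.symm
  exact Module.Finite.of_submodule_quotient (LinearMap.ker g)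

lemma subsingleton_of_exact {X Y Z : Type*} [AddCommGroup X] [Module K X] [AddCommGroup Y]
    [Module K Y] [AddCommGroup Z] [Module K Z] {f : X →ₗ[K] Y} {g : Y →ₗ[K] Z}
    (h : Function.Exact f g) [Subsingleton X] [Subsingleton Z] : Subsingleton Y := by
  refine ⟨fun a b => ?_⟩
  have key : ∀ y : Y, y = 0 := by
    intro y
    obtain ⟨x, rfl⟩ := (h y).1 (Subsingleton.elim _ _)
    rw [Subsingleton.elim x 0, map_zero]
  rw [key a, key b]

lemma finrank_eq_of_exact {X Y Z : Type*} [AddCommGroup X] [Module K X] [AddCommGroup Y]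
    [Module K Y] [AddCommGroup Z] [Module K Z] {f : X →ₗ[K] Y} {g : Y →ₗ[K] Z}
    (h : Function.Exact f g) [Module.Finite K Y] :
    Module.finrank K Y = Module.finrank K (LinearMap.range f) +
      Module.finrank K (LinearMap.range g) := by
  rw [← h.linearMap_ker_eq, ← g.finrank_range_add_finrank_ker, add_comm]

variable {A B C : ℕ → Type*} [∀ i, AddCommGroup (A i)] [∀ i, Module K (A i)]
  [∀ i, AddCommGroup (B i)] [∀ i, Module K (B i)] [∀ i, AddCommGroup (C i)] [∀ i, Module K (C i)]
  {f : ∀ i, A i →ₗ[K] B i} {g : ∀ i, B i →ₗ[K] C i} {δ : ∀ i, C (i + 1) →ₗ[K] A i}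

lemma sum_range_finrank_of_exact (hfg : ∀ i, Function.Exact (f i) (g i))
    (hgδ : ∀ i, Function.Exact (g (i + 1)) (δ i)) (hδf : ∀ i, Function.Exact (δ i) (f i))
    (hg : Function.Surjective (g 0)) [∀ i, Module.Finite K (A i)] [∀ i, Module.Finite K (B i)]
    [∀ i, Module.Finite K (C i)] (n : ℕ) :
    ∑ i ∈ Finset.range (n + 1), (-1 : ℤ) ^ i * ((Module.finrank K (B i) : ℤ) -
      Module.finrank K (A i) - Module.finrank K (C i)) =
      - (-1) ^ n * Module.finrank K (LinearMap.range (δ n)) := by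
  induction n with
  | zero =>
    have h0 : Module.finrank K (C 0) = Module.finrank K (LinearMap.range (g 0)) := by
      rw [LinearMap.range_eq_top.2 hg, finrank_top]
    simp only [zero_add, Finset.range_one, Finset.sum_singleton, pow_zero, one_mul, neg_mul, h0,
      finrank_eq_of_exact (hfg 0), finrank_eq_of_exact (hδf 0)]
    push_cast
    ring
  | succ n ih =>
    rw [Finset.sum_range_succ, ih, finrank_eq_of_exact (hfg (n + 1)),
      finrank_eq_of_exact (hδf (n + 1)), finrank_eq_of_exact (hgδ n)]
    push_cast
    ring

end LongExactSequence

open CategoryTheory HomologicalComplex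

/-- The chain complex `C` has finite-dimensional total homology, of Euler characteristic `k`. -/
structure HasEuler (C : ChainComplex (ModuleCat.{0} ℝ) ℕ) (k : ℤ) : Prop where
  finite : ∀ q, Module.Finite ℝ (C.homology q)
  bounded : ∃ N, ∀ q, N ≤ q → Subsingleton (C.homology q)
  eulerChar_eq : C.homologyEulerChar = k

lemma homologyEulerChar_eq_sum_range (C : ChainComplex (ModuleCat.{0} ℝ) ℕ) (N : ℕ)
    (hN : ∀ q, N ≤ q → Subsingleton (C.homology q)) :
    C.homologyEulerChar =
      ∑ i ∈ Finset.range N, (-1 : ℤ) ^ i * Module.finrank ℝ (C.homology i) := by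
  rw [homologyEulerChar_eq_sum_finSet_of_finrankSupport_subset C (Finset.range N)]
  · simp
  · intro q hq
    by_contra h
    have := hN q (by simpa using h)
    exact hq (by simp [Module.finrank_zero_of_subsingleton])

lemma HasEuler.unique {C : ChainComplex (ModuleCat.{0} ℝ) ℕ} {k l : ℤ} (h : HasEuler C k)
    (h' : HasEuler C l) : k = l := h.eulerChar_eq.symm.trans h'.eulerChar_eq

lemma HasEuler.of_iso_homology {C D : ChainComplex (ModuleCat.{0} ℝ) ℕ} {k : ℤ}
    (e : ∀ q, C.homology q ≅ D.homology q) (h : HasEuler C k) : HasEuler D k := by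
  have e' := fun q => (e q).toLinearEquiv
  obtain ⟨N, hN⟩ := h.bounded
  have hN' : ∀ q, N ≤ q → Subsingleton (D.homology q) := fun q hq =>
    have := hN q hq
    (e' q).symm.toEquiv.subsingleton
  refine ⟨fun q => ?_, ⟨N, hN'⟩, ?_⟩
  · have := h.finite q
    exact Module.Finite.equiv (e' q)
  · rw [← h.eulerChar_eq, homologyEulerChar_eq_sum_range C N hN,
      homologyEulerChar_eq_sum_range D N hN']
    exact Finset.sum_congr rfl fun q _ => by rw [(e' q).finrank_eq]

lemma HasEuler.of_iso {C D : ChainComplex (ModuleCat.{0} ℝ) ℕ} {k : ℤ} (e : C ≅ D)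
    (h : HasEuler C k) : HasEuler D k :=
  h.of_iso_homology fun q => (homologyFunctor _ _ q).mapIso e

lemma hasEuler_zero_of_acyclic {C : ChainComplex (ModuleCat.{0} ℝ) ℕ}
    (h : ∀ q, Subsingleton (C.homology q)) : HasEuler C 0 := by
  refine ⟨fun q => ?_, ⟨0, fun q _ => h q⟩, ?_⟩
  · have := h q
    infer_instance
  · rw [homologyEulerChar_eq_sum_range C 0 fun q _ => h q]
    simp

section ShortExact

variable {S : ShortComplex (ChainComplex (ModuleCat.{0} ℝ) ℕ)} (hS : S.ShortExact)

include hS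

lemma exact_homologyMap (i : ℕ) :
    Function.Exact (homologyMap S.f i).hom (homologyMap S.g i).hom :=
  (ShortComplex.ShortExact.moduleCat_exact_iff_function_exact _).1 (hS.homology_exact₂ i)

lemma exact_homologyMap_δ (i : ℕ) :
    Function.Exact (homologyMap S.g (i + 1)).hom (hS.δ (i + 1) i rfl).hom :=
  (ShortComplex.ShortExact.moduleCat_exact_iff_function_exact _).1 (hS.homology_exact₃ (i + 1) i rfl)

lemma exact_δ_homologyMap (i : ℕ) :
    Function.Exact (hS.δ (i + 1) i rfl).hom (homologyMap S.f i).hom :=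
  (ShortComplex.ShortExact.moduleCat_exact_iff_function_exact _).1 (hS.homology_exact₁ (i + 1) i rfl)

lemma surjective_homologyMap_zero : Function.Surjective (homologyMap S.g 0).hom := by
  have := hS.epi_g
  have : Epi (homologyMap S.g 0) := epi_homologyMap_of_epi_of_not_rel S.g 0 (by simp)
  exact (ModuleCat.epi_iff_surjective _).1 this

lemma eulerChar_eq_add (hA : ∀ q, Module.Finite ℝ (S.X₁.homology q))
    (hB : ∀ q, Module.Finite ℝ (S.X₂.homology q)) (hC : ∀ q, Module.Finite ℝ (S.X₃.homology q))
    {N : ℕ} (hA' : ∀ q, N ≤ q → Subsingleton (S.X₁.homology q))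
    (hB' : ∀ q, N ≤ q → Subsingleton (S.X₂.homology q))
    (hC' : ∀ q, N ≤ q → Subsingleton (S.X₃.homology q)) :
    S.X₂.homologyEulerChar = S.X₁.homologyEulerChar + S.X₃.homologyEulerChar := by
  have key := sum_range_finrank_of_exact (exact_homologyMap hS) (exact_homologyMap_δ hS)
    (exact_δ_homologyMap hS) (surjective_homologyMap_zero hS) N
  have h0 : Module.finrank ℝ (LinearMap.range (hS.δ (N + 1) N rfl).hom) = 0 := by
    have := hA' N le_rfl
    exact Module.finrank_zero_of_subsingleton
  rw [h0] at key
  rw [homologyEulerChar_eq_sum_range _ (N + 1) fun q hq => hA' q (by lia),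
    homologyEulerChar_eq_sum_range _ (N + 1) fun q hq => hB' q (by lia),
    homologyEulerChar_eq_sum_range _ (N + 1) fun q hq => hC' q (by lia),
    ← Finset.sum_add_distrib, ← sub_eq_zero, ← Finset.sum_sub_distrib]
  simp only [mul_sub, Nat.cast_zero, mul_zero] at key
  rw [← key]
  exact Finset.sum_congr rfl fun _ _ => by ring

lemma HasEuler.middle {k l : ℤ} (hA : HasEuler S.X₁ k) (hC : HasEuler S.X₃ l) :
    HasEuler S.X₂ (k + l) := by
  obtain ⟨N, hN⟩ := hA.bounded
  obtain ⟨M, hM⟩ := hC.bounded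
  have hfin : ∀ q, Module.Finite ℝ (S.X₂.homology q) := fun q => by
    have := hA.finite q
    have := hC.finite q
    exact finite_of_exact (exact_homologyMap hS q)
  have hb : ∀ q, max N M ≤ q → Subsingleton (S.X₂.homology q) := fun q hq => by
    have := hN q (by lia)
    have := hM q (by lia)
    exact subsingleton_of_exact (exact_homologyMap hS q)
  refine ⟨hfin, ⟨_, hb⟩, ?_⟩
  rw [eulerChar_eq_add hS hA.finite hfin hC.finite (fun q hq => hN q (by lia)) hb
    (fun q hq => hM q (by lia)), hA.eulerChar_eq, hC.eulerChar_eq]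

lemma HasEuler.right {k l : ℤ} (hA : HasEuler S.X₁ k) (hB : HasEuler S.X₂ l) :
    HasEuler S.X₃ (l - k) := by
  obtain ⟨N, hN⟩ := hA.bounded
  obtain ⟨M, hM⟩ := hB.bounded
  have hfin : ∀ q, Module.Finite ℝ (S.X₃.homology q) := by
    rintro (_ | q)
    · have := hB.finite 0
      exact Module.Finite.of_surjective _ (surjective_homologyMap_zero hS)
    · have := hA.finite q
      have := hB.finite (q + 1)
      exact finite_of_exact (exact_homologyMap_δ hS q)
  have hb : ∀ q, max N M + 1 ≤ q → Subsingleton (S.X₃.homology q) := by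
    rintro (_ | q) hq
    · lia
    · have := hN q (by lia)
      have := hM (q + 1) (by lia)
      exact subsingleton_of_exact (exact_homologyMap_δ hS q)
  refine ⟨hfin, ⟨_, hb⟩, ?_⟩
  rw [← hA.eulerChar_eq, ← hB.eulerChar_eq, eulerChar_eq_add hS hA.finite hB.finite hfin
    (fun q hq => hN q (by lia)) (fun q hq => hM q (by lia)) hb]
  ring

end ShortExact

end EulerCalculus

namespace Subdivision

/-! ### Formal chains of tuples of points -/

/-- Formal chains of `(n + 1)`-tuples in `V`. -/
abbrev TupleChain (V : Type*) (n : ℕ) : Type _ := (Fin (n + 1) → V) →₀ ℝ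

variable {V W : Type*}

/-- The alternating sum of faces. -/
def bdry (n : ℕ) : TupleChain V (n + 1) →ₗ[ℝ] TupleChain V n :=
  Finsupp.linearCombination ℝ fun w =>
    ∑ i : Fin (n + 2), (-1 : ℝ) ^ (i : ℕ) • Finsupp.single (w ∘ i.succAbove) 1

/-- Adding an apex as the first vertex. -/
def cone (a : V) (n : ℕ) : TupleChain V n →ₗ[ℝ] TupleChain V (n + 1) :=
  Finsupp.lmapDomain ℝ ℝ fun w => (Fin.cons a w : Fin (n + 2) → V)

/-- Functoriality of formal chains. -/
def mapTuple (f : V → W) (n : ℕ) : TupleChain V n →ₗ[ℝ] TupleChain W n :=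
  Finsupp.lmapDomain ℝ ℝ fun w => f ∘ w

@[simp] lemma bdry_single (n : ℕ) (w : Fin (n + 2) → V) :
    bdry n (Finsupp.single w 1) =
      ∑ i : Fin (n + 2), (-1 : ℝ) ^ (i : ℕ) • Finsupp.single (w ∘ i.succAbove) 1 := by
  simp [bdry]

@[simp] lemma cone_single (a : V) (n : ℕ) (w : Fin (n + 1) → V) :
    cone a n (Finsupp.single w 1) = Finsupp.single (Fin.cons a w : Fin (n + 2) → V) 1 := by
  simp [cone]

@[simp] lemma mapTuple_single (f : V → W) (n : ℕ) (w : Fin (n + 1) → V) :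
    mapTuple f n (Finsupp.single w 1) = Finsupp.single (f ∘ w) 1 := by
  simp [mapTuple]

lemma cons_comp_succAbove_succ (a : V) (n : ℕ) (w : Fin (n + 2) → V) (i : Fin (n + 2)) :
    (Fin.cons a w : Fin (n + 3) → V) ∘ i.succ.succAbove =
      (Fin.cons a (w ∘ i.succAbove) : Fin (n + 2) → V) := by
  funext j
  refine Fin.cases ?_ (fun j => ?_) j <;> simp

lemma bdry_cone_succ (a : V) (n : ℕ) (c : TupleChain V (n + 1)) :
    bdry (n + 1) (cone a (n + 1) c) = c - cone a n (bdry n c) := by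
  suffices h : bdry (n + 1) ∘ₗ cone a (n + 1) = LinearMap.id - cone a n ∘ₗ bdry n from
    LinearMap.congr_fun h c
  refine Finsupp.lhom_ext' fun w => LinearMap.ext_ring ?_
  simp only [LinearMap.comp_apply, Finsupp.lsingle_apply, cone_single, bdry_single,
    LinearMap.sub_apply, LinearMap.id_apply, map_sum, map_smul]
  rw [Fin.sum_univ_succ]
  simp only [cons_comp_succAbove_succ, Fin.val_succ, pow_succ, mul_neg, mul_one, neg_smul,
    Finset.sum_neg_distrib, ← sub_eq_add_neg]
  congr 1
  simp [Function.comp_def]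

lemma bdry_cone_zero (a : V) (c : TupleChain V 0) :
    bdry 0 (cone a 0 c) = c - (c.sum fun _ r => r) • Finsupp.single (fun _ => a) 1 := by
  induction c using Finsupp.induction_linear with
  | zero => simp
  | add c d hc hd =>
    rw [map_add, map_add, hc, hd, Finsupp.sum_add_index' (by simp) (by simp), add_smul]
    abel
  | single w r =>
    rw [← mul_one r, ← smul_eq_mul, ← Finsupp.smul_single, map_smul, map_smul, cone_single,
      bdry_single, Finsupp.sum_smul_index (by simp), Finsupp.sum_single_index (by simp), mul_one,
      ← smul_sub]
    congr 1
    rw [Fin.sum_univ_two]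
    have h1 : (Fin.cons a w : Fin 2 → V) ∘ (0 : Fin 2).succAbove = w := by
      funext j; simp
    have h2 : (Fin.cons a w : Fin 2 → V) ∘ (1 : Fin 2).succAbove = fun _ => a := by
      funext j
      rw [Subsingleton.elim j 0]
      rfl
    rw [h1, h2]
    simp [sub_eq_add_neg]

lemma sum_bdry_zero (c : TupleChain V 1) : ((bdry 0 c).sum fun _ r => r) = 0 := by
  induction c using Finsupp.induction_linear with
  | zero => simp
  | add c d hc hd => rw [map_add, Finsupp.sum_add_index' (by simp) (by simp), hc, hd, add_zero]
  | single w r =>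
    rw [← mul_one r, ← smul_eq_mul, ← Finsupp.smul_single, map_smul, bdry_single,
      Finsupp.sum_smul_index (by simp), Fin.sum_univ_two,
      Finsupp.sum_add_index' (by simp) (by intros; ring), Finsupp.sum_smul_index (by simp),
      Finsupp.sum_smul_index (by simp)]
    simp

lemma bdry_bdry (n : ℕ) (c : TupleChain V (n + 2)) : bdry n (bdry (n + 1) c) = 0 := by
  suffices h : bdry n ∘ₗ bdry (n + 1) = (0 : TupleChain V (n + 2) →ₗ[ℝ] _) from
    LinearMap.congr_fun h c
  clear c
  refine Finsupp.lhom_ext' fun w => LinearMap.ext_ring ?_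
  induction n with
  | zero =>
    obtain ⟨a, w, rfl⟩ : ∃ a w', w = Fin.cons a w' := ⟨w 0, Fin.tail w, (Fin.cons_self_tail w).symm⟩
    rw [LinearMap.comp_apply, LinearMap.comp_apply, Finsupp.lsingle_apply, ← cone_single,
      bdry_cone_succ, map_sub, bdry_cone_zero, sum_bdry_zero]
    simp
  | succ n ih =>
    obtain ⟨a, w, rfl⟩ : ∃ a w', w = Fin.cons a w' := ⟨w 0, Fin.tail w, (Fin.cons_self_tail w).symm⟩
    have h := ih w
    simp only [LinearMap.comp_apply, Finsupp.lsingle_apply, LinearMap.zero_apply] at h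
    rw [LinearMap.comp_apply, LinearMap.comp_apply, Finsupp.lsingle_apply, ← cone_single,
      bdry_cone_succ, map_sub, bdry_cone_succ, h]
    simp

variable (b : ∀ n, (Fin (n + 1) → V) → V) (b' : ∀ n, (Fin (n + 1) → W) → W)

/-- The subdivision operator, with respect to a choice `b` of apices. -/
def sd : ∀ n, TupleChain V n →ₗ[ℝ] TupleChain V n
  | 0 => LinearMap.id
  | n + 1 => Finsupp.linearCombination ℝ fun w =>
      cone (b (n + 1) w) n (sd n (bdry n (Finsupp.single w 1)))

/-- The chain homotopy between the identity and the subdivision operator. -/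
def sdHomotopy : ∀ n, TupleChain V n →ₗ[ℝ] TupleChain V (n + 1)
  | 0 => 0
  | n + 1 => Finsupp.linearCombination ℝ fun w =>
      cone (b (n + 1) w) (n + 1)
        (Finsupp.single w 1 - sdHomotopy n (bdry n (Finsupp.single w 1)))

@[simp] lemma sd_zero (c : TupleChain V 0) : sd b 0 c = c := rfl

lemma sd_succ_single (n : ℕ) (w : Fin (n + 2) → V) :
    sd b (n + 1) (Finsupp.single w 1) =
      cone (b (n + 1) w) n (sd b n (bdry n (Finsupp.single w 1))) := by
  rw [sd, Finsupp.linearCombination_single, one_smul]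

@[simp] lemma sdHomotopy_zero (c : TupleChain V 0) : sdHomotopy b 0 c = 0 := rfl

lemma sdHomotopy_succ_single (n : ℕ) (w : Fin (n + 2) → V) :
    sdHomotopy b (n + 1) (Finsupp.single w 1) = cone (b (n + 1) w) (n + 1)
        (Finsupp.single w 1 - sdHomotopy b n (bdry n (Finsupp.single w 1))) := by
  rw [sdHomotopy, Finsupp.linearCombination_single, one_smul]

lemma bdry_sd (n : ℕ) (c : TupleChain V (n + 1)) :
    bdry n (sd b (n + 1) c) = sd b n (bdry n c) := by
  induction n with
  | zero =>
    suffices h : bdry 0 ∘ₗ sd b 1 = sd b 0 ∘ₗ bdry 0 from LinearMap.congr_fun h c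
    refine Finsupp.lhom_ext' fun w => LinearMap.ext_ring ?_
    simp only [LinearMap.comp_apply, Finsupp.lsingle_apply, sd_succ_single, bdry_cone_zero, sd_zero,
      sum_bdry_zero, zero_smul, sub_zero]
  | succ n ih =>
    suffices h : bdry (n + 1) ∘ₗ sd b (n + 2) = sd b (n + 1) ∘ₗ bdry (n + 1) from
      LinearMap.congr_fun h c
    refine Finsupp.lhom_ext' fun w => LinearMap.ext_ring ?_
    simp only [LinearMap.comp_apply, Finsupp.lsingle_apply]
    rw [sd_succ_single, bdry_cone_succ, ih, bdry_bdry, map_zero, map_zero, sub_zero]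

lemma bdry_sdHomotopy_zero (c : TupleChain V 0) :
    bdry 0 (sdHomotopy b 0 c) = c - sd b 0 c := by
  simp

lemma bdry_sdHomotopy_succ (n : ℕ) (c : TupleChain V (n + 1)) :
    bdry (n + 1) (sdHomotopy b (n + 1) c) + sdHomotopy b n (bdry n c) = c - sd b (n + 1) c := by
  suffices h : bdry (n + 1) ∘ₗ sdHomotopy b (n + 1) + sdHomotopy b n ∘ₗ bdry n =
      LinearMap.id - sd b (n + 1) from LinearMap.congr_fun h c
  refine Finsupp.lhom_ext' fun w => LinearMap.ext_ring ?_
  have key : bdry n (sdHomotopy b n (bdry n (Finsupp.single w 1))) =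
      bdry n (Finsupp.single w 1) - sd b n (bdry n (Finsupp.single w 1)) := by
    cases n with
    | zero => simp
    | succ n =>
      have h := bdry_sdHomotopy_succ n (bdry (n + 1) (Finsupp.single w 1))
      rwa [bdry_bdry, map_zero, add_zero] at h
  simp only [LinearMap.comp_apply, Finsupp.lsingle_apply, LinearMap.add_apply, LinearMap.sub_apply,
    LinearMap.id_apply]
  rw [sdHomotopy_succ_single, sd_succ_single, bdry_cone_succ, map_sub, key]
  simp only [sub_sub_cancel]
  abel

section Naturality

variable {b b'} {f : V → W}

lemma mapTuple_bdry (f : V → W) (n : ℕ) (c : TupleChain V (n + 1)) :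
    mapTuple f n (bdry n c) = bdry n (mapTuple f (n + 1) c) := by
  suffices h : mapTuple f n ∘ₗ bdry n = bdry n ∘ₗ mapTuple f (n + 1) from LinearMap.congr_fun h c
  refine Finsupp.lhom_ext' fun w => LinearMap.ext_ring ?_
  simp only [LinearMap.comp_apply, Finsupp.lsingle_apply, bdry_single, map_sum, map_smul,
    mapTuple_single, Function.comp_assoc]

lemma mapTuple_cone (f : V → W) (a : V) (n : ℕ) (c : TupleChain V n) :
    mapTuple f (n + 1) (cone a n c) = cone (f a) n (mapTuple f n c) := by
  suffices h : mapTuple f (n + 1) ∘ₗ cone a n = cone (f a) n ∘ₗ mapTuple f n from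
    LinearMap.congr_fun h c
  refine Finsupp.lhom_ext' fun w => LinearMap.ext_ring ?_
  simp only [LinearMap.comp_apply, Finsupp.lsingle_apply, mapTuple_single, cone_single]
  congr 1
  funext j
  refine Fin.cases ?_ (fun j => ?_) j <;> simp

lemma mapTuple_sd (hf : ∀ n w, f (b n w) = b' n (f ∘ w)) (n : ℕ) (c : TupleChain V n) :
    mapTuple f n (sd b n c) = sd b' n (mapTuple f n c) := by
  induction n with
  | zero => rfl
  | succ n ih =>
    suffices h : mapTuple f (n + 1) ∘ₗ sd b (n + 1) = sd b' (n + 1) ∘ₗ mapTuple f (n + 1) from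
      LinearMap.congr_fun h c
    refine Finsupp.lhom_ext' fun w => LinearMap.ext_ring ?_
    simp only [LinearMap.comp_apply, Finsupp.lsingle_apply]
    rw [mapTuple_single, sd_succ_single, sd_succ_single, mapTuple_cone, ih, mapTuple_bdry,
      mapTuple_single, hf]

lemma mapTuple_sdHomotopy (hf : ∀ n w, f (b n w) = b' n (f ∘ w)) (n : ℕ) (c : TupleChain V n) :
    mapTuple f (n + 1) (sdHomotopy b n c) = sdHomotopy b' n (mapTuple f n c) := by
  induction n with
  | zero => simp
  | succ n ih =>
    suffices h : mapTuple f (n + 2) ∘ₗ sdHomotopy b (n + 1) =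
      sdHomotopy b' (n + 1) ∘ₗ mapTuple f (n + 1) from LinearMap.congr_fun h c
    refine Finsupp.lhom_ext' fun w => LinearMap.ext_ring ?_
    simp only [LinearMap.comp_apply, Finsupp.lsingle_apply]
    rw [mapTuple_single, sdHomotopy_succ_single, sdHomotopy_succ_single, mapTuple_cone, map_sub, ih,
      mapTuple_bdry, mapTuple_single, hf]

end Naturality

end Subdivision

namespace Subdivision

/-! ### Affine maps between standard simplices -/

/-- The topological standard simplex of dimension `n`. -/
abbrev Simplex (n : ℕ) : Type := stdSimplex ℝ (Fin (n + 1))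

/-- The affine map between standard simplices with given values on the vertices. -/
def affineMap {n m : ℕ} (w : Fin (n + 1) → Simplex m) : C(Simplex n, Simplex m) where
  toFun x := ⟨fun j => ∑ i, x i * w i j,
    fun j => Finset.sum_nonneg fun i _ => mul_nonneg (x.2.1 i) ((w i).2.1 j), by
      rw [Finset.sum_comm]
      simp_rw [← Finset.mul_sum, stdSimplex.sum_eq_one, mul_one]
      exact x.2.2⟩
  continuous_toFun := by
    refine Continuous.subtype_mk (continuous_pi fun j => continuous_finsetSum _ fun i _ => ?_) _
    exact (((continuous_apply i).comp continuous_subtype_val).mul continuous_const)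

lemma affineMap_apply {n m : ℕ} (w : Fin (n + 1) → Simplex m) (x : Simplex n) (j : Fin (m + 1)) :
    affineMap w x j = ∑ i, x i * w i j := rfl

/-- The vertices of the standard simplex. -/
def vert (n : ℕ) : Fin (n + 1) → Simplex n := fun i => stdSimplex.vertex i

lemma affineMap_vert (n : ℕ) : affineMap (vert n) = ContinuousMap.id _ := by
  ext x j
  rw [affineMap_apply]
  simp [vert, Pi.single_apply]

lemma affineMap_apply_vert {n m : ℕ} (w : Fin (n + 1) → Simplex m) : affineMap w ∘ vert n = w := by
  funext i
  ext j
  rw [Function.comp_apply, affineMap_apply]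
  simp [vert, Pi.single_apply]

lemma affineMap_comp {n m k : ℕ} (u : Fin (m + 1) → Simplex k) (w : Fin (n + 1) → Simplex m) :
    (affineMap u).comp (affineMap w) = affineMap (affineMap u ∘ w) := by
  ext x j
  simp only [ContinuousMap.comp_apply, affineMap_apply, Function.comp_apply, Finset.sum_mul,
    Finset.mul_sum]
  rw [Finset.sum_comm]
  simp only [mul_assoc]

/-- The inclusion of a face of the standard simplex. -/
def face {n : ℕ} (i : Fin (n + 2)) : C(Simplex n, Simplex (n + 1)) :=
  ⟨stdSimplex.map i.succAbove, stdSimplex.continuous_map _⟩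

lemma face_eq {n : ℕ} (i : Fin (n + 2)) : face i = affineMap (vert (n + 1) ∘ i.succAbove) := by
  ext x j
  rw [affineMap_apply]
  change FunOnFinite.linearMap ℝ ℝ i.succAbove x j = _
  rw [FunOnFinite.linearMap_apply_apply, Finset.sum_filter]
  refine Finset.sum_congr rfl fun k _ => ?_
  simp [vert, Pi.single_apply, eq_comm]

lemma affineMap_comp_face {n m : ℕ} (w : Fin (n + 2) → Simplex m) (i : Fin (n + 2)) :
    (affineMap w).comp (face i) = affineMap (w ∘ i.succAbove) := by
  rw [face_eq, affineMap_comp, ← Function.comp_assoc, affineMap_apply_vert]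

/-- The barycentre of a tuple of points of a standard simplex. -/
def bary (m n : ℕ) (w : Fin (n + 1) → Simplex m) : Simplex m := affineMap w stdSimplex.barycenter

lemma affineMap_bary {m k : ℕ} (u : Fin (m + 1) → Simplex k) (n : ℕ) (w : Fin (n + 1) → Simplex m) :
    affineMap u (bary m n w) = bary k n (affineMap u ∘ w) := by
  rw [bary, bary, ← affineMap_comp]
  rfl

/-! ### Estimates for the diameters of the simplices of the subdivision -/

lemma dist_affineMap_le {n m : ℕ} (w : Fin (n + 1) → Simplex m) (x : Simplex n) (p : Simplex m)
    {D : ℝ} (h : ∀ i, dist (w i) p ≤ D) : dist (affineMap w x) p ≤ D := by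
  have hD : 0 ≤ D := dist_nonneg.trans (h 0)
  rw [Subtype.dist_eq, dist_pi_le_iff hD]
  intro j
  have h1 : (affineMap w x : Simplex m).1 j - p.1 j = ∑ i, x i * (w i j - p j) := by
    simp_rw [mul_sub, Finset.sum_sub_distrib, ← Finset.sum_mul, stdSimplex.sum_eq_one, one_mul]
    rfl
  rw [Real.dist_eq, h1]
  calc |∑ i, x i * (w i j - p j)| ≤ ∑ i, |x i * (w i j - p j)| := Finset.abs_sum_le_sum_abs _ _
    _ ≤ ∑ i, x i * D := by
      refine Finset.sum_le_sum fun i _ => ?_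
      rw [abs_mul, abs_of_nonneg (stdSimplex.zero_le x i)]
      refine mul_le_mul_of_nonneg_left ?_ (stdSimplex.zero_le x i)
      have h2 := h i
      rw [Subtype.dist_eq, dist_pi_le_iff hD] at h2
      exact h2 j
    _ = D := by rw [← Finset.sum_mul, stdSimplex.sum_eq_one, one_mul]

lemma dist_bary_le {n m : ℕ} (w : Fin (n + 1) → Simplex m) (k : Fin (n + 1))
    {D : ℝ} (h : ∀ i j, dist (w i) (w j) ≤ D) : dist (bary m n w) (w k) ≤ n / (n + 1) * D := by
  have hD : 0 ≤ D := dist_nonneg.trans (h 0 0)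
  have hnD : 0 ≤ n / (n + 1) * D := by positivity
  rw [Subtype.dist_eq, dist_pi_le_iff hnD]
  intro j
  have h1 : (bary m n w : Simplex m).1 j - (w k).1 j =
      ∑ i, ((n : ℝ) + 1)⁻¹ * (w i j - w k j) := by
    rw [← Finset.mul_sum, Finset.sum_sub_distrib, mul_sub]
    congr 1
    · change ∑ i, (stdSimplex.barycenter : Simplex n) i * w i j = _
      rw [Finset.mul_sum]
      refine Finset.sum_congr rfl fun i _ => ?_
      congr 1
      change ((Fintype.card (Fin (n + 1)) : ℝ))⁻¹ = _
      simp
    · simp only [Finset.sum_const, Finset.card_univ, Fintype.card_fin, nsmul_eq_mul]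
      push_cast
      field_simp
      rfl
  rw [Real.dist_eq, h1, ← Finset.mul_sum, ← Finset.add_sum_erase _ _ (Finset.mem_univ k), sub_self,
    zero_add, abs_mul, abs_of_nonneg (by positivity)]
  calc ((n : ℝ) + 1)⁻¹ * |∑ i ∈ Finset.univ.erase k, (w i j - w k j)|
      ≤ ((n : ℝ) + 1)⁻¹ * ∑ i ∈ Finset.univ.erase k, D := by
        refine mul_le_mul_of_nonneg_left ?_ (by positivity)
        refine (Finset.abs_sum_le_sum_abs _ _).trans (Finset.sum_le_sum fun i _ => ?_)
        have h2 := h i k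
        rw [Subtype.dist_eq, dist_pi_le_iff hD] at h2
        exact h2 j
    _ = n / (n + 1) * D := by
        simp only [Finset.sum_const, Finset.card_erase_of_mem (Finset.mem_univ k), Finset.card_univ,
          Fintype.card_fin, Nat.add_sub_cancel, nsmul_eq_mul]
        ring

/-- The tuples with vertices in the hull of `w` and diameter at most `D`. -/
def smallTuples {n m : ℕ} (w : Fin (n + 1) → Simplex m) (D : ℝ) (l : ℕ) :
    Set (Fin (l + 1) → Simplex m) :=
  {u | (∀ j, u j ∈ Set.range (affineMap w)) ∧ ∀ i j, dist (u i) (u j) ≤ D}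

lemma sd_mem_supported {m : ℕ} (n : ℕ) (w : Fin (n + 1) → Simplex m) {D : ℝ}
    (h : ∀ i j, dist (w i) (w j) ≤ D) :
    sd (bary m) n (Finsupp.single w 1) ∈
      Finsupp.supported ℝ ℝ (smallTuples w (n / (n + 1) * D) n) := by
  induction n with
  | zero =>
    refine Finsupp.single_mem_supported ℝ 1 ⟨fun j => ⟨vert 0 j, congr_fun (affineMap_apply_vert w) j⟩,
      fun i j => ?_⟩
    rw [Subsingleton.elim (α := Fin 1) i j]
    simp
  | succ n ih =>
    have hD : 0 ≤ D := dist_nonneg.trans (h 0 0)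
    rw [sd_succ_single, bdry_single, map_sum, map_sum]
    refine Submodule.sum_mem _ fun i _ => ?_
    rw [map_smul, map_smul]
    refine Submodule.smul_mem _ _ ?_
    have h1 := ih (w ∘ i.succAbove) fun _ _ => h _ _
    generalize sd (bary m) n (Finsupp.single (w ∘ i.succAbove) 1) = c at h1
    intro u hu
    obtain ⟨u', hu', rfl⟩ := Finset.mem_image.1 (Finsupp.mapDomain_support hu)
    obtain ⟨h2, h3⟩ := h1 hu'
    have h4 : ∀ j, u' j ∈ Set.range (affineMap w) := fun j => by
      obtain ⟨x, hx⟩ := h2 j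
      refine ⟨face i x, ?_⟩
      rw [← hx, ← affineMap_comp_face]
      rfl
    have h5 : ∀ j, dist (bary m (n + 1) w) (u' j) ≤ ((n + 1 : ℕ) : ℝ) / ((n + 1 : ℕ) + 1) * D := by
      intro j
      obtain ⟨x, hx⟩ := h4 j
      rw [← hx, dist_comm]
      refine dist_affineMap_le _ _ _ fun k => ?_
      rw [dist_comm]
      exact dist_bary_le w k h
    refine ⟨fun j => ?_, fun j k => ?_⟩
    · refine Fin.cases ?_ (fun j => ?_) j
      · exact ⟨_, rfl⟩
      · simpa using h4 j
    · refine Fin.cases ?_ (fun j => ?_) j <;> refine Fin.cases ?_ (fun k => ?_) k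
      · simp only [Fin.cons_zero, dist_self]
        positivity
      · simpa using h5 k
      · rw [dist_comm]
        simpa using h5 j
      · simp only [Fin.cons_succ]
        refine (h3 j k).trans (mul_le_mul_of_nonneg_right ?_ hD)
        rw [div_le_div_iff₀ (by positivity) (by positivity)]
        push_cast
        nlinarith

lemma sd_pow_mem_supported (n N : ℕ) :
    ((sd (bary n) n)^[N]) (Finsupp.single (vert n) 1) ∈
      Finsupp.supported ℝ ℝ {u : Fin (n + 1) → Simplex n |
        ∀ i j, dist (u i) (u j) ≤ ((n : ℝ) / (n + 1)) ^ N * Metric.diam (Set.univ : Set (Simplex n))} := by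
  induction N with
  | zero =>
    refine Finsupp.single_mem_supported ℝ 1 fun i j => ?_
    rw [pow_zero, one_mul]
    exact Metric.dist_le_diam_of_mem isCompact_univ.isBounded (Set.mem_univ _) (Set.mem_univ _)
  | succ N ih =>
    rw [Function.iterate_succ_apply']
    generalize ((sd (bary n) n)^[N]) (Finsupp.single (vert n) 1) = c at ih
    have hc : c = ∑ w ∈ c.support, c w • Finsupp.single w 1 := by
      conv_lhs => rw [← Finsupp.sum_single c]
      simp [Finsupp.sum]
    rw [hc, map_sum]
    refine Submodule.sum_mem _ fun w hw => ?_
    rw [map_smul]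
    refine Submodule.smul_mem _ _ (Finsupp.supported_mono ?_ (sd_mem_supported n w (ih hw)))
    rintro u ⟨-, hu⟩ i j
    refine (hu i j).trans_eq ?_
    rw [pow_succ]
    ring

end Subdivision

namespace Subdivision

/-! ### Singular chains and small simplices -/

/-- Singular chains with real coefficients. -/
abbrev SingChain (X : Type*) [TopologicalSpace X] (n : ℕ) : Type _ := C(Simplex n, X) →₀ ℝ

variable {X : Type*} [TopologicalSpace X]

/-- The boundary of singular chains. -/
def singBdry (X : Type*) [TopologicalSpace X] (n : ℕ) : SingChain X (n + 1) →ₗ[ℝ] SingChain X n :=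
  Finsupp.linearCombination ℝ fun σ =>
    ∑ i : Fin (n + 2), (-1 : ℝ) ^ (i : ℕ) • Finsupp.single (σ.comp (face i)) 1

@[simp] lemma singBdry_single (n : ℕ) (σ : C(Simplex (n + 1), X)) :
    singBdry X n (Finsupp.single σ 1) =
      ∑ i : Fin (n + 2), (-1 : ℝ) ^ (i : ℕ) • Finsupp.single (σ.comp (face i)) 1 := by
  simp [singBdry]

/-- The singular chain obtained by restricting `σ` to the affine simplices of a chain. -/
def restrict {m : ℕ} (σ : C(Simplex m, X)) (n : ℕ) : TupleChain (Simplex m) n →ₗ[ℝ] SingChain X n :=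
  Finsupp.lmapDomain ℝ ℝ fun w => σ.comp (affineMap w)

@[simp] lemma restrict_single {m : ℕ} (σ : C(Simplex m, X)) (n : ℕ) (w : Fin (n + 1) → Simplex m) :
    restrict σ n (Finsupp.single w 1) = Finsupp.single (σ.comp (affineMap w)) 1 := by
  simp [restrict]

lemma restrict_vert {m : ℕ} (σ : C(Simplex m, X)) :
    restrict σ m (Finsupp.single (vert m) 1) = Finsupp.single σ 1 := by
  rw [restrict_single, affineMap_vert, ContinuousMap.comp_id]

lemma singBdry_restrict {m : ℕ} (σ : C(Simplex m, X)) (n : ℕ)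
    (c : TupleChain (Simplex m) (n + 1)) :
    singBdry X n (restrict σ (n + 1) c) = restrict σ n (bdry n c) := by
  suffices h : singBdry X n ∘ₗ restrict σ (n + 1) = restrict σ n ∘ₗ bdry n from
    LinearMap.congr_fun h c
  refine Finsupp.lhom_ext' fun w => LinearMap.ext_ring ?_
  simp only [LinearMap.comp_apply, Finsupp.lsingle_apply, bdry_single, map_sum, map_smul,
    restrict_single, singBdry_single, ContinuousMap.comp_assoc, affineMap_comp_face]

lemma restrict_comp_affineMap {m k : ℕ} (σ : C(Simplex m, X)) (w : Fin (k + 1) → Simplex m) (n : ℕ)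
    (c : TupleChain (Simplex k) n) :
    restrict (σ.comp (affineMap w)) n c = restrict σ n (mapTuple (affineMap w) n c) := by
  suffices h : restrict (σ.comp (affineMap w)) n = restrict σ n ∘ₗ mapTuple (affineMap w) n from
    LinearMap.congr_fun h c
  refine Finsupp.lhom_ext' fun u => LinearMap.ext_ring ?_
  simp only [LinearMap.comp_apply, Finsupp.lsingle_apply, restrict_single, mapTuple_single,
    ContinuousMap.comp_assoc, affineMap_comp]

/-- Barycentric subdivision of singular chains. -/
def singSd (X : Type*) [TopologicalSpace X] (n : ℕ) : SingChain X n →ₗ[ℝ] SingChain X n :=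
  Finsupp.linearCombination ℝ fun σ =>
    restrict σ n (sd (bary n) n (Finsupp.single (vert n) 1))

/-- The chain homotopy between the identity and barycentric subdivision. -/
def singSdHomotopy (X : Type*) [TopologicalSpace X] (n : ℕ) :
    SingChain X n →ₗ[ℝ] SingChain X (n + 1) :=
  Finsupp.linearCombination ℝ fun σ =>
    restrict σ (n + 1) (sdHomotopy (bary n) n (Finsupp.single (vert n) 1))

lemma singSd_single (n : ℕ) (σ : C(Simplex n, X)) : singSd X n (Finsupp.single σ 1) =
    restrict σ n (sd (bary n) n (Finsupp.single (vert n) 1)) := by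
  simp [singSd]

lemma singSdHomotopy_single (n : ℕ) (σ : C(Simplex n, X)) :
    singSdHomotopy X n (Finsupp.single σ 1) =
      restrict σ (n + 1) (sdHomotopy (bary n) n (Finsupp.single (vert n) 1)) := by
  simp [singSdHomotopy]

lemma singSd_restrict {m : ℕ} (σ : C(Simplex m, X)) (n : ℕ) (c : TupleChain (Simplex m) n) :
    singSd X n (restrict σ n c) = restrict σ n (sd (bary m) n c) := by
  suffices h : singSd X n ∘ₗ restrict σ n = restrict σ n ∘ₗ sd (bary m) n from
    LinearMap.congr_fun h c
  refine Finsupp.lhom_ext' fun w => LinearMap.ext_ring ?_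
  simp only [LinearMap.comp_apply, Finsupp.lsingle_apply, restrict_single, singSd_single]
  rw [restrict_comp_affineMap, mapTuple_sd (fun k u => affineMap_bary w k u), mapTuple_single,
    affineMap_apply_vert]

lemma singSdHomotopy_restrict {m : ℕ} (σ : C(Simplex m, X)) (n : ℕ)
    (c : TupleChain (Simplex m) n) :
    singSdHomotopy X n (restrict σ n c) = restrict σ (n + 1) (sdHomotopy (bary m) n c) := by
  suffices h : singSdHomotopy X n ∘ₗ restrict σ n = restrict σ (n + 1) ∘ₗ sdHomotopy (bary m) n from
    LinearMap.congr_fun h c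
  refine Finsupp.lhom_ext' fun w => LinearMap.ext_ring ?_
  simp only [LinearMap.comp_apply, Finsupp.lsingle_apply, restrict_single, singSdHomotopy_single]
  rw [restrict_comp_affineMap, mapTuple_sdHomotopy (fun k u => affineMap_bary w k u),
    mapTuple_single, affineMap_apply_vert]

lemma singChain_ext {n : ℕ} {M : Type*} [AddCommGroup M] [Module ℝ M]
    {f g : SingChain X n →ₗ[ℝ] M}
    (h : ∀ σ : C(Simplex n, X), f (restrict σ n (Finsupp.single (vert n) 1)) =
      g (restrict σ n (Finsupp.single (vert n) 1))) : f = g := by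
  refine Finsupp.lhom_ext' fun σ => LinearMap.ext_ring ?_
  simp only [LinearMap.comp_apply, Finsupp.lsingle_apply, ← restrict_vert, h]

lemma singBdry_singBdry (n : ℕ) (c : SingChain X (n + 2)) :
    singBdry X n (singBdry X (n + 1) c) = 0 := by
  suffices h : singBdry X n ∘ₗ singBdry X (n + 1) = 0 from LinearMap.congr_fun h c
  refine singChain_ext fun σ => ?_
  simp only [LinearMap.comp_apply, singBdry_restrict, bdry_bdry, map_zero, LinearMap.zero_apply]

lemma singBdry_singSd (n : ℕ) (c : SingChain X (n + 1)) :
    singBdry X n (singSd X (n + 1) c) = singSd X n (singBdry X n c) := by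
  suffices h : singBdry X n ∘ₗ singSd X (n + 1) = singSd X n ∘ₗ singBdry X n from
    LinearMap.congr_fun h c
  refine singChain_ext fun σ => ?_
  simp only [LinearMap.comp_apply, singBdry_restrict, singSd_restrict, bdry_sd]

lemma singBdry_singSdHomotopy_zero (c : SingChain X 0) :
    singBdry X 0 (singSdHomotopy X 0 c) = c - singSd X 0 c := by
  suffices h : singBdry X 0 ∘ₗ singSdHomotopy X 0 = LinearMap.id - singSd X 0 from
    LinearMap.congr_fun h c
  refine singChain_ext fun σ => ?_
  simp only [LinearMap.comp_apply, singSdHomotopy_restrict, singBdry_restrict,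
    bdry_sdHomotopy_zero, LinearMap.sub_apply, LinearMap.id_apply, singSd_restrict, map_sub]

lemma singBdry_singSdHomotopy_succ (n : ℕ) (c : SingChain X (n + 1)) :
    singBdry X (n + 1) (singSdHomotopy X (n + 1) c) + singSdHomotopy X n (singBdry X n c) =
      c - singSd X (n + 1) c := by
  suffices h : singBdry X (n + 1) ∘ₗ singSdHomotopy X (n + 1) + singSdHomotopy X n ∘ₗ singBdry X n =
      LinearMap.id - singSd X (n + 1) from LinearMap.congr_fun h c
  refine singChain_ext fun σ => ?_
  simp only [LinearMap.add_apply, LinearMap.comp_apply, singSdHomotopy_restrict, singBdry_restrict,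
    LinearMap.sub_apply, LinearMap.id_apply, singSd_restrict]
  rw [← map_add, bdry_sdHomotopy_succ, map_sub]

/-- Singular chains supported in a subset. -/
def chainsIn (U : Set X) (n : ℕ) : Submodule ℝ (SingChain X n) :=
  Finsupp.supported ℝ ℝ {σ | ∀ x, σ x ∈ U}

lemma restrict_mem_chainsIn {U : Set X} {m : ℕ} {σ : C(Simplex m, X)} (hσ : ∀ x, σ x ∈ U) (n : ℕ)
    (c : TupleChain (Simplex m) n) : restrict σ n c ∈ chainsIn U n := by
  classical
  intro τ hτ
  obtain ⟨w, -, rfl⟩ := Finset.mem_image.1 (Finsupp.mapDomain_support hτ)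
  exact fun x => hσ _

lemma map_mem_chainsIn {U : Set X} {n k : ℕ} {f : SingChain X n →ₗ[ℝ] SingChain X k}
    (hf : ∀ σ : C(Simplex n, X), (∀ x, σ x ∈ U) → f (Finsupp.single σ 1) ∈ chainsIn U k)
    {c : SingChain X n} (hc : c ∈ chainsIn U n) : f c ∈ chainsIn U k := by
  have h : c = ∑ σ ∈ c.support, c σ • Finsupp.single σ 1 := by
    conv_lhs => rw [← Finsupp.sum_single c]
    simp [Finsupp.sum]
  rw [h, map_sum]
  refine Submodule.sum_mem _ fun σ hσ => ?_
  rw [map_smul]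
  exact Submodule.smul_mem _ _ (hf σ (hc hσ))

lemma singBdry_mem_chainsIn {U : Set X} {n : ℕ} {c : SingChain X (n + 1)}
    (hc : c ∈ chainsIn U (n + 1)) : singBdry X n c ∈ chainsIn U n := by
  refine map_mem_chainsIn (fun σ hσ => ?_) hc
  rw [← restrict_vert, singBdry_restrict]
  exact restrict_mem_chainsIn hσ _ _

lemma singSd_mem_chainsIn {U : Set X} {n : ℕ} {c : SingChain X n}
    (hc : c ∈ chainsIn U n) : singSd X n c ∈ chainsIn U n := by
  refine map_mem_chainsIn (fun σ hσ => ?_) hc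
  rw [singSd_single]
  exact restrict_mem_chainsIn hσ _ _

lemma singSdHomotopy_mem_chainsIn {U : Set X} {n : ℕ} {c : SingChain X n}
    (hc : c ∈ chainsIn U n) : singSdHomotopy X n c ∈ chainsIn U (n + 1) := by
  refine map_mem_chainsIn (fun σ hσ => ?_) hc
  rw [singSdHomotopy_single]
  exact restrict_mem_chainsIn hσ _ _

lemma map_mem_chainsIn_sup {U V : Set X} {n k : ℕ} {f : SingChain X n →ₗ[ℝ] SingChain X k}
    (hf : ∀ (W : Set X) (c : SingChain X n), c ∈ chainsIn W n → f c ∈ chainsIn W k)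
    {c : SingChain X n} (hc : c ∈ chainsIn U n ⊔ chainsIn V n) :
    f c ∈ chainsIn U k ⊔ chainsIn V k := by
  obtain ⟨a, ha, b, hb, rfl⟩ := Submodule.mem_sup.1 hc
  rw [map_add]
  exact Submodule.add_mem_sup (hf U a ha) (hf V b hb)

/-- The chain homotopy between the identity and iterated barycentric subdivision. -/
def iterHomotopy (X : Type*) [TopologicalSpace X] :
    ∀ (_ n : ℕ), SingChain X n →ₗ[ℝ] SingChain X (n + 1)
  | 0, _ => 0
  | N + 1, n => singSdHomotopy X n + iterHomotopy X N n ∘ₗ singSd X n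

lemma singBdry_iterHomotopy_zero (N : ℕ) (c : SingChain X 0) :
    singBdry X 0 (iterHomotopy X N 0 c) = c - (singSd X 0)^[N] c := by
  induction N generalizing c with
  | zero => simp [iterHomotopy]
  | succ N ih =>
    rw [iterHomotopy, LinearMap.add_apply, LinearMap.comp_apply, map_add, ih,
      singBdry_singSdHomotopy_zero, Function.iterate_succ_apply]
    abel

lemma singBdry_iterHomotopy_succ (N n : ℕ) (c : SingChain X (n + 1)) :
    singBdry X (n + 1) (iterHomotopy X N (n + 1) c) + iterHomotopy X N n (singBdry X n c) =
      c - (singSd X (n + 1))^[N] c := by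
  induction N generalizing c with
  | zero => simp [iterHomotopy]
  | succ N ih =>
    have h1 := ih (singSd X (n + 1) c)
    have h2 := singBdry_singSdHomotopy_succ n c
    rw [singBdry_singSd] at h1
    rw [iterHomotopy, iterHomotopy, LinearMap.add_apply, LinearMap.comp_apply, map_add,
      LinearMap.add_apply, LinearMap.comp_apply, Function.iterate_succ_apply, add_add_add_comm, h1,
      h2]
    abel

lemma iterHomotopy_mem_chainsIn {U : Set X} (N : ℕ) {n : ℕ} {c : SingChain X n}
    (hc : c ∈ chainsIn U n) : iterHomotopy X N n c ∈ chainsIn U (n + 1) := by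
  induction N generalizing c with
  | zero => exact Submodule.zero_mem _
  | succ N ih =>
    exact Submodule.add_mem _ (singSdHomotopy_mem_chainsIn hc) (ih (singSd_mem_chainsIn hc))

lemma iterate_singSd_single (N n : ℕ) (σ : C(Simplex n, X)) :
    (singSd X n)^[N] (Finsupp.single σ 1) =
      restrict σ n ((sd (bary n) n)^[N] (Finsupp.single (vert n) 1)) := by
  induction N with
  | zero => simp [affineMap_vert]
  | succ N ih => rw [Function.iterate_succ_apply', ih, singSd_restrict, Function.iterate_succ_apply']

lemma exists_iterate_singSd_single_mem {U V : Set X} (hU : IsOpen U) (hV : IsOpen V)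
    (hUV : U ∪ V = Set.univ) {n : ℕ} (σ : C(Simplex n, X)) :
    ∃ N, (singSd X n)^[N] (Finsupp.single σ 1) ∈ chainsIn U n ⊔ chainsIn V n := by
  obtain ⟨ε, hε, hL⟩ := lebesgue_number_lemma_of_metric (s := Set.univ)
    (c := fun b : Bool => σ ⁻¹' (if b then U else V)) isCompact_univ
    (fun b => by cases b <;> simpa using IsOpen.preimage σ.continuous ‹_›) (by
      intro x _
      rcases (hUV.symm ▸ Set.mem_univ (σ x) : σ x ∈ U ∪ V) with h | h
      · exact Set.mem_iUnion.2 ⟨true, by simpa using h⟩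
      · exact Set.mem_iUnion.2 ⟨false, by simpa using h⟩)
  have hr : ((n : ℝ) / (n + 1)) < 1 := by
    rw [div_lt_one (by positivity)]
    linarith
  have hlim := (tendsto_pow_atTop_nhds_zero_of_lt_one (by positivity) hr).mul_const
    (Metric.diam (Set.univ : Set (Simplex n)))
  rw [zero_mul] at hlim
  obtain ⟨N, hN⟩ := (hlim.eventually_lt_const hε).exists
  refine ⟨N, ?_⟩
  rw [iterate_singSd_single]
  have h1 := sd_pow_mem_supported n N
  generalize (sd (bary n) n)^[N] (Finsupp.single (vert n) 1) = c at h1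
  have hc : c = ∑ w ∈ c.support, c w • Finsupp.single w 1 := by
    conv_lhs => rw [← Finsupp.sum_single c]
    simp [Finsupp.sum]
  rw [hc, map_sum]
  refine Submodule.sum_mem _ fun w hw => ?_
  rw [map_smul, restrict_single]
  refine Submodule.smul_mem _ _ ?_
  obtain ⟨b, hb⟩ := hL (w 0) (Set.mem_univ _)
  have h2 : ∀ x, (σ.comp (affineMap w)) x ∈ if b then U else V := fun x =>
    hb ((dist_affineMap_le w x (w 0) fun i => h1 hw i 0).trans_lt hN)
  cases b
  · exact Submodule.mem_sup_right (Finsupp.single_mem_supported ℝ 1 h2)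
  · exact Submodule.mem_sup_left (Finsupp.single_mem_supported ℝ 1 h2)

lemma iterate_singSd_mem_of_le {U V : Set X} {n N M : ℕ} (h : N ≤ M) {c : SingChain X n}
    (hc : (singSd X n)^[N] c ∈ chainsIn U n ⊔ chainsIn V n) :
    (singSd X n)^[M] c ∈ chainsIn U n ⊔ chainsIn V n := by
  obtain ⟨k, rfl⟩ := Nat.exists_eq_add_of_le' h
  rw [Function.iterate_add_apply]
  generalize (singSd X n)^[N] c = d at hc
  induction k with
  | zero => exact hc
  | succ k ih =>
    rw [Function.iterate_succ_apply']
    exact map_mem_chainsIn_sup (fun _ _ h => singSd_mem_chainsIn h) (ih (by lia))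

lemma exists_iterate_singSd_mem {U V : Set X} (hU : IsOpen U) (hV : IsOpen V)
    (hUV : U ∪ V = Set.univ) {n : ℕ} (c : SingChain X n) :
    ∃ N, (singSd X n)^[N] c ∈ chainsIn U n ⊔ chainsIn V n := by
  induction c using Finsupp.induction_linear with
  | zero => exact ⟨0, Submodule.zero_mem _⟩
  | add c d hc hd =>
    obtain ⟨N, hN⟩ := hc
    obtain ⟨M, hM⟩ := hd
    refine ⟨max N M, ?_⟩
    rw [iterate_map_add]
    exact Submodule.add_mem _ (iterate_singSd_mem_of_le (le_max_left _ _) hN)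
      (iterate_singSd_mem_of_le (le_max_right _ _) hM)
  | single σ r =>
    obtain ⟨N, hN⟩ := exists_iterate_singSd_single_mem hU hV hUV σ
    refine ⟨N, ?_⟩
    rw [← mul_one r, ← smul_eq_mul, ← Finsupp.smul_single, ← Module.End.pow_apply,
      map_smul, Module.End.pow_apply]
    exact Submodule.smul_mem _ _ hN

/-- Modulo boundaries, a chain is small as soon as its boundary is. -/
lemma exists_sub_singBdry_mem {U V : Set X} (hU : IsOpen U) (hV : IsOpen V)
    (hUV : U ∪ V = Set.univ) {n : ℕ} (c : SingChain X (n + 1))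
    (hc : singBdry X n c ∈ chainsIn U n ⊔ chainsIn V n) :
    ∃ y, c - singBdry X (n + 1) y ∈ chainsIn U (n + 1) ⊔ chainsIn V (n + 1) := by
  obtain ⟨N, hN⟩ := exists_iterate_singSd_mem hU hV hUV c
  refine ⟨iterHomotopy X N (n + 1) c, ?_⟩
  have h : c - singBdry X (n + 1) (iterHomotopy X N (n + 1) c) =
      (singSd X (n + 1))^[N] c + iterHomotopy X N n (singBdry X n c) := by
    have := singBdry_iterHomotopy_succ N n c
    rw [sub_eq_iff_eq_add, add_assoc, add_comm (iterHomotopy X N n _), this]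
    abel
  rw [h]
  exact Submodule.add_mem _ hN
    (map_mem_chainsIn_sup (fun _ _ h => iterHomotopy_mem_chainsIn N h) hc)

lemma exists_sub_singBdry_mem_zero {U V : Set X} (hU : IsOpen U) (hV : IsOpen V)
    (hUV : U ∪ V = Set.univ) (c : SingChain X 0) :
    ∃ y, c - singBdry X 0 y ∈ chainsIn U 0 ⊔ chainsIn V 0 := by
  obtain ⟨N, hN⟩ := exists_iterate_singSd_mem hU hV hUV c
  refine ⟨iterHomotopy X N 0 c, ?_⟩
  rwa [singBdry_iterHomotopy_zero, sub_sub_cancel]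

end Subdivision

namespace EulerCalculus

/-! ### Chain complexes given by sequences of linear maps -/

/-- A sequence of real vector spaces and linear maps with `d ∘ d = 0`. -/
structure LinearComplex where
  /-- the spaces -/
  X : ℕ → Type
  [addCommGroup : ∀ n, AddCommGroup (X n)]
  [module : ∀ n, Module ℝ (X n)]
  /-- the differentials -/
  d : ∀ n, X (n + 1) →ₗ[ℝ] X n
  d_d : ∀ n x, d n (d (n + 1) x) = 0

attribute [instance] LinearComplex.addCommGroup LinearComplex.module

namespace LinearComplex

/-- The chain complex in the category of modules. -/
def toChainComplex (A : LinearComplex) : ChainComplex (ModuleCat.{0} ℝ) ℕ :=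
  ChainComplex.of (fun n => ModuleCat.of ℝ (A.X n)) (fun n => ModuleCat.ofHom (A.d n)) fun n => by
    ext x
    exact A.d_d n x

lemma toChainComplex_d (A : LinearComplex) (n : ℕ) :
    A.toChainComplex.d (n + 1) n = ModuleCat.ofHom (A.d n) := by
  simp [toChainComplex]

/-- Morphisms. -/
structure Hom (A B : LinearComplex) where
  /-- the components -/
  f : ∀ n, A.X n →ₗ[ℝ] B.X n
  comm : ∀ n x, f n (A.d n x) = B.d n (f (n + 1) x)

/-- The morphism of chain complexes in the category of modules. -/
def Hom.toChainMap {A B : LinearComplex} (φ : A.Hom B) : A.toChainComplex ⟶ B.toChainComplex :=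
  ChainComplex.ofHom (fun n => ModuleCat.ofHom (φ.f n)) fun n => by
    simp only [toChainComplex, ChainComplex.of_d]
    ext x
    exact (φ.comm n x).symm

/-- A short complex of chain complexes. -/
def shortComplex {A B C : LinearComplex} (φ : A.Hom B) (ψ : B.Hom C)
    (h : ∀ n, Function.Exact (φ.f n) (ψ.f n)) :
    ShortComplex (ChainComplex (ModuleCat.{0} ℝ) ℕ) :=
  ShortComplex.mk φ.toChainMap ψ.toChainMap <| by
    ext n x
    exact (h n).apply_apply_eq_zero x

lemma shortComplex_shortExact {A B C : LinearComplex} (φ : A.Hom B) (ψ : B.Hom C)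
    (h : ∀ n, Function.Exact (φ.f n) (ψ.f n)) (hφ : ∀ n, Function.Injective (φ.f n))
    (hψ : ∀ n, Function.Surjective (ψ.f n)) : (shortComplex φ ψ h).ShortExact := by
  refine HomologicalComplex.shortExact_of_degreewise_shortExact _ fun n => ?_
  exact ModuleCat.shortComplex_shortExact _ (h n) (hφ n) (hψ n)

lemma toChainComplex_iso {A B : LinearComplex} (φ : A.Hom B)
    (hφ : ∀ n, Function.Bijective (φ.f n)) : Nonempty (A.toChainComplex ≅ B.toChainComplex) := by
  have : ∀ n, IsIso (φ.toChainMap.f n) := fun n =>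
    (ConcreteCategory.isIso_iff_bijective _).2 (hφ n)
  have : IsIso φ.toChainMap := HomologicalComplex.Hom.isIso_of_components _
  exact ⟨asIso φ.toChainMap⟩

lemma subsingleton_homology (A : LinearComplex) (h0 : Function.Surjective (A.d 0))
    (h : ∀ n x, A.d n x = 0 → ∃ y, A.d (n + 1) y = x) (q : ℕ) :
    Subsingleton (A.toChainComplex.homology q) := by
  refine ModuleCat.subsingleton_of_isZero (HomologicalComplex.ExactAt.isZero_homology ?_)
  rcases q with _ | q
  · rw [HomologicalComplex.exactAt_iff' _ 1 0 0 (by simp) (by simp),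
      ShortComplex.moduleCat_exact_iff]
    intro x _
    obtain ⟨y, hy⟩ := h0 x
    refine ⟨y, ?_⟩
    change (A.toChainComplex.d 1 0).hom y = x
    rw [toChainComplex_d]
    exact hy
  · rw [HomologicalComplex.exactAt_iff' _ (q + 2) (q + 1) q (by simp) (by simp),
      ShortComplex.moduleCat_exact_iff]
    intro x hx
    change (A.toChainComplex.d (q + 1) q).hom x = 0 at hx
    rw [toChainComplex_d] at hx
    obtain ⟨y, hy⟩ := h q x hx
    refine ⟨y, ?_⟩
    change (A.toChainComplex.d (q + 2) (q + 1)).hom y = x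
    rw [toChainComplex_d]
    exact hy

/-- The product of two complexes. -/
def prod (A B : LinearComplex) : LinearComplex where
  X n := A.X n × B.X n
  d n := (A.d n).prodMap (B.d n)
  d_d n x := Prod.ext (A.d_d n x.1) (B.d_d n x.2)

lemma hasEuler_prod {A B : LinearComplex} {k l : ℤ} (hA : HasEuler A.toChainComplex k)
    (hB : HasEuler B.toChainComplex l) : HasEuler (A.prod B).toChainComplex (k + l) := by
  let φ : A.Hom (A.prod B) := ⟨fun n => LinearMap.inl ℝ _ _, fun n x =>
    Prod.ext rfl (map_zero (B.d n)).symm⟩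
  let ψ : (A.prod B).Hom B := ⟨fun n => LinearMap.snd ℝ _ _, fun n x => rfl⟩
  exact HasEuler.middle (shortComplex_shortExact φ ψ (fun n => Function.Exact.inl_snd)
    (fun n => LinearMap.inl_injective) (fun n => LinearMap.snd_surjective)) hA hB

/-- A subcomplex. -/
def sub (A : LinearComplex) (P : ∀ n, Submodule ℝ (A.X n))
    (hP : ∀ n, ∀ x ∈ P (n + 1), A.d n x ∈ P n) : LinearComplex where
  X n := P n
  d n := (A.d n).restrict (hP n)
  d_d n x := Subtype.ext (A.d_d n x)

/-- A quotient complex. -/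
def quot (A : LinearComplex) (P : ∀ n, Submodule ℝ (A.X n))
    (hP : ∀ n, ∀ x ∈ P (n + 1), A.d n x ∈ P n) : LinearComplex where
  X n := A.X n ⧸ P n
  d n := (P (n + 1)).mapQ (P n) (A.d n) (hP n)
  d_d n x := by
    obtain ⟨x, rfl⟩ := (P (n + 2)).mkQ_surjective x
    simp [A.d_d]

/-- A subcomplex with acyclic quotient has the same Euler characteristic. -/
lemma hasEuler_of_sub {A : LinearComplex} (P : ∀ n, Submodule ℝ (A.X n))
    (hP : ∀ n, ∀ x ∈ P (n + 1), A.d n x ∈ P n) (h0 : ∀ x, ∃ y, x - A.d 0 y ∈ P 0)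
    (h : ∀ n x, A.d n x ∈ P n → ∃ y, x - A.d (n + 1) y ∈ P (n + 1)) {k : ℤ}
    (hk : HasEuler (A.sub P hP).toChainComplex k) : HasEuler A.toChainComplex k := by
  let φ : (A.sub P hP).Hom A := ⟨fun n => (P n).subtype, fun n x => rfl⟩
  let ψ : A.Hom (A.quot P hP) := ⟨fun n => (P n).mkQ, fun n x => rfl⟩
  have hq : HasEuler (A.quot P hP).toChainComplex 0 := by
    refine hasEuler_zero_of_acyclic (subsingleton_homology _ ?_ ?_)
    · intro x
      obtain ⟨x, rfl⟩ := (P 0).mkQ_surjective x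
      obtain ⟨y, hy⟩ := h0 x
      exact ⟨(P 1).mkQ y, ((Submodule.Quotient.eq _).2 hy).symm⟩
    · intro n x hx
      obtain ⟨x, rfl⟩ := (P (n + 1)).mkQ_surjective x
      obtain ⟨y, hy⟩ := h n x ((Submodule.Quotient.mk_eq_zero _).1 hx)
      exact ⟨(P (n + 2)).mkQ y, ((Submodule.Quotient.eq _).2 hy).symm⟩
  have := HasEuler.middle (shortComplex_shortExact φ ψ
    (fun n => LinearMap.exact_subtype_mkQ (P n)) (fun n => (P n).injective_subtype)
    (fun n => (P n).mkQ_surjective)) hk hq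
  rwa [add_zero] at this

/-- The Mayer–Vietoris formula for the sum of two subcomplexes. -/
lemma hasEuler_sup {A : LinearComplex} (P Q : ∀ n, Submodule ℝ (A.X n))
    (hP : ∀ n, ∀ x ∈ P (n + 1), A.d n x ∈ P n) (hQ : ∀ n, ∀ x ∈ Q (n + 1), A.d n x ∈ Q n)
    (hPQ : ∀ n, ∀ x ∈ P (n + 1) ⊓ Q (n + 1), A.d n x ∈ P n ⊓ Q n)
    (hPQ' : ∀ n, ∀ x ∈ P (n + 1) ⊔ Q (n + 1), A.d n x ∈ P n ⊔ Q n) {k l m : ℤ}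
    (hk : HasEuler (A.sub P hP).toChainComplex k) (hl : HasEuler (A.sub Q hQ).toChainComplex l)
    (hm : HasEuler (A.sub (fun n => P n ⊓ Q n) hPQ).toChainComplex m) :
    HasEuler (A.sub (fun n => P n ⊔ Q n) hPQ').toChainComplex (k + l - m) := by
  let φ : (A.sub (fun n => P n ⊓ Q n) hPQ).Hom ((A.sub P hP).prod (A.sub Q hQ)) :=
    ⟨fun n => (Submodule.inclusion inf_le_left).prod (- Submodule.inclusion inf_le_right),
      fun n x => Prod.ext rfl (Subtype.ext (map_neg (A.d n) x.1).symm)⟩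
  let ψ : ((A.sub P hP).prod (A.sub Q hQ)).Hom (A.sub (fun n => P n ⊔ Q n) hPQ') :=
    ⟨fun n => (Submodule.inclusion le_sup_left).coprod (Submodule.inclusion le_sup_right),
      fun n x => Subtype.ext (map_add (A.d n) x.1.1 x.2.1).symm⟩
  refine HasEuler.right (shortComplex_shortExact φ ψ (fun n => ?_) (fun n => ?_) (fun n => ?_))
    hm (hasEuler_prod hk hl)
  · rintro ⟨⟨a, ha⟩, ⟨b, hb⟩⟩
    constructor
    · intro h
      have h1 : a + b = 0 := congrArg Subtype.val h
      have h2 : b = -a := (neg_eq_of_add_eq_zero_right h1).symm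
      refine ⟨⟨a, ha, ?_⟩, Prod.ext rfl (Subtype.ext h2.symm)⟩
      rw [← neg_neg a, ← h2]
      exact (Q n).neg_mem hb
    · rintro ⟨⟨c, hc⟩, hc'⟩
      have h1 : c = a := congrArg Subtype.val (congrArg Prod.fst hc')
      have h2 : -c = b := congrArg Subtype.val (congrArg Prod.snd hc')
      refine Subtype.ext (?_ : a + b = 0)
      rw [← h1, ← h2, add_neg_cancel]
  · intro x y hxy
    have h : x.1 = y.1 := congrArg (fun z : P n × Q n => z.1.1) hxy
    exact Subtype.ext h
  · rintro ⟨x, hx⟩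
    obtain ⟨a, ha, b, hb, rfl⟩ := Submodule.mem_sup.1 hx
    exact ⟨(⟨a, ha⟩, ⟨b, hb⟩), rfl⟩

end LinearComplex

end EulerCalculus

namespace EulerCalculus

open Subdivision AlgebraicTopology

/-! ### Euler characteristics of spaces -/

/-- Mathlib's singular chain complex with real coefficients. -/
abbrev singularChains (X : Type) [TopologicalSpace X] : ChainComplex (ModuleCat.{0} ℝ) ℕ :=
  ((singularChainComplexFunctor (ModuleCat.{0} ℝ)).obj (ModuleCat.of ℝ ℝ)).obj (TopCat.of X)

/-- Mathlib's singular chain complex, as the chain complex of a simplicial set. -/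
abbrev simplicialChains (X : Type) [TopologicalSpace X] : ChainComplex (ModuleCat.{0} ℝ) ℕ :=
  (TopCat.toSSet.obj (TopCat.of X)).chainComplex (ModuleCat.of ℝ ℝ)

/-- The concrete singular chain complex. -/
def singComplex (X : Type) [TopologicalSpace X] : LinearComplex where
  X n := SingChain X n
  d n := singBdry X n
  d_d := singBdry_singBdry

/-- Singular simplices of Mathlib's singular simplicial set are continuous maps. -/
def simplexEquiv (X : Type) [TopologicalSpace X] (n : ℕ) :
    (TopCat.toSSet.obj (TopCat.of X)).obj (Opposite.op (SimplexCategory.mk n)) ≃ C(Simplex n, X) :=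
  TopCat.toSSetObjEquiv (TopCat.of X) (Opposite.op (SimplexCategory.mk n))

lemma simplexEquiv_δ (X : Type) [TopologicalSpace X] (n : ℕ)
    (x : (TopCat.toSSet.obj (TopCat.of X)).obj (Opposite.op (SimplexCategory.mk (n + 1))))
    (i : Fin (n + 2)) :
    simplexEquiv X n ((TopCat.toSSet.obj (TopCat.of X)).δ i x) =
      (simplexEquiv X (n + 1) x).comp (face i) := rfl

/-- The comparison from Mathlib's singular chains. -/
def comparison (X : Type) [TopologicalSpace X] (n : ℕ) :
    (simplicialChains X).X n ⟶ ModuleCat.of ℝ (SingChain X n) :=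
  Limits.Sigma.desc fun x => ModuleCat.ofHom (Finsupp.lsingle (simplexEquiv X n x))

lemma ι_comparison (X : Type) [TopologicalSpace X] (n : ℕ)
    (x : (TopCat.toSSet.obj (TopCat.of X)).obj (Opposite.op (SimplexCategory.mk n))) :
    (TopCat.toSSet.obj (TopCat.of X)).ιChainComplex x ≫ comparison X n =
      ModuleCat.ofHom (Finsupp.lsingle (simplexEquiv X n x)) :=
  Limits.Sigma.ι_desc _ _

/-- The inverse of the comparison, as a linear map. -/
def comparisonInvLin (X : Type) [TopologicalSpace X] (n : ℕ) :
    SingChain X n →ₗ[ℝ] ((simplicialChains X).X n : ModuleCat.{0} ℝ) :=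
  Finsupp.linearCombination ℝ fun σ =>
    ((TopCat.toSSet.obj (TopCat.of X)).ιChainComplex (R := ModuleCat.of ℝ ℝ)
      ((simplexEquiv X n).symm σ)).hom 1

/-- The inverse of the comparison. -/
def comparisonInv (X : Type) [TopologicalSpace X] (n : ℕ) :
    ModuleCat.of ℝ (SingChain X n) ⟶ (simplicialChains X).X n :=
  ModuleCat.ofHom (comparisonInvLin X n)

lemma comparisonInv_single (X : Type) [TopologicalSpace X] (n : ℕ) (σ : C(Simplex n, X)) :
    (comparisonInv X n).hom (Finsupp.single σ 1) =
      ((TopCat.toSSet.obj (TopCat.of X)).ιChainComplex (R := ModuleCat.of ℝ ℝ)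
        ((simplexEquiv X n).symm σ)).hom 1 := by
  change comparisonInvLin X n (Finsupp.single σ 1) = _
  rw [comparisonInvLin, Finsupp.linearCombination_single, one_smul]

lemma isIso_comparison (X : Type) [TopologicalSpace X] (n : ℕ) : IsIso (comparison X n) := by
  refine ⟨comparisonInv X n, ?_, ?_⟩
  · refine SSet.chainComplex_hom_ext fun x => ?_
    rw [← Category.assoc, ι_comparison, Category.comp_id]
    refine ModuleCat.hom_ext (LinearMap.ext_ring ?_)
    refine (comparisonInv_single X n _).trans ?_
    rw [Equiv.symm_apply_apply]
  · refine ModuleCat.hom_ext (Finsupp.lhom_ext' fun σ => LinearMap.ext_ring ?_)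
    change (comparison X n).hom ((comparisonInv X n).hom (Finsupp.single σ 1)) = Finsupp.single σ 1
    rw [comparisonInv_single]
    have h := ι_comparison X n ((simplexEquiv X n).symm σ)
    rw [Equiv.apply_symm_apply] at h
    exact LinearMap.congr_fun (congrArg ModuleCat.Hom.hom h) (1 : ℝ)

lemma comparison_comm (X : Type) [TopologicalSpace X] (n : ℕ) :
    (simplicialChains X).d (n + 1) n ≫ comparison X n =
      comparison X (n + 1) ≫ ModuleCat.ofHom (singBdry X n) := by
  refine SSet.chainComplex_hom_ext fun x => ?_
  rw [← Category.assoc, ← Category.assoc, ι_comparison]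
  have h := SSet.ιChainComplex_d (R := ModuleCat.of ℝ ℝ) (TopCat.toSSet.obj (TopCat.of X)) x
  refine (congrArg (· ≫ comparison X n) h).trans ?_
  rw [Preadditive.sum_comp]
  refine ModuleCat.hom_ext (LinearMap.ext_ring ?_)
  rw [ModuleCat.hom_sum]
  rw [LinearMap.sum_apply]
  change _ = singBdry X n (Finsupp.single (simplexEquiv X (n + 1) x) 1)
  rw [singBdry_single]
  refine Finset.sum_congr rfl fun i _ => ?_
  rw [Linear.smul_comp, ι_comparison, simplexEquiv_δ]
  rw [← Int.cast_smul_eq_zsmul ℝ]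
  push_cast
  rfl

/-- Mathlib's singular chain complex is isomorphic to the concrete one. -/
lemma nonempty_singularChains_iso (X : Type) [TopologicalSpace X] :
    Nonempty (singularChains X ≅ (singComplex X).toChainComplex) := by
  suffices h : Nonempty (simplicialChains X ≅ (singComplex X).toChainComplex) from h
  refine ⟨HomologicalComplex.Hom.isoOfComponents (fun n =>
    @asIso _ _ _ _ (comparison X n) (isIso_comparison X n)) ?_⟩
  rintro i j (rfl : j + 1 = i)
  rw [LinearComplex.toChainComplex_d]
  exact (comparison_comm X j).symm

end EulerCalculus

namespace EulerCalculus

open Subdivision AlgebraicTopology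

/-- The space `X` has finite-dimensional total singular homology, of Euler characteristic `k`. -/
def SpaceEuler (X : Type) [TopologicalSpace X] (k : ℤ) : Prop := HasEuler (singularChains X) k

lemma spaceEuler_iff (X : Type) [TopologicalSpace X] (k : ℤ) :
    SpaceEuler X k ↔ HasEuler (singComplex X).toChainComplex k := by
  obtain ⟨e⟩ := nonempty_singularChains_iso X
  exact ⟨fun h => h.of_iso e, fun h => HasEuler.of_iso e.symm h⟩

/-- The map induced on singular homology. -/
abbrev singularMap {X Y : Type} [TopologicalSpace X] [TopologicalSpace Y] (f : C(X, Y)) :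
    singularChains X ⟶ singularChains Y :=
  ((singularChainComplexFunctor (ModuleCat.{0} ℝ)).obj (ModuleCat.of ℝ ℝ)).map (TopCat.ofHom f)

lemma singularMap_comp {X Y Z : Type} [TopologicalSpace X] [TopologicalSpace Y]
    [TopologicalSpace Z] (f : C(X, Y)) (g : C(Y, Z)) :
    singularMap (g.comp f) = singularMap f ≫ singularMap g := by
  rw [singularMap, TopCat.ofHom_comp, Functor.map_comp]

lemma singularMap_id (X : Type) [TopologicalSpace X] :
    singularMap (ContinuousMap.id X) = 𝟙 (singularChains X) := by
  rw [singularMap, TopCat.ofHom_id, CategoryTheory.Functor.map_id]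

lemma homologyMap_comp_eq_id {X Y : Type} [TopologicalSpace X] [TopologicalSpace Y]
    {f : C(X, Y)} {g : C(Y, X)} (h : (g.comp f).Homotopic (ContinuousMap.id X)) (q : ℕ) :
    HomologicalComplex.homologyMap (singularMap f) q ≫
      HomologicalComplex.homologyMap (singularMap g) q = 𝟙 _ := by
  obtain ⟨H⟩ := h
  rw [← HomologicalComplex.homologyMap_comp, ← singularMap_comp]
  have h1 := TopCat.Homotopy.congr_homologyMap_singularChainComplexFunctor
    (f := TopCat.ofHom (g.comp f)) (g := TopCat.ofHom (ContinuousMap.id X)) H (ModuleCat.of ℝ ℝ) q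
  refine h1.trans ?_
  have h2 := singularMap_id X
  rw [singularMap] at h2
  rw [h2, HomologicalComplex.homologyMap_id]

lemma SpaceEuler.of_homotopyEquiv {X Y : Type} [TopologicalSpace X] [TopologicalSpace Y] {k : ℤ}
    (e : ContinuousMap.HomotopyEquiv X Y) (h : SpaceEuler X k) : SpaceEuler Y k :=
  h.of_iso_homology fun q =>
    ⟨HomologicalComplex.homologyMap (singularMap e.toFun) q,
      HomologicalComplex.homologyMap (singularMap e.invFun) q,
      homologyMap_comp_eq_id e.left_inv q, homologyMap_comp_eq_id e.right_inv q⟩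

lemma SpaceEuler.of_homeomorph {X Y : Type} [TopologicalSpace X] [TopologicalSpace Y] {k : ℤ}
    (e : X ≃ₜ Y) (h : SpaceEuler X k) : SpaceEuler Y k := h.of_homotopyEquiv e.toHomotopyEquiv

lemma spaceEuler_unit : SpaceEuler Unit 1 := by
  have h : ∀ q, 1 ≤ q → Subsingleton ((singularChains Unit).homology q) := fun q hq =>
    ModuleCat.subsingleton_of_isZero
      (isZero_singularHomologyFunctor_of_totallyDisconnectedSpace (ModuleCat.{0} ℝ) q
        (ModuleCat.of ℝ ℝ) (TopCat.of Unit) (by lia))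
  have e : (singularChains Unit).homology 0 ≅ ModuleCat.of ℝ ℝ :=
    singularHomologyFunctorZeroOfTotallyDisconnectedSpace (ModuleCat.{0} ℝ)
      (ModuleCat.of ℝ ℝ) (TopCat.of Unit) ≪≫
      @Limits.coproductUniqueIso _ _ _ (inferInstanceAs (Unique Unit)) (fun _ => ModuleCat.of ℝ ℝ)
  have e' : (singularChains Unit).homology 0 ≃ₗ[ℝ] ℝ := e.toLinearEquiv
  refine ⟨fun q => ?_, ⟨1, h⟩, ?_⟩
  · rcases q with _ | q
    · exact Module.Finite.equiv e'.symm
    · have := h (q + 1) (by lia)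
      infer_instance
  · rw [homologyEulerChar_eq_sum_range _ 1 h]
    simp [e'.finrank_eq]

lemma spaceEuler_of_contractible (X : Type) [TopologicalSpace X] [ContractibleSpace X] :
    SpaceEuler X 1 :=
  spaceEuler_unit.of_homotopyEquiv (ContractibleSpace.hequiv_unit X).some.symm

lemma spaceEuler_of_isEmpty (X : Type) [TopologicalSpace X] [IsEmpty X] : SpaceEuler X 0 := by
  rw [spaceEuler_iff]
  have h : ∀ n, Subsingleton ((singComplex X).X n) := fun n => by
    have : IsEmpty C(Simplex n, X) := ⟨fun f => isEmptyElim (f (vert n 0))⟩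
    exact inferInstanceAs (Subsingleton (SingChain X n))
  refine hasEuler_zero_of_acyclic (LinearComplex.subsingleton_homology _ ?_ ?_)
  · exact fun x => ⟨0, (h 0).elim _ _⟩
  · exact fun n x _ => ⟨0, (h (n + 1)).elim _ _⟩

section MayerVietoris

variable {X : Type} [TopologicalSpace X]

/-- The complex of singular chains supported in a subset. -/
def chainsInComplex (U : Set X) : LinearComplex :=
  (singComplex X).sub (fun n => chainsIn U n) fun _ _ h => singBdry_mem_chainsIn h

lemma hasEuler_chainsInComplex {U : Set X} {k : ℤ} (h : SpaceEuler U k) :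
    HasEuler (chainsInComplex U).toChainComplex k := by
  rw [spaceEuler_iff] at h
  let ι : C(U, X) := ⟨Subtype.val, continuous_subtype_val⟩
  let m (n : ℕ) : SingChain U n →ₗ[ℝ] SingChain X n := Finsupp.lmapDomain ℝ ℝ fun σ => ι.comp σ
  have hm : ∀ n c, m n c ∈ chainsIn U n := fun n c => by
    classical
    intro τ hτ
    obtain ⟨σ, -, rfl⟩ := Finset.mem_image.1 (Finsupp.mapDomain_support hτ)
    exact fun x => (σ x).2
  have hcomm : ∀ n c, m n (singBdry U n c) = singBdry X n (m (n + 1) c) := fun n c => by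
    suffices h : m n ∘ₗ singBdry U n = singBdry X n ∘ₗ m (n + 1) from LinearMap.congr_fun h c
    refine Finsupp.lhom_ext' fun σ => LinearMap.ext_ring ?_
    have hs : ∀ n (σ : C(Simplex n, U)), m n (Finsupp.single σ 1) = Finsupp.single (ι.comp σ) 1 :=
      fun n σ => Finsupp.mapDomain_single
    simp only [LinearMap.comp_apply, Finsupp.lsingle_apply, singBdry_single, map_sum, map_smul, hs,
      ContinuousMap.comp_assoc]
  let φ : (singComplex U).Hom (chainsInComplex U) :=
    ⟨fun n => (m n).codRestrict (chainsIn U n) (hm n), fun n c => Subtype.ext (hcomm n c)⟩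
  have hinj : ∀ n, Function.Injective fun σ : C(Simplex n, U) => ι.comp σ := fun n σ τ h => by
    ext x
    exact congrArg (fun f : C(Simplex n, X) => f x) h
  obtain ⟨e⟩ := LinearComplex.toChainComplex_iso φ fun n => by
    constructor
    · intro c d hcd
      exact Finsupp.mapDomain_injective (hinj n) (congrArg Subtype.val hcd)
    · rintro ⟨c, hc⟩
      change SingChain X n at c
      have hc' : c ∈ LinearMap.range (m n) := by
        have h1 : c = ∑ σ ∈ c.support, c σ • Finsupp.single σ 1 := by
          conv_lhs => rw [← Finsupp.sum_single c]
          simp [Finsupp.sum]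
        rw [h1]
        refine Submodule.sum_mem _ fun σ hσ => Submodule.smul_mem _ _ ?_
        refine ⟨Finsupp.single ⟨fun x => ⟨σ x, hc hσ x⟩, σ.continuous.subtype_mk _⟩ 1, ?_⟩
        exact Finsupp.mapDomain_single
      obtain ⟨d, hd⟩ := hc'
      exact ⟨d, Subtype.ext hd⟩
  exact h.of_iso e

/-- The Mayer–Vietoris formula. -/
lemma SpaceEuler.union {U V : Set X} (hU : IsOpen U) (hV : IsOpen V) (hUV : U ∪ V = Set.univ)
    {k l m : ℤ} (hk : SpaceEuler U k) (hl : SpaceEuler V l)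
    (hm : SpaceEuler (U ∩ V : Set X) m) : SpaceEuler X (k + l - m) := by
  rw [spaceEuler_iff]
  have hinf : ∀ n, chainsIn (U ∩ V) n = chainsIn U n ⊓ chainsIn V n := fun n => by
    rw [chainsIn, chainsIn, chainsIn, ← Finsupp.supported_inter]
    congr 1
    ext σ
    exact forall_and
  have hm' := hasEuler_chainsInComplex hm
  unfold chainsInComplex at hm'
  simp only [hinf] at hm'
  have hsup := LinearComplex.hasEuler_sup (A := singComplex X) (fun n => chainsIn U n)
    (fun n => chainsIn V n) (fun _ _ h => singBdry_mem_chainsIn h)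
    (fun _ _ h => singBdry_mem_chainsIn h)
    (fun _ _ h => ⟨singBdry_mem_chainsIn h.1, singBdry_mem_chainsIn h.2⟩)
    (fun _ _ h => map_mem_chainsIn_sup (fun _ _ h => singBdry_mem_chainsIn h) h)
    (hasEuler_chainsInComplex hk) (hasEuler_chainsInComplex hl) hm'
  exact LinearComplex.hasEuler_of_sub _ _ (exists_sub_singBdry_mem_zero hU hV hUV)
    (fun n x hx => exists_sub_singBdry_mem hU hV hUV x hx) hsup

end MayerVietoris

/-- The Euler characteristic of the homology of the one-point compactification relative to the
added point. -/
lemma hasEuler_onePointChains {X : Type} [TopologicalSpace X] {k : ℤ}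
    (h : SpaceEuler (OnePoint X) (k + 1)) : HasEuler (CurveGerm.onePointChains X) k := by
  let i : C(PUnit.{1}, OnePoint X) := ContinuousMap.const PUnit.{1} (OnePoint.infty : OnePoint X)
  let p : C(OnePoint X, PUnit.{1}) := ContinuousMap.const _ PUnit.unit
  have hip : singularMap i ≫ singularMap p = 𝟙 _ := by
    rw [← singularMap_comp, ← singularMap_id]
  have : Mono (singularMap i) := mono_of_mono_fac hip
  have hS : (ShortComplex.mk (singularMap i) (Limits.cokernel.π (singularMap i))
      (Limits.cokernel.condition _)).ShortExact :=
    { exact := ShortComplex.exact_cokernel _ }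
  have h1 := HasEuler.right hS spaceEuler_unit h
  rwa [add_sub_cancel_right] at h1

lemma hasFiniteHomology_and_eulerChar {X : Type} [TopologicalSpace X] {k : ℤ}
    (h : SpaceEuler (OnePoint X) (k + 1)) :
    CurveGerm.HasFiniteHomology X ∧ CurveGerm.eulerChar X = k := by
  have h1 := hasEuler_onePointChains h
  exact ⟨⟨h1.finite, h1.bounded⟩, h1.eulerChar_eq⟩

end EulerCalculus

namespace EulerCalculus

/-! ### Punctured vector spaces -/

/-- A subset of a subtype, seen as a subset of the ambient space. -/
def homeomorphPreimage {E : Type*} [TopologicalSpace E] {S T : Set E} (h : T ⊆ S) :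
    ((Subtype.val : S → E) ⁻¹' T : Set S) ≃ₜ T where
  toFun x := ⟨x.1.1, x.2⟩
  invFun x := ⟨⟨x.1, h x.2⟩, x.2⟩
  left_inv _ := rfl
  right_inv _ := rfl
  continuous_toFun := (continuous_subtype_val.comp continuous_subtype_val).subtype_mk _
  continuous_invFun := (continuous_subtype_val.subtype_mk _).subtype_mk _

section Product

variable {W : Type} [NormedAddCommGroup W] [NormedSpace ℝ W]

lemma starConvex_slit (ε : ℝ) (hε : ε ≠ 0) :
    StarConvex ℝ ((0, ε) : W × ℝ) {v | v.1 ≠ 0 ∨ 0 < ε * v.2} := by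
  rintro ⟨w, t⟩ h a b ha hb hab
  simp only [Set.mem_ofPred_eq, Prod.smul_mk, Prod.mk_add_mk, smul_zero, zero_add, smul_eq_mul] at h ⊢
  rcases hb.eq_or_lt with rfl | hb'
  · right
    have : a = 1 := by linarith
    subst this
    have := mul_self_pos.2 hε
    linarith
  · rcases h with h | h
    · exact Or.inl (smul_ne_zero hb'.ne' h)
    · right
      have h1 := mul_self_pos.2 hε
      have h2 : ε * (a * ε + b * t) = a * (ε * ε) + b * (ε * t) := by ring
      rw [h2]
      positivity

/-- The complement of a line is homotopy equivalent to a punctured space. -/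
def homotopyEquivCompl : ContinuousMap.HomotopyEquiv {w : W // w ≠ 0} {v : W × ℝ | v.1 ≠ 0} where
  toFun := ⟨fun w => ⟨(w.1, 0), w.2⟩, by fun_prop⟩
  invFun := ⟨fun v => ⟨v.1.1, v.2⟩, by fun_prop⟩
  left_inv := by
    have : (ContinuousMap.id {w : W // w ≠ 0}) = ContinuousMap.comp
      ⟨fun v : {v : W × ℝ | v.1 ≠ 0} => (⟨v.1.1, v.2⟩ : {w : W // w ≠ 0}), by fun_prop⟩
      ⟨fun w : {w : W // w ≠ 0} => (⟨(w.1, 0), w.2⟩ : {v : W × ℝ | v.1 ≠ 0}), by fun_prop⟩ := by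
      ext w
      rfl
    rw [← this]
  right_inv := ⟨{
    toFun := fun p => ⟨(p.2.1.1, (p.1 : ℝ) * p.2.1.2), p.2.2⟩
    continuous_toFun := by fun_prop
    map_zero_left := fun v => by simp
    map_one_left := fun v => by simp }⟩

lemma spaceEuler_punctured_prod {k : ℤ} (h : SpaceEuler {w : W // w ≠ 0} k) :
    SpaceEuler {v : W × ℝ | v ≠ 0} (1 + 1 - k) := by
  have hc : ∀ ε : ℝ, ε ≠ 0 → SpaceEuler {v : W × ℝ | v.1 ≠ 0 ∨ 0 < ε * v.2} 1 := fun ε hε => by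
    have := (starConvex_slit (W := W) ε hε).contractibleSpace
      ⟨(0, ε), Or.inr (mul_self_pos.2 hε)⟩
    exact spaceEuler_of_contractible _
  have hsub : ∀ ε : ℝ, {v : W × ℝ | v.1 ≠ 0 ∨ 0 < ε * v.2} ⊆ {v | v ≠ 0} := by
    rintro ε v hv rfl
    simp at hv
  have hopen : ∀ ε : ℝ, IsOpen ((Subtype.val : {v : W × ℝ | v ≠ 0} → W × ℝ) ⁻¹'
      {v | v.1 ≠ 0 ∨ 0 < ε * v.2}) := fun ε => by
    refine IsOpen.preimage continuous_subtype_val (IsOpen.union ?_ ?_)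
    · exact isOpen_ne_fun continuous_fst continuous_const
    · exact isOpen_lt continuous_const (continuous_const.mul continuous_snd)
  refine SpaceEuler.union (hopen 1) (hopen (-1)) ?_
    ((hc 1 one_ne_zero).of_homeomorph (homeomorphPreimage (hsub 1)).symm)
    ((hc (-1) (by norm_num)).of_homeomorph (homeomorphPreimage (hsub (-1))).symm) ?_
  · ext ⟨⟨w, t⟩, hv⟩
    simp only [ne_eq, one_mul, Set.mem_union, Set.mem_preimage, Set.mem_ofPred_eq, Set.mem_univ,
      iff_true]
    by_cases hw : w = 0
    · have ht : t ≠ 0 := fun ht => hv (by rw [hw, ht]; rfl)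
      rcases lt_or_gt_of_ne ht with h | h
      · exact Or.inr (Or.inr (by linarith))
      · exact Or.inl (Or.inr h)
    · exact Or.inl (Or.inl hw)
  · have h1 := h.of_homotopyEquiv homotopyEquivCompl
    have hsub' : {v : W × ℝ | v.1 ≠ 0} ⊆ {v | v ≠ 0} := by
      rintro v hv rfl
      exact hv rfl
    have h2 := h1.of_homeomorph (homeomorphPreimage hsub').symm
    have h3 : ((Subtype.val : {v : W × ℝ | v ≠ 0} → W × ℝ) ⁻¹' {v | v.1 ≠ 0 ∨ 0 < 1 * v.2}) ∩
      ((Subtype.val : {v : W × ℝ | v ≠ 0} → W × ℝ) ⁻¹' {v | v.1 ≠ 0 ∨ 0 < (-1) * v.2}) =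
      (Subtype.val : {v : W × ℝ | v ≠ 0} → W × ℝ) ⁻¹' {v | v.1 ≠ 0} := by
      ext ⟨⟨w, t⟩, hv⟩
      simp only [one_mul, Set.mem_inter_iff, Set.mem_preimage, Set.mem_ofPred_eq]
      constructor
      · rintro ⟨h | h, h' | h'⟩
        · exact h
        · exact h
        · exact h'
        · linarith
      · exact fun h => ⟨Or.inl h, Or.inl h⟩
    rw [h3]
    exact h2

end Product

/-- A linear equivalence induces a homeomorphism of punctured spaces. -/
def homeomorphPunctured {V W : Type*} [NormedAddCommGroup V] [NormedSpace ℝ V]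
    [NormedAddCommGroup W] [NormedSpace ℝ W] (e : V ≃L[ℝ] W) :
    {v : V // v ≠ 0} ≃ₜ {w : W // w ≠ 0} :=
  e.toHomeomorph.subtype fun v => by simp

lemma spaceEuler_punctured (V : Type) [NormedAddCommGroup V] [NormedSpace ℝ V]
    [FiniteDimensional ℝ V] :
    SpaceEuler {v : V // v ≠ 0} (1 - (-1) ^ Module.finrank ℝ V) := by
  suffices h : ∀ m : ℕ, SpaceEuler {v : Fin m → ℝ // v ≠ 0} (1 - (-1) ^ m) by
    have e : (Fin (Module.finrank ℝ V) → ℝ) ≃L[ℝ] V :=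
      ContinuousLinearEquiv.ofFinrankEq (by simp)
    exact (h _).of_homeomorph (homeomorphPunctured e)
  intro m
  induction m with
  | zero =>
    have : IsEmpty {v : Fin 0 → ℝ // v ≠ 0} := ⟨fun v => v.2 (Subsingleton.elim _ _)⟩
    simpa using spaceEuler_of_isEmpty {v : Fin 0 → ℝ // v ≠ 0}
  | succ m ih =>
    have e : ((Fin m → ℝ) × ℝ) ≃L[ℝ] (Fin (m + 1) → ℝ) :=
      ContinuousLinearEquiv.ofFinrankEq (by simp)
    have h1 := (spaceEuler_punctured_prod ih).of_homeomorph (homeomorphPunctured e)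
    have h2 : (1 : ℤ) + 1 - (1 - (-1) ^ m) = 1 - (-1) ^ (m + 1) := by ring
    rwa [h2] at h1

section OpenNeighbourhood

variable {V : Type} [NormedAddCommGroup V]

/-- The scaling that contracts the space into a ball. -/
def shrink (ε : ℝ) (v : V) : ℝ := ε / (ε + ‖v‖)

lemma shrink_pos {ε : ℝ} (hε : 0 < ε) (v : V) : 0 < shrink ε v := by
  unfold shrink
  positivity

lemma shrink_le_one {ε : ℝ} (hε : 0 < ε) (v : V) : shrink ε v ≤ 1 := by
  unfold shrink
  rw [div_le_one (by positivity)]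
  linarith [norm_nonneg v]

lemma continuous_shrink {ε : ℝ} (hε : 0 < ε) : Continuous (shrink ε : V → ℝ) :=
  continuous_const.div (continuous_const.add continuous_norm) fun v => by positivity

variable [NormedSpace ℝ V]

lemma norm_shrink_smul_lt {ε : ℝ} (hε : 0 < ε) (v : V) : ‖shrink ε v • v‖ < ε := by
  rw [norm_smul, Real.norm_of_nonneg (shrink_pos hε v).le, shrink, div_mul_eq_mul_div,
    div_lt_iff₀ (by positivity)]
  nlinarith [norm_nonneg v]

lemma spaceEuler_punctured_starConvex [FiniteDimensional ℝ V] {O : Set V} (hO : IsOpen O)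
    (h0 : (0 : V) ∈ O) (hs : StarConvex ℝ 0 O) :
    SpaceEuler {v : V | v ∈ O ∧ v ≠ 0} (1 - (-1) ^ Module.finrank ℝ V) := by
  obtain ⟨ε, hε, hball⟩ := Metric.isOpen_iff.1 hO 0 h0
  have hmem : ∀ v : V, shrink ε v • v ∈ O := fun v =>
    hball (by simpa using norm_shrink_smul_lt hε v)
  have hcont := continuous_shrink (V := V) hε
  have hpos : ∀ (s : unitInterval) (v : V), 0 < (1 - (s : ℝ)) * shrink ε v + s := fun s v => by
    have h1 := shrink_pos hε v
    rcases s.2.2.eq_or_lt with h | h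
    · rw [h]; norm_num
    · have := s.2.1
      have : 0 < (1 - (s : ℝ)) * shrink ε v := mul_pos (by linarith) h1
      linarith
  have hle : ∀ (s : unitInterval) (v : V), (1 - (s : ℝ)) * shrink ε v + s ≤ 1 := fun s v => by
    have h1 := shrink_le_one hε v
    have := s.2.1
    have := s.2.2
    nlinarith
  let f : C({v : V | v ∈ O ∧ v ≠ 0}, {v : V // v ≠ 0}) := ⟨fun v => ⟨v.1, v.2.2⟩, by fun_prop⟩
  let g : C({v : V // v ≠ 0}, {v : V | v ∈ O ∧ v ≠ 0}) :=
    ⟨fun v => ⟨shrink ε v.1 • v.1, hmem _, smul_ne_zero (shrink_pos hε _).ne' v.2⟩, by fun_prop⟩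
  refine (spaceEuler_punctured V).of_homotopyEquiv ⟨g, f, ⟨?_⟩, ⟨?_⟩⟩
  · exact {
      toFun := fun p => ⟨((1 - (p.1 : ℝ)) * shrink ε p.2.1 + p.1) • p.2.1,
        smul_ne_zero (hpos _ _).ne' p.2.2⟩
      continuous_toFun := by fun_prop
      map_zero_left := fun v => by simp [f, g]
      map_one_left := fun v => by simp }
  · exact {
      toFun := fun p => ⟨((1 - (p.1 : ℝ)) * shrink ε p.2.1 + p.1) • p.2.1,
        hs.smul_mem p.2.2.1 (hpos _ _).le (hle _ _), smul_ne_zero (hpos _ _).ne' p.2.2.2⟩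
      continuous_toFun := by fun_prop
      map_zero_left := fun v => by simp [f, g]
      map_one_left := fun v => by simp }

end OpenNeighbourhood

end EulerCalculus

namespace EulerCalculus

/-! ### Collapsing the complement of a subset -/

section Collapse

variable {E : Type}

open Classical in
/-- The map to the one-point compactification of a subset that collapses the complement. -/
def collapse (W : Set E) (x : E) : OnePoint W :=
  if h : x ∈ W then ((⟨x, h⟩ : W) : OnePoint W) else OnePoint.infty

variable {W : Set E}

lemma collapse_of_mem {x : E} (h : x ∈ W) : collapse W x = ((⟨x, h⟩ : W) : OnePoint W) := dif_pos h

lemma collapse_of_notMem {x : E} (h : x ∉ W) : collapse W x = OnePoint.infty := dif_neg h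

lemma collapse_coe (x : W) : collapse W x = (x : OnePoint W) := collapse_of_mem x.2

/-- The points outside of a compact subset of `W` are mapped outside of it. -/
lemma preimage_collapse_of_compact (A : Set W) :
    collapse W ⁻¹' (((↑) : W → OnePoint W) '' A)ᶜ = (Subtype.val '' A)ᶜ := by
  ext x
  simp only [Set.mem_preimage, Set.mem_compl_iff, not_iff_not]
  constructor
  · rintro ⟨a, ha, hax⟩
    by_cases hx : x ∈ W
    · rw [collapse_of_mem hx, OnePoint.coe_eq_coe] at hax
      exact ⟨a, ha, congrArg Subtype.val hax⟩
    · rw [collapse_of_notMem hx] at hax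
      exact absurd hax (OnePoint.coe_ne_infty a)
  · rintro ⟨a, ha, rfl⟩
    exact ⟨a, ha, (collapse_coe a).symm⟩

variable [TopologicalSpace E]

lemma exists_compact_of_mem_nhds_infty {N : Set (OnePoint W)} (hN : N ∈ 𝓝 OnePoint.infty) :
    ∃ A : Set W, IsCompact A ∧ (((↑) : W → OnePoint W) '' A)ᶜ ⊆ N := by
  obtain ⟨A, ⟨-, hA⟩, hAN⟩ := OnePoint.hasBasis_nhds_infty.mem_iff.1 hN
  exact ⟨A, hA, by rwa [OnePoint.compl_image_coe]⟩

lemma preimage_collapse_mem_of_mem_nhds_infty {N : Set (OnePoint W)}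
    (hN : N ∈ 𝓝 OnePoint.infty) : ∃ B : Set E, IsCompact B ∧ B ⊆ W ∧ Bᶜ ⊆ collapse W ⁻¹' N := by
  obtain ⟨A, hA, hAN⟩ := exists_compact_of_mem_nhds_infty hN
  refine ⟨Subtype.val '' A, hA.image continuous_subtype_val, by simp, ?_⟩
  rw [← preimage_collapse_of_compact]
  exact Set.preimage_mono hAN

lemma continuousOn_collapse [T2Space E] (hW : IsLocallyClosed W) : ContinuousOn (collapse W) (closure W) := by
  obtain ⟨U, F, hU, hF, rfl⟩ := hW
  intro x hx
  by_cases hxW : x ∈ U ∩ F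
  · have h1 : ContinuousWithinAt (collapse (U ∩ F)) (U ∩ F) x := by
      rw [continuousWithinAt_iff_continuousAt_domRestrict _ hxW]
      have h2 : Set.domRestrict (U ∩ F) (collapse (U ∩ F)) =
          fun y : ↑(U ∩ F) => (y : OnePoint ↑(U ∩ F)) := by
        funext y
        exact collapse_coe y
      rw [h2]
      exact OnePoint.continuous_coe.continuousAt
    refine h1.mono_of_mem_nhdsWithin ?_
    have h3 : U ∩ closure (U ∩ F) ⊆ U ∩ F := fun y hy =>
      ⟨hy.1, closure_minimal Set.inter_subset_right hF hy.2⟩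
    exact Filter.mem_of_superset (inter_mem_nhdsWithin _ (hU.mem_nhds hxW.1))
      fun y hy => h3 ⟨hy.2, hy.1⟩
  · intro N hN
    rw [collapse_of_notMem hxW] at hN
    obtain ⟨B, hB, hBW, hBN⟩ := preimage_collapse_mem_of_mem_nhds_infty hN
    exact mem_nhdsWithin_of_mem_nhds (Filter.mem_of_superset
      (hB.isClosed.isOpen_compl.mem_nhds fun h => hxW (hBW h)) hBN)

end Collapse

/-! ### Attaching a cell -/

variable {E : Type} [NormedAddCommGroup E] [NormedSpace ℝ E]

/-- A centre `c`, a direction `D` and a positively homogeneous function `p`, which describe a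
cell `{c + v | v ∈ D, p v < 1}`. -/
structure Cell (E : Type) [NormedAddCommGroup E] [NormedSpace ℝ E] where
  /-- the centre -/
  c : E
  /-- the direction of the affine hull -/
  D : Submodule ℝ E
  /-- the gauge -/
  p : E → ℝ
  isClosed : IsClosed (D : Set E)
  continuous : Continuous p
  nonneg : ∀ v, 0 ≤ p v
  smul : ∀ s : ℝ, 0 ≤ s → ∀ v, p (s • v) = s * p v

namespace Cell

variable (K : Cell E)

/-- The open cell. -/
def openCell : Set E := {x | x - K.c ∈ K.D ∧ K.p (x - K.c) < 1}

/-- The closed cell. -/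
def closedCell : Set E := {x | x - K.c ∈ K.D ∧ K.p (x - K.c) ≤ 1}

lemma p_zero : K.p 0 = 0 := by simpa using K.smul 0 le_rfl 0

lemma center_mem : K.c ∈ K.openCell := by
  refine ⟨by simp, ?_⟩
  rw [sub_self, K.p_zero]
  exact one_pos

lemma openCell_subset_closedCell : K.openCell ⊆ K.closedCell := fun _ h => ⟨h.1, h.2.le⟩

lemma isClosed_closedCell : IsClosed K.closedCell := by
  have h : Continuous fun x : E => x - K.c := by fun_prop
  exact (K.isClosed.preimage h).inter (isClosed_le (K.continuous.comp h) continuous_const)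

lemma scale_mem_closedCell {v : E} {s : ℝ} (hs : 0 ≤ s) (hv : v ∈ K.D) (h : s * K.p v ≤ 1) :
    K.c + s • v ∈ K.closedCell := by
  refine ⟨by simpa using K.D.smul_mem s hv, ?_⟩
  rwa [add_sub_cancel_left, K.smul s hs]

lemma scale_mem_openCell {v : E} {s : ℝ} (hs : 0 ≤ s) (hv : v ∈ K.D) (h : s * K.p v < 1) :
    K.c + s • v ∈ K.openCell := by
  refine ⟨by simpa using K.D.smul_mem s hv, ?_⟩
  rwa [add_sub_cancel_left, K.smul s hs]

lemma closedCell_subset_closure : K.closedCell ⊆ closure K.openCell := by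
  intro x hx
  have h1 : Tendsto (fun s : ℝ => K.c + s • (x - K.c)) (𝓝[<] 1) (𝓝 x) := by
    have h2 : Continuous fun s : ℝ => K.c + s • (x - K.c) := by fun_prop
    have h3 := h2.tendsto 1
    simp only [one_smul, add_sub_cancel] at h3
    exact h3.mono_left nhdsWithin_le_nhds
  refine mem_closure_of_tendsto h1 ?_
  filter_upwards [Ioo_mem_nhdsLT (show (0 : ℝ) < 1 by norm_num)] with s hs
  refine K.scale_mem_openCell hs.1.le hx.1 ?_
  have := hx.2
  have := hs.1
  have := hs.2
  nlinarith [K.nonneg (x - K.c)]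

/-- The denominator in the radial deformation. -/
def denom (x : E) (t : ℝ) : ℝ := (1 - t) + t * K.p (x - K.c)

lemma continuous_denom : Continuous fun q : E × ℝ => K.denom q.1 q.2 := by
  have := K.continuous
  unfold denom
  fun_prop

variable {K} in
lemma denom_nonneg {x : E} {t : ℝ} (ht : t ∈ unitInterval) : 0 ≤ K.denom x t :=
  add_nonneg (by linarith [ht.2]) (mul_nonneg ht.1 (K.nonneg _))

variable {K} in
lemma denom_le_one {x : E} (hx : x ∈ K.closedCell) {t : ℝ} (ht : t ∈ unitInterval) :
    K.denom x t ≤ 1 := by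
  have := hx.2
  have := ht.1
  unfold denom
  nlinarith

variable {K} in
lemma p_le_denom {x : E} (hx : x ∈ K.closedCell) {t : ℝ} (ht : t ∈ unitInterval) :
    K.p (x - K.c) ≤ K.denom x t := by
  have := hx.2
  have := ht.2
  unfold denom
  nlinarith

variable {K} in
lemma push_mem_closedCell {x : E} (hx : x ∈ K.closedCell) {t : ℝ} (ht : t ∈ unitInterval) :
    K.c + (K.denom x t)⁻¹ • (x - K.c) ∈ K.closedCell := by
  refine K.scale_mem_closedCell (inv_nonneg.2 (denom_nonneg ht)) hx.1 ?_
  rw [inv_mul_eq_div]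
  exact div_le_one_of_le₀ (p_le_denom hx ht) (denom_nonneg ht)

variable {W : Set E}

open Classical in
/-- The radial deformation on the closed cell. -/
def pushOut (W : Set E) (q : E × ℝ) : OnePoint W :=
  if K.denom q.1 q.2 = 0 then OnePoint.infty
  else collapse W (K.c + (K.denom q.1 q.2)⁻¹ • (q.1 - K.c))

lemma continuousOn_pushOut (hW : IsLocallyClosed W) (hK : K.openCell ⊆ W) :
    ContinuousOn (K.pushOut W) ((K.closedCell \ {K.c}) ×ˢ unitInterval) := by
  rintro ⟨x, t⟩ ⟨⟨hx, hxc⟩, ht⟩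
  have hxc' : x - K.c ≠ 0 := sub_ne_zero.2 hxc
  have hden : ContinuousAt (fun q : E × ℝ => K.denom q.1 q.2) (x, t) :=
    K.continuous_denom.continuousAt
  by_cases h0 : K.denom x t = 0
  · intro N hN
    rw [pushOut, if_pos h0] at hN
    have hinf : OnePoint.infty ∈ N := mem_of_mem_nhds hN
    obtain ⟨B, hB, -, hBN⟩ := preimage_collapse_mem_of_mem_nhds_infty hN
    obtain ⟨R, hR⟩ := hB.isBounded.subset_closedBall K.c
    have hpos : 0 < ‖x - K.c‖ := norm_pos_iff.2 hxc'
    have h1 : ∀ᶠ q : E × ℝ in 𝓝 (x, t), K.denom q.1 q.2 * R < ‖q.1 - K.c‖ := by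
      refine ContinuousAt.eventually_lt (hden.mul continuousAt_const) (by fun_prop) ?_
      simpa [h0] using hxc'
    rw [mem_map]
    filter_upwards [mem_nhdsWithin_of_mem_nhds h1, self_mem_nhdsWithin] with q hq hq'
    rw [Set.mem_preimage, pushOut]
    split_ifs with h
    · exact hinf
    · refine hBN fun hmem => ?_
      have h2 := hR hmem
      have h3 : 0 < K.denom q.1 q.2 := lt_of_le_of_ne (denom_nonneg hq'.2) (Ne.symm h)
      rw [Metric.mem_closedBall, dist_eq_norm, add_sub_cancel_left, norm_smul, norm_inv,
        Real.norm_of_nonneg h3.le, inv_mul_le_iff₀ h3] at h2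
      linarith
  · have h1 : ContinuousWithinAt (fun q : E × ℝ => K.c + (K.denom q.1 q.2)⁻¹ • (q.1 - K.c))
        ((K.closedCell \ {K.c}) ×ˢ unitInterval) (x, t) := by
      have h2 : ContinuousAt (fun q : E × ℝ => (K.denom q.1 q.2)⁻¹) (x, t) := hden.inv₀ h0
      exact (continuousAt_const.add (h2.smul (by fun_prop))).continuousWithinAt
    have h2 : Set.MapsTo (fun q : E × ℝ => K.c + (K.denom q.1 q.2)⁻¹ • (q.1 - K.c))
        ((K.closedCell \ {K.c}) ×ˢ unitInterval) (closure W) := fun q hq =>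
      closure_mono hK (K.closedCell_subset_closure (push_mem_closedCell hq.1.1 hq.2))
    have h3 := ContinuousWithinAt.comp (x := (x, t)) (continuousOn_collapse hW _ (h2 ⟨⟨hx, hxc⟩, ht⟩)) h1 h2
    refine h3.congr_of_eventuallyEq ?_ (if_neg h0)
    filter_upwards [mem_nhdsWithin_of_mem_nhds (hden.eventually_ne h0)] with q hq
    exact if_neg hq

lemma pushOut_of_p_eq_one {x : E} (hx : K.p (x - K.c) = 1) (t : ℝ) :
    K.pushOut W (x, t) = collapse W x := by
  have h1 : K.denom x t = 1 := by
    rw [denom, hx]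
    ring
  simp [pushOut, h1]

lemma pushOut_zero (x : E) : K.pushOut W (x, 0) = collapse W x := by
  have h1 : K.denom x 0 = 1 := by simp [denom]
  simp [pushOut, h1]

end Cell

end EulerCalculus

namespace EulerCalculus

namespace Cell

variable {E : Type} [NormedAddCommGroup E] [NormedSpace ℝ E] (K : Cell E) {W : Set E}

open Classical in
/-- The deformation of the one-point compactification that moves the points of the cell outwards. -/
def radial (W : Set E) (t : ℝ) (y : OnePoint W) : OnePoint W :=
  y.elim OnePoint.infty fun x => if (x : E) ∈ K.openCell then K.pushOut W (x, t) else x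

lemma radial_of_mem {x : W} (hx : (x : E) ∈ K.openCell) (t : ℝ) :
    K.radial W t x = K.pushOut W (x, t) := if_pos hx

lemma radial_of_notMem {x : W} (hx : (x : E) ∉ K.openCell) (t : ℝ) : K.radial W t x = x :=
  if_neg hx

lemma radial_of_mem_closedCell {x : W} (hx : (x : E) ∈ K.closedCell) (t : ℝ) :
    K.radial W t x = K.pushOut W (x, t) := by
  by_cases h : (x : E) ∈ K.openCell
  · exact K.radial_of_mem h t
  · have h1 : K.p (x - K.c) = 1 := le_antisymm hx.2 (not_lt.1 fun h' => h ⟨hx.1, h'⟩)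
    rw [K.radial_of_notMem h, K.pushOut_of_p_eq_one h1, collapse_coe]

lemma radial_zero (y : OnePoint W) : K.radial W 0 y = y := by
  induction y using OnePoint.rec with
  | infty => rfl
  | coe x =>
    by_cases h : (x : E) ∈ K.openCell
    · rw [K.radial_of_mem h, K.pushOut_zero, collapse_coe]
    · exact K.radial_of_notMem h 0

variable (hK : K.openCell ⊆ W)

/-- The centre of the cell. -/
def center : W := ⟨K.c, hK K.center_mem⟩

lemma radial_ne_center {y : OnePoint W} (hy : y ≠ (K.center hK : OnePoint W)) (t : ℝ) :
    K.radial W t y ≠ (K.center hK : OnePoint W) := by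
  induction y using OnePoint.rec with
  | infty => exact OnePoint.infty_ne_coe _
  | coe x =>
    by_cases h : (x : E) ∈ K.openCell
    · rw [K.radial_of_mem h, pushOut]
      split_ifs with h0
      · exact OnePoint.infty_ne_coe _
      · by_cases hm : K.c + (K.denom x t)⁻¹ • ((x : E) - K.c) ∈ W
        · rw [collapse_of_mem hm, Ne, OnePoint.coe_eq_coe]
          intro h1
          have h2 := congrArg Subtype.val h1
          simp only [center, add_eq_left, smul_eq_zero, inv_eq_zero, h0, false_or,
            sub_eq_zero] at h2
          exact hy (congrArg _ (Subtype.ext h2))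
        · rw [collapse_of_notMem hm]
          exact OnePoint.infty_ne_coe _
    · rwa [K.radial_of_notMem h]

lemma radial_one_notMem {y : OnePoint W} (hy : y ≠ (K.center hK : OnePoint W)) {z : W}
    (hz : K.radial W 1 y = z) : (z : E) ∉ K.openCell := by
  induction y using OnePoint.rec with
  | infty => exact absurd hz (OnePoint.infty_ne_coe _)
  | coe x =>
    by_cases h : (x : E) ∈ K.openCell
    · have hden : K.denom x 1 = K.p ((x : E) - K.c) := by simp [denom]
      rw [K.radial_of_mem h, pushOut] at hz
      split_ifs at hz with h0
      · exact absurd hz (OnePoint.infty_ne_coe _)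
      · by_cases hm : K.c + (K.denom x 1)⁻¹ • ((x : E) - K.c) ∈ W
        · rw [collapse_of_mem hm, OnePoint.coe_eq_coe] at hz
          intro hz'
          rw [← hz] at hz'
          have h1 := hz'.2
          rw [add_sub_cancel_left, K.smul _ (by rw [hden]; exact inv_nonneg.2 (K.nonneg _)), hden,
            inv_mul_cancel₀ (hden ▸ h0)] at h1
          exact lt_irrefl _ h1
        · rw [collapse_of_notMem hm] at hz
          exact absurd hz (OnePoint.infty_ne_coe _)
    · rw [K.radial_of_notMem h, OnePoint.coe_eq_coe] at hz
      rwa [← hz]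

include hK in
lemma continuousWithinAt_radial_coe (hW : IsLocallyClosed W)
    (hZ : IsClosed {x : W | (x : E) ∉ K.openCell}) {x : W} (hx : (x : E) ≠ K.c) {t : ℝ}
    (ht : t ∈ unitInterval) :
    ContinuousWithinAt (fun q : W × ℝ => K.radial W q.2 q.1) (Set.univ ×ˢ unitInterval) (x, t) := by
  have hcover : (Set.univ : Set W) ×ˢ unitInterval ⊆
      {x : W | (x : E) ∈ K.closedCell} ×ˢ unitInterval ∪
        {x : W | (x : E) ∉ K.openCell} ×ˢ unitInterval := by
    rintro ⟨x, t⟩ ⟨-, ht⟩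
    by_cases h : (x : E) ∈ K.openCell
    · exact Or.inl ⟨K.openCell_subset_closedCell h, ht⟩
    · exact Or.inr ⟨h, ht⟩
  have hcl : IsClosed ({x : W | (x : E) ∈ K.closedCell} ×ˢ unitInterval) :=
    (K.isClosed_closedCell.preimage continuous_subtype_val).prod isClosed_Icc
  have hcl' : IsClosed ({x : W | (x : E) ∉ K.openCell} ×ˢ unitInterval) := hZ.prod isClosed_Icc
  refine ContinuousWithinAt.mono (ContinuousWithinAt.union ?_ ?_) hcover
  · by_cases h : (x : E) ∈ K.closedCell
    · have h1 : ContinuousWithinAt (K.pushOut W) ((K.closedCell \ {K.c}) ×ˢ unitInterval) (x, t) :=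
        K.continuousOn_pushOut hW hK _ ⟨⟨h, hx⟩, ht⟩
      have h2 : ContinuousWithinAt (fun q : W × ℝ => ((q.1 : E), q.2))
          ({x : W | (x : E) ∈ K.closedCell ∧ (x : E) ≠ K.c} ×ˢ unitInterval) (x, t) :=
        Continuous.continuousWithinAt (by fun_prop)
      have hmaps : Set.MapsTo (fun q : W × ℝ => ((q.1 : E), q.2))
          ({x : W | (x : E) ∈ K.closedCell ∧ (x : E) ≠ K.c} ×ˢ unitInterval)
          ((K.closedCell \ {K.c}) ×ˢ unitInterval) := fun q hq => ⟨⟨hq.1.1, hq.1.2⟩, hq.2⟩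
      have h3 := ContinuousWithinAt.comp (x := (x, t)) h1 h2 hmaps
      have h4 : ContinuousWithinAt (fun q : W × ℝ => K.radial W q.2 q.1)
          ({x : W | (x : E) ∈ K.closedCell ∧ (x : E) ≠ K.c} ×ˢ unitInterval) (x, t) :=
        h3.congr (fun q hq => K.radial_of_mem_closedCell hq.1.1 q.2)
          (K.radial_of_mem_closedCell h t)
      refine h4.mono_of_mem_nhdsWithin ?_
      have h5 : ∀ᶠ q : W × ℝ in 𝓝 (x, t), (q.1 : E) ≠ K.c :=
        ContinuousAt.eventually_ne (by fun_prop) hx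
      filter_upwards [self_mem_nhdsWithin, mem_nhdsWithin_of_mem_nhds h5] with q hq hq'
      exact ⟨⟨hq.1, hq'⟩, hq.2⟩
    · exact continuousWithinAt_of_notMem_closure (by
        rw [hcl.closure_eq]
        exact fun h' => h h'.1)
  · by_cases h : (x : E) ∈ K.openCell
    · exact continuousWithinAt_of_notMem_closure (by
        rw [hcl'.closure_eq]
        exact fun h' => h'.1 h)
    · have h1 : ContinuousWithinAt (fun q : W × ℝ => (q.1 : OnePoint W))
          ({x : W | (x : E) ∉ K.openCell} ×ˢ unitInterval) (x, t) :=
        (OnePoint.continuous_coe.comp continuous_fst).continuousWithinAt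
      exact h1.congr (fun q hq => K.radial_of_notMem hq.1 q.2) (K.radial_of_notMem h t)

include hK in
lemma continuousWithinAt_radial_infty (t : ℝ) :
    ContinuousWithinAt (fun q : OnePoint W × ℝ => K.radial W q.2 q.1) (Set.univ ×ˢ unitInterval)
      (OnePoint.infty, t) := by
  intro N hN
  obtain ⟨A, hA, hAN⟩ := exists_compact_of_mem_nhds_infty hN
  have hinf : OnePoint.infty ∈ N := mem_of_mem_nhds hN
  let B : Set E := (fun q : ℝ × E => K.c + q.1 • (q.2 - K.c)) ''
    (unitInterval ×ˢ (Subtype.val '' A ∩ K.closedCell))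
  have hA' : IsCompact (Subtype.val '' A : Set E) := hA.image continuous_subtype_val
  have hB : IsCompact B := by
    refine IsCompact.image (isCompact_Icc.prod (hA'.inter_right K.isClosed_closedCell)) ?_
    fun_prop
  have hBW : B ⊆ W := by
    rintro _ ⟨⟨s, a⟩, ⟨hs, ⟨a, ha, rfl⟩, ha'⟩, rfl⟩
    rcases hs.2.eq_or_lt with h | h
    · have h' : s = 1 := h
      simp only [h', one_smul, add_sub_cancel, Subtype.coe_prop]
    · refine hK (K.scale_mem_openCell hs.1 ha'.1 ?_)
      have h1 := ha'.2
      have h2 := hs.1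
      have h3 : s < 1 := h
      simp only at h2 ⊢
      nlinarith [K.nonneg ((a : E) - K.c)]
  have hC : IsCompact (A ∪ Subtype.val ⁻¹' B) :=
    hA.union (Topology.IsEmbedding.subtypeVal.isCompact_preimage' hB (by simpa using hBW))
  have hM : (((↑) : W → OnePoint W) '' (A ∪ Subtype.val ⁻¹' B))ᶜ ∈ 𝓝 OnePoint.infty := by
    refine IsOpen.mem_nhds ?_ OnePoint.infty_notMem_image_coe
    rw [OnePoint.isOpen_compl_image_coe]
    exact ⟨hC.isClosed, hC⟩
  rw [mem_map, nhdsWithin_prod_eq]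
  refine Filter.mem_of_superset (prod_mem_prod (mem_nhdsWithin_of_mem_nhds hM)
    self_mem_nhdsWithin) ?_
  rintro ⟨y, s⟩ ⟨hy, hs⟩
  change K.radial W s y ∈ N
  induction y using OnePoint.rec with
  | infty => exact hinf
  | coe x =>
    have hxA : x ∉ A := fun h => hy ⟨x, Or.inl h, rfl⟩
    have hxB : (x : E) ∉ B := fun h => hy ⟨x, Or.inr h, rfl⟩
    by_cases h : (x : E) ∈ K.openCell
    · rw [K.radial_of_mem h, pushOut]
      split_ifs with h0
      · exact hinf
      · refine hAN ?_
        rw [← Set.mem_preimage, preimage_collapse_of_compact]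
        intro hmem
        have hx' := K.openCell_subset_closedCell h
        refine hxB ⟨(K.denom x s, _), ⟨⟨denom_nonneg hs, denom_le_one hx' hs⟩, hmem,
          push_mem_closedCell hx' hs⟩, ?_⟩
        simp only [add_sub_cancel_left, smul_smul, mul_inv_cancel₀ h0, one_smul, add_sub_cancel]
    · rw [K.radial_of_notMem h]
      refine hAN ?_
      rintro ⟨a, ha, hax⟩
      rw [OnePoint.coe_eq_coe] at hax
      exact hxA (hax ▸ ha)

lemma continuousOn_radial (hW : IsLocallyClosed W)
    (hZ : IsClosed {x : W | (x : E) ∉ K.openCell}) :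
    ContinuousOn (fun q : OnePoint W × ℝ => K.radial W q.2 q.1)
      ({(K.center hK : OnePoint W)}ᶜ ×ˢ unitInterval) := by
  rintro ⟨y, t⟩ ⟨hy, ht⟩
  refine ContinuousWithinAt.mono (t := Set.univ ×ˢ unitInterval) ?_
    (Set.prod_mono (Set.subset_univ _) le_rfl)
  induction y using OnePoint.rec with
  | infty => exact K.continuousWithinAt_radial_infty hK t
  | coe x =>
    have hx : (x : E) ≠ K.c := fun h => hy (congrArg _ (Subtype.ext h : x = K.center hK))
    have h1 := K.continuousWithinAt_radial_coe hK hW hZ hx ht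
    rw [ContinuousWithinAt, nhdsWithin_prod_eq, nhdsWithin_univ] at h1 ⊢
    rw [OnePoint.nhds_coe_eq, ← Filter.map_id (f := 𝓝[unitInterval] t), Filter.prod_map_map_eq]
    exact h1

end Cell

end EulerCalculus

namespace EulerCalculus

namespace Cell

variable {E : Type} [NormedAddCommGroup E] [NormedSpace ℝ E] (K : Cell E) {W : Set E}

/-- The one-point compactification of a closed subset, inside the one-point compactification. -/
lemma isEmbedding_map_inclusion [FiniteDimensional ℝ E] (hW : IsLocallyClosed W) {Z : Set E}
    (hZW : Z ⊆ W) (hZ : IsClosed {x : W | (x : E) ∈ Z}) :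
    IsEmbedding (OnePoint.map (Set.inclusion hZW)) := by
  have : ProperSpace E := FiniteDimensional.proper ℝ E
  have : LocallyCompactSpace W := hW.locallyCompactSpace
  have hemb : IsClosedEmbedding (Set.inclusion hZW) :=
    ⟨Topology.IsEmbedding.inclusion hZW, by rwa [Set.range_inclusion]⟩
  have hcont : Continuous (OnePoint.map (Set.inclusion hZW)) := by
    refine OnePoint.continuous_map hemb.continuous ?_
    rw [coclosedCompact_eq_cocompact, coclosedCompact_eq_cocompact]
    exact hemb.tendsto_cocompact
  exact (hcont.isClosedEmbedding (Option.map_injective (Set.inclusion_injective hZW))).isEmbedding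

variable (hK : K.openCell ⊆ W)

include hK in
/-- The one-point compactification without the centre of the cell retracts onto the
one-point compactification of the complement of the cell. -/
lemma spaceEuler_compl_center [FiniteDimensional ℝ E] (hW : IsLocallyClosed W)
    (hZ : IsClosed {x : W | (x : E) ∉ K.openCell}) {k : ℤ}
    (h : SpaceEuler (OnePoint (W \ K.openCell : Set E)) k) :
    SpaceEuler ({(K.center hK : OnePoint W)}ᶜ : Set (OnePoint W)) k := by
  have hZ' : IsClosed {x : W | (x : E) ∈ W \ K.openCell} := by
    convert hZ using 2
    ext x
    simp
  let i := OnePoint.map (Set.inclusion (Set.sdiff_subset : W \ K.openCell ⊆ W))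
  have hi : IsEmbedding i := isEmbedding_map_inclusion hW _ hZ'
  have hrange : ∀ y : OnePoint W, y ∈ Set.range i ↔ ∀ z : W, y = z → (z : E) ∉ K.openCell := by
    intro y
    constructor
    · rintro ⟨x, rfl⟩ z hz
      induction x using OnePoint.rec with
      | infty => exact absurd hz (OnePoint.infty_ne_coe _)
      | coe x =>
        have h1 : Set.inclusion Set.sdiff_subset x = z := OnePoint.coe_eq_coe.1 hz
        rw [← h1]
        exact x.2.2
    · intro hy
      induction y using OnePoint.rec with
      | infty => exact ⟨OnePoint.infty, rfl⟩
      | coe x => exact ⟨((⟨x, x.2, hy x rfl⟩ : (W \ K.openCell : Set E)) : OnePoint _), rfl⟩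
  have hc : (K.center hK : OnePoint W) ∉ Set.range i := fun hmem =>
    (hrange _).1 hmem _ rfl K.center_mem
  have hcont := K.continuousOn_radial hK hW hZ
  have hrad : Continuous fun q : unitInterval × ({(K.center hK : OnePoint W)}ᶜ : Set (OnePoint W)) =>
      K.radial W q.1 q.2 := by
    refine hcont.comp_continuous (f := fun q : unitInterval ×
      ({(K.center hK : OnePoint W)}ᶜ : Set (OnePoint W)) => ((q.2 : OnePoint W), (q.1 : ℝ)))
      (by fun_prop) fun q => ⟨q.2.2, q.1.2⟩
  have hfix : ∀ y ∈ Set.range i, ∀ t, K.radial W t y = y := by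
    intro y hy t
    induction y using OnePoint.rec with
    | infty => rfl
    | coe x => exact K.radial_of_notMem ((hrange _).1 hy x rfl) t
  let f : C(Set.range i, ({(K.center hK : OnePoint W)}ᶜ : Set (OnePoint W))) :=
    ⟨fun y => ⟨y.1, fun hy => hc (hy ▸ y.2)⟩, by fun_prop⟩
  let g : C(({(K.center hK : OnePoint W)}ᶜ : Set (OnePoint W)), Set.range i) :=
    ⟨fun y => ⟨K.radial W 1 y, (hrange _).2 fun z hz => K.radial_one_notMem hK y.2 hz⟩, by
      refine Continuous.subtype_mk ?_ _
      exact hrad.comp (Continuous.prodMk continuous_const continuous_id :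
        Continuous fun y => ((1 : unitInterval), y))⟩
  have hgf : g.comp f = ContinuousMap.id _ := by
    ext y
    exact hfix y y.2 1
  refine (h.of_homeomorph hi.toHomeomorph).of_homotopyEquiv ⟨f, g, ?_, ?_⟩
  · rw [hgf]
  · refine ContinuousMap.Homotopic.symm ⟨?_⟩
    exact {
      toFun := fun q => ⟨K.radial W q.1 q.2, K.radial_ne_center hK q.2.2 q.1⟩
      continuous_toFun := hrad.subtype_mk _
      map_zero_left := fun y => Subtype.ext (K.radial_zero _)
      map_one_left := fun y => rfl }

include hK in
/-- A subset of the direction of the cell, as a subset of the one-point compactification. -/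
lemma exists_isEmbedding (S : Set K.D) (hS : ∀ v ∈ S, K.p v < 1) :
    ∃ e : S → OnePoint W, IsEmbedding e ∧ Set.range e =
      ((↑) : W → OnePoint W) '' {x | ∃ v ∈ S, (x : E) = K.c + v} := by
  have hmem : ∀ v : S, K.c + ((v : K.D) : E) ∈ W := fun v =>
    hK ⟨by simp, by simpa using hS v v.2⟩
  let j : S → W := fun v => ⟨K.c + ((v : K.D) : E), hmem v⟩
  have hj : IsEmbedding j := by
    refine Topology.IsEmbedding.of_comp (g := Subtype.val) (by fun_prop) continuous_subtype_val ?_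
    exact (Homeomorph.addLeft K.c).isEmbedding.comp
      (Topology.IsEmbedding.subtypeVal.comp Topology.IsEmbedding.subtypeVal)
  refine ⟨fun v => j v, OnePoint.isOpenEmbedding_coe.isEmbedding.comp hj, ?_⟩
  ext y
  constructor
  · rintro ⟨v, rfl⟩
    exact ⟨j v, ⟨v, v.2, rfl⟩, rfl⟩
  · rintro ⟨x, ⟨v, hv, hx⟩, rfl⟩
    exact ⟨⟨v, hv⟩, congrArg _ (Subtype.ext hx.symm)⟩

include hK in
/-- The effect of attaching a cell on the Euler characteristic of the one-point
compactification. -/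
theorem spaceEuler_attach [FiniteDimensional ℝ E] (hW : IsLocallyClosed W)
    (hZ : IsClosed {x : W | (x : E) ∉ K.openCell}) {k : ℤ}
    (h : SpaceEuler (OnePoint (W \ K.openCell : Set E)) k) :
    SpaceEuler (OnePoint W) (k + (-1) ^ Module.finrank ℝ K.D) := by
  let O : Set K.D := {v | K.p v < 1}
  have hO : IsOpen O := isOpen_lt (K.continuous.comp continuous_subtype_val) continuous_const
  have h0 : (0 : K.D) ∈ O := by
    change K.p ((0 : K.D) : E) < 1
    rw [Submodule.coe_zero, K.p_zero]
    exact one_pos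
  have hs : StarConvex ℝ 0 O := by
    rw [starConvex_zero_iff]
    intro v hv a ha ha1
    change K.p ((a • v : K.D) : E) < 1
    rw [Submodule.coe_smul, K.smul a ha]
    have h1 : K.p v < 1 := hv
    nlinarith [K.nonneg v]
  let U : Set (OnePoint W) := ((↑) : W → OnePoint W) '' {x | (x : E) ∈ K.openCell}
  have hU : IsOpen U := by
    refine OnePoint.isOpen_image_coe.2 ?_
    have := hZ.isOpen_compl
    convert this using 1
    ext x
    simp
  have hV : IsOpen ({(K.center hK : OnePoint W)}ᶜ : Set (OnePoint W)) := by
    have := OnePoint.isOpen_compl_image_coe (s := {K.center hK}).2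
      ⟨isClosed_singleton, isCompact_singleton⟩
    rwa [Set.image_singleton] at this
  have hcell : ∀ x : W, (x : E) ∈ K.openCell ↔ ∃ v ∈ O, (x : E) = K.c + v := by
    intro x
    constructor
    · intro hx
      exact ⟨⟨x - K.c, hx.1⟩, hx.2, by simp⟩
    · rintro ⟨v, hv, hx⟩
      have hv' : K.p v < 1 := hv
      rw [hx]
      exact ⟨by simp, by simpa using hv'⟩
  have hUV : U ∪ {(K.center hK : OnePoint W)}ᶜ = Set.univ := by
    refine Set.eq_univ_of_forall fun y => ?_
    by_cases hy : y = (K.center hK : OnePoint W)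
    · exact Or.inl ⟨K.center hK, K.center_mem, hy.symm⟩
    · exact Or.inr hy
  have hkU : SpaceEuler U 1 := by
    obtain ⟨e, he, hrange⟩ := K.exists_isEmbedding hK O fun v hv => hv
    have : ContractibleSpace O := hs.contractibleSpace ⟨0, h0⟩
    have h1 := (spaceEuler_of_contractible O).of_homeomorph he.toHomeomorph
    have h2 : Set.range e = U := by
      rw [hrange]
      congr 1
      ext x
      exact (hcell x).symm
    rwa [h2] at h1
  have hkUV : SpaceEuler (U ∩ {(K.center hK : OnePoint W)}ᶜ : Set (OnePoint W))
      (1 - (-1) ^ Module.finrank ℝ K.D) := by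
    obtain ⟨e, he, hrange⟩ := K.exists_isEmbedding hK {v | v ∈ O ∧ v ≠ 0} fun v hv => hv.1
    have h1 := (spaceEuler_punctured_starConvex hO h0 hs).of_homeomorph he.toHomeomorph
    have h2 : Set.range e = U ∩ {(K.center hK : OnePoint W)}ᶜ := by
      rw [hrange]
      ext y
      constructor
      · rintro ⟨x, ⟨v, hv, hx⟩, rfl⟩
        refine ⟨⟨x, (hcell x).2 ⟨v, hv.1, hx⟩, rfl⟩, fun hxc => hv.2 ?_⟩
        have h3 : (x : E) = K.c := congrArg Subtype.val (OnePoint.coe_eq_coe.1 hxc)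
        rw [h3, left_eq_add] at hx
        exact Subtype.ext hx
      · rintro ⟨⟨x, hx, rfl⟩, hy⟩
        obtain ⟨v, hv, hxv⟩ := (hcell x).1 hx
        refine ⟨x, ⟨v, ⟨hv, ?_⟩, hxv⟩, rfl⟩
        rintro rfl
        rw [Submodule.coe_zero, add_zero] at hxv
        exact hy (congrArg _ (Subtype.ext hxv : x = K.center hK))
    rwa [h2] at h1
  have := SpaceEuler.union hU hV hUV hkU (K.spaceEuler_compl_center hK hW hZ h) hkUV
  convert this using 1
  ring

end Cell

end EulerCalculus

namespace EulerCalculus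

/-! ### Real affine hyperplane arrangements -/

variable {E : Type} [NormedAddCommGroup E] [NormedSpace ℝ E] {ι : Type}

/-- A finite family of affine functions. -/
structure Arrangement (E : Type) [NormedAddCommGroup E] [NormedSpace ℝ E] (ι : Type) where
  /-- the linear parts -/
  lin : ι → E →L[ℝ] ℝ
  /-- the constants -/
  const : ι → ℝ

namespace Arrangement

variable (A : Arrangement E ι)

/-- The affine functions. -/
def eval (i : ι) (x : E) : ℝ := A.lin i x + A.const i

/-- The signs of the affine functions at a point. -/
def signVec (x : E) : ι → SignType := fun i => SignType.sign (A.eval i x)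

/-- The union of the cells with given sign vectors. -/
def stratum (S : Set (ι → SignType)) : Set E := {x | A.signVec x ∈ S}

/-- The direction of the affine hull of a cell. -/
def direction (s : ι → SignType) : Submodule ℝ E :=
  ⨅ i : {i // s i = 0}, LinearMap.ker (A.lin i : E →ₗ[ℝ] ℝ)

open Classical in
/-- The contribution of a cell to the Euler characteristic. -/
def index (s : ι → SignType) : ℤ :=
  if ∃ x, A.signVec x = s then (-1) ^ Module.finrank ℝ (A.direction s) else 0

lemma continuous_eval (i : ι) : Continuous (A.eval i) := by
  unfold eval
  fun_prop

lemma eval_add (i : ι) (c v : E) : A.eval i (c + v) = A.eval i c + A.lin i v := by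
  simp only [eval, map_add]
  ring

lemma mem_direction {s : ι → SignType} {v : E} :
    v ∈ A.direction s ↔ ∀ i, s i = 0 → A.lin i v = 0 := by
  simp [direction, Submodule.mem_iInf]

variable [Fintype ι]

/-- The gauge of a cell with respect to a point `c`. -/
def gauge (c v : E) : NNReal := Finset.univ.sup fun i => Real.toNNReal (-(A.lin i v) / A.eval i c)

lemma gauge_lt_one {c v : E} : A.gauge c v < 1 ↔ ∀ i, -(A.lin i v) / A.eval i c < 1 := by
  rw [gauge, Finset.sup_lt_iff (by simp)]
  simp

/-- A nonempty cell of the arrangement. -/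
def cell [FiniteDimensional ℝ E] (c : E) : Cell E where
  c := c
  D := A.direction (A.signVec c)
  p v := A.gauge c v
  isClosed := Submodule.closed_of_finiteDimensional _
  continuous := by
    refine NNReal.continuous_coe.comp (Continuous.finset_sup_apply fun i _ => ?_)
    exact continuous_real_toNNReal.comp (by fun_prop)
  nonneg v := NNReal.coe_nonneg _
  smul s hs v := by
    lift s to NNReal using hs
    rw [← NNReal.coe_mul, gauge, gauge, NNReal.mul_finset_sup]
    congr 2
    funext i
    rw [map_smul, smul_eq_mul, ← mul_neg, mul_div_assoc, Real.toNNReal_mul s.coe_nonneg,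
      Real.toNNReal_coe]

lemma sign_add_eq_iff {a t : ℝ} (ha : a ≠ 0) :
    SignType.sign (a + t) = SignType.sign a ↔ -t / a < 1 := by
  rcases ha.lt_or_gt with h | h
  · rw [sign_neg h, sign_eq_neg_one_iff, div_lt_one_of_neg h]
    constructor <;> intro <;> linarith
  · rw [sign_pos h, sign_eq_one_iff, div_lt_one h]
    constructor <;> intro <;> linarith

lemma openCell_cell [FiniteDimensional ℝ E] (c : E) :
    (A.cell c).openCell = A.stratum {A.signVec c} := by
  ext x
  obtain ⟨v, rfl⟩ : ∃ v, x = c + v := ⟨x - c, by simp⟩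
  change (c + v - c ∈ A.direction (A.signVec c) ∧ ((A.gauge c (c + v - c) : NNReal) : ℝ) < 1) ↔
    A.signVec (c + v) = A.signVec c
  rw [add_sub_cancel_left, NNReal.coe_lt_one, gauge_lt_one, mem_direction, ← forall_and,
    funext_iff]
  refine forall_congr' fun i => ?_
  simp only [signVec, eval_add, sign_eq_zero_iff]
  by_cases h : A.eval i c = 0
  · simp [h]
  · simp [h, sign_add_eq_iff h]

lemma isOpen_agree (s : ι → SignType) :
    IsOpen {x : E | ∀ i, s i ≠ 0 → A.signVec x i = s i} := by
  have h : {x : E | ∀ i, s i ≠ 0 → A.signVec x i = s i} =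
      ⋂ i, {x | s i ≠ 0 → A.signVec x i = s i} := by
    ext
    simp
  rw [h]
  refine isOpen_iInter_of_finite fun i => ?_
  rcases hs : s i with _ | _ | _
  · simp
  · simp only [signVec, ne_eq, SignType.neg_eq_neg_one, sign_eq_neg_one_iff]
    simpa using isOpen_lt (A.continuous_eval i) continuous_const
  · simp only [signVec, ne_eq, SignType.pos_eq_one, sign_eq_one_iff]
    simpa using isOpen_lt continuous_const (A.continuous_eval i)

/-- The Euler characteristic of the one-point compactification of a union of cells. -/
theorem spaceEuler_stratum [DecidableEq ι] [FiniteDimensional ℝ E] (S : Finset (ι → SignType))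
    (hS : IsLocallyClosed (A.stratum S)) :
    SpaceEuler (OnePoint (A.stratum S)) (1 + ∑ s ∈ S, A.index s) := by
  induction hn : S.card generalizing S with
  | zero =>
    obtain rfl := Finset.card_eq_zero.1 hn
    have : IsEmpty (A.stratum ((∅ : Finset (ι → SignType)) : Set (ι → SignType))) :=
      ⟨fun x => by simpa [stratum] using x.2⟩
    have : Subsingleton (OnePoint (A.stratum ((∅ : Finset (ι → SignType)) : Set _))) :=
      inferInstanceAs (Subsingleton (Option _))
    have : Nonempty (OnePoint (A.stratum ((∅ : Finset (ι → SignType)) : Set _))) :=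
      ⟨OnePoint.infty⟩
    simpa using spaceEuler_of_contractible
      (OnePoint (A.stratum ((∅ : Finset (ι → SignType)) : Set _)))
  | succ n ih =>
    have hne : S.Nonempty := Finset.card_pos.1 (by lia)
    obtain ⟨s, hs, hmax⟩ := S.exists_max_image
      (fun s => (Finset.univ.filter fun i => s i ≠ 0).card) hne
    have hagree : ∀ s' ∈ S, (∀ i, s i ≠ 0 → s' i = s i) → s' = s := by
      intro s' hs' h
      have hsub : (Finset.univ.filter fun i => s i ≠ 0) ⊆ Finset.univ.filter fun i => s' i ≠ 0 := by
        intro i hi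
        simp only [Finset.mem_filter, Finset.mem_univ, true_and] at hi ⊢
        rwa [h i hi]
      have heq := Finset.eq_of_subset_of_card_le hsub (hmax s' hs')
      funext i
      by_cases hi : s i = 0
      · by_contra hne'
        have : i ∈ Finset.univ.filter fun i => s' i ≠ 0 := by
          simpa using fun h0 => hne' (h0.trans hi.symm)
        rw [← heq] at this
        simp [hi] at this
      · exact h i hi
    have hdiff : A.stratum S \ A.stratum {s} = A.stratum (S.erase s : Finset _) := by
      ext x
      simp only [stratum, Set.mem_sdiff, Set.mem_ofPred_eq, Finset.mem_coe, Finset.mem_erase,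
        Set.mem_singleton_iff]
      tauto
    have hcell : A.stratum S ∩ {x : E | ∀ i, s i ≠ 0 → A.signVec x i = s i} = A.stratum {s} := by
      ext x
      constructor
      · rintro ⟨h1, h2⟩
        exact hagree _ h1 h2
      · intro h
        have h' : A.signVec x = s := h
        refine ⟨?_, fun i _ => congr_fun h' i⟩
        change A.signVec x ∈ (S : Set _)
        rw [h']
        exact hs
    have hloc : IsLocallyClosed (A.stratum (S.erase s : Finset _)) := by
      have h1 := hS.inter (A.isOpen_agree s).isClosed_compl.isLocallyClosed
      rw [← hdiff, ← hcell]
      convert h1 using 1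
      ext x
      simp only [Set.mem_sdiff, Set.mem_inter_iff, Set.mem_compl_iff]
      tauto
    have hind := ih (S.erase s) hloc (by rw [Finset.card_erase_of_mem hs]; lia)
    rw [← hdiff] at hind
    rw [← Finset.add_sum_erase S _ hs]
    by_cases hex : ∃ c, A.signVec c = s
    · obtain ⟨c, rfl⟩ := hex
      rw [index, if_pos ⟨c, rfl⟩]
      rw [← openCell_cell] at hind
      have hsub : (A.cell c).openCell ⊆ A.stratum S := by
        rw [openCell_cell, ← hcell]
        exact Set.inter_subset_left
      have hclosed : IsClosed {x : A.stratum S | (x : E) ∉ (A.cell c).openCell} := by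
        have h1 := (A.isOpen_agree (A.signVec c)).isClosed_compl.preimage
          (continuous_subtype_val (p := (· ∈ A.stratum S)))
        convert h1 using 1
        ext x
        rw [openCell_cell, ← hcell]
        simp
      have := (A.cell c).spaceEuler_attach hsub hS hclosed hind
      convert this using 1
      change _ = _ + (-1) ^ Module.finrank ℝ (A.direction (A.signVec c))
      ring
    · rw [index, if_neg hex, zero_add]
      have h1 : A.stratum {s} = ∅ := Set.eq_empty_of_forall_notMem fun x hx => hex ⟨x, hx⟩
      rwa [h1, Set.sdiff_empty] at hind

end Arrangement

end EulerCalculus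

namespace EulerCalculus

/-! ### Complements of complex hyperplane arrangements -/

variable {E : Type} [NormedAddCommGroup E] [NormedSpace ℂ E] {κ : Type}

namespace Arrangement

/-- The real and imaginary parts of complex affine functions. -/
def ofComplex (lam : κ → E →L[ℂ] ℂ) (p : κ → ℂ) : Arrangement E (κ ⊕ κ) where
  lin := Sum.elim (fun i => Complex.reCLM.comp ((lam i).restrictScalars ℝ))
    (fun i => Complex.imCLM.comp ((lam i).restrictScalars ℝ))
  const := Sum.elim (fun i => (p i).re) (fun i => (p i).im)

variable (lam : κ → E →L[ℂ] ℂ) (p : κ → ℂ)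

lemma signVec_ofComplex_inl (v : E) (i : κ) :
    (ofComplex lam p).signVec v (Sum.inl i) = SignType.sign (lam i v + p i).re := rfl

lemma signVec_ofComplex_inr (v : E) (i : κ) :
    (ofComplex lam p).signVec v (Sum.inr i) = SignType.sign (lam i v + p i).im := rfl

lemma signVec_ofComplex_eq_zero_iff (v : E) (i : κ) :
    ((ofComplex lam p).signVec v (Sum.inl i) = 0 ∧ (ofComplex lam p).signVec v (Sum.inr i) = 0) ↔
      lam i v + p i = 0 := by
  rw [signVec_ofComplex_inl, signVec_ofComplex_inr, sign_eq_zero_iff, sign_eq_zero_iff,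
    Complex.ext_iff]
  rfl

lemma direction_ofComplex_zero :
    (ofComplex lam p).direction 0 =
      (⨅ i, LinearMap.ker (lam i : E →ₗ[ℂ] ℂ)).restrictScalars ℝ := by
  ext v
  rw [mem_direction, Submodule.restrictScalars_mem, Submodule.mem_iInf]
  simp only [Sum.forall, Pi.zero_apply, forall_const]
  rw [← forall_and]
  refine forall_congr' fun i => ?_
  rw [LinearMap.mem_ker]
  change ((lam i v).re = 0 ∧ (lam i v).im = 0) ↔ lam i v = 0
  rw [Complex.ext_iff]
  rfl

lemma index_ofComplex_zero (h : ∃ v, ∀ i, lam i v + p i = 0) :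
    (ofComplex lam p).index 0 = 1 := by
  obtain ⟨v, hv⟩ := h
  have hv' : (ofComplex lam p).signVec v = 0 := by
    funext i
    rcases i with i | i
    · exact ((signVec_ofComplex_eq_zero_iff lam p v i).2 (hv i)).1
    · exact ((signVec_ofComplex_eq_zero_iff lam p v i).2 (hv i)).2
  rw [index, if_pos ⟨v, hv'⟩, direction_ofComplex_zero]
  have : Module.finrank ℝ ((⨅ i, LinearMap.ker (lam i : E →ₗ[ℂ] ℂ)).restrictScalars ℝ) =
      2 * Module.finrank ℂ (⨅ i, LinearMap.ker (lam i : E →ₗ[ℂ] ℂ) : Submodule ℂ E) :=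
    finrank_real_of_complex (⨅ i, LinearMap.ker (lam i : E →ₗ[ℂ] ℂ) : Submodule ℂ E)
  rw [this, pow_mul]
  simp

lemma isClosed_zeros (I : Set κ) : IsClosed {v : E | ∀ i ∈ I, lam i v + p i = 0} := by
  simp only [Set.ofPred_forall]
  refine isClosed_biInter fun i _ => ?_
  exact isClosed_eq (by fun_prop) continuous_const

lemma spaceEuler_zeros [FiniteDimensional ℂ E] [Fintype κ]
    (h : ∃ v, ∀ i, lam i v + p i = 0) :
    SpaceEuler (OnePoint {v : E | ∀ i, lam i v + p i = 0}) 2 := by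
  classical
  have : FiniteDimensional ℝ E := FiniteDimensional.complexToReal E
  have hset : (ofComplex lam p).stratum ({0} : Finset (κ ⊕ κ → SignType)) =
      {v : E | ∀ i, lam i v + p i = 0} := by
    ext v
    simp only [stratum, Finset.coe_singleton, Set.mem_singleton_iff, Set.mem_ofPred_eq, funext_iff,
      Sum.forall, Pi.zero_apply]
    rw [← forall_and]
    exact forall_congr' fun i => signVec_ofComplex_eq_zero_iff lam p v i
  have hc : IsClosed {v : E | ∀ i, lam i v + p i = 0} := by
    simpa using isClosed_zeros lam p Set.univ
  have h1 := (ofComplex lam p).spaceEuler_stratum {0} (by rw [hset]; exact hc.isLocallyClosed)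
  rw [hset, Finset.sum_singleton, index_ofComplex_zero lam p h] at h1
  exact h1

variable [FiniteDimensional ℂ E] [Fintype κ] [DecidableEq κ]

open Classical in
lemma sum_index_ofComplex (I : Finset κ) :
    ∑ s : κ ⊕ κ → SignType with ∀ i ∈ I, s (Sum.inl i) = 0 ∧ s (Sum.inr i) = 0,
      (ofComplex lam p).index s = if ∃ v, ∀ i ∈ I, lam i v + p i = 0 then 1 else 0 := by
  have : FiniteDimensional ℝ E := FiniteDimensional.complexToReal E
  split_ifs with h
  · set S : Finset (κ ⊕ κ → SignType) :=
      Finset.univ.filter fun s => ∀ i ∈ I, s (Sum.inl i) = 0 ∧ s (Sum.inr i) = 0 with hS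
    have hset : (ofComplex lam p).stratum S = {v : E | ∀ i ∈ I, lam i v + p i = 0} := by
      ext v
      simp only [hS, stratum, Finset.coe_filter, Finset.mem_univ, true_and, Set.mem_ofPred_eq,
        signVec_ofComplex_eq_zero_iff]
    have hc := isClosed_zeros lam p (I : Set κ)
    have h1 := (ofComplex lam p).spaceEuler_stratum S (by rw [hset]; exact hc.isLocallyClosed)
    have h2 := spaceEuler_zeros (fun i : I => lam i) (fun i : I => p i) (by simpa using h)
    rw [hset] at h1
    have hset' : {v : E | ∀ i : I, lam i v + p i = 0} = {v : E | ∀ i ∈ I, lam i v + p i = 0} := by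
      ext v
      simp
    rw [hset'] at h2
    have h3 := HasEuler.unique h1 h2
    linarith
  · refine Finset.sum_eq_zero fun s hs => ?_
    rw [index, if_neg]
    rintro ⟨v, rfl⟩
    refine h ⟨v, fun i hi => ?_⟩
    exact (signVec_ofComplex_eq_zero_iff lam p v i).1 ((Finset.mem_filter.1 hs).2 i hi)

omit [DecidableEq κ] in
open Classical in
/-- The Euler characteristic of the complement of a complex hyperplane arrangement. -/
theorem spaceEuler_complement :
    SpaceEuler (OnePoint {v : E | ∀ i, lam i v + p i ≠ 0})
      (1 + ∑ I : Finset κ, (-1) ^ I.card *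
        if ∃ v, ∀ i ∈ I, lam i v + p i = 0 then 1 else 0) := by
  have : FiniteDimensional ℝ E := FiniteDimensional.complexToReal E
  set S : Finset (κ ⊕ κ → SignType) :=
    Finset.univ.filter fun s => ∀ i, ¬ (s (Sum.inl i) = 0 ∧ s (Sum.inr i) = 0) with hS
  have hset : (ofComplex lam p).stratum S = {v : E | ∀ i, lam i v + p i ≠ 0} := by
    ext v
    simp only [hS, stratum, Finset.coe_filter, Finset.mem_univ, true_and, Set.mem_ofPred_eq,
      signVec_ofComplex_eq_zero_iff, ne_eq]
  have ho : IsOpen {v : E | ∀ i, lam i v + p i ≠ 0} := by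
    simp only [Set.ofPred_forall]
    refine isOpen_iInter_of_finite fun i => ?_
    exact isOpen_ne_fun (by fun_prop) continuous_const
  have h1 := (ofComplex lam p).spaceEuler_stratum S (by rw [hset]; exact ho.isLocallyClosed)
  rw [hset] at h1
  convert h1 using 2
  simp only [← sum_index_ofComplex, Finset.mul_sum]
  simp only [Finset.sum_filter, hS]
  rw [Finset.sum_comm]
  refine Finset.sum_congr rfl fun s _ => ?_
  set Z : Finset κ := Finset.univ.filter fun i => s (Sum.inl i) = 0 ∧ s (Sum.inr i) = 0 with hZ
  have e1 : ∀ I : Finset κ, (∀ i ∈ I, s (Sum.inl i) = 0 ∧ s (Sum.inr i) = 0) ↔ I ∈ Z.powerset := by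
    intro I
    simp [hZ, Finset.subset_iff]
  have e2 : (∀ i, ¬ (s (Sum.inl i) = 0 ∧ s (Sum.inr i) = 0)) ↔ Z = ∅ := by
    simp [hZ, Finset.filter_eq_empty_iff]
  simp only [e1, e2]
  rw [← Finset.sum_filter, Finset.filter_mem_eq_inter, Finset.univ_inter, ← Finset.sum_mul,
    Finset.sum_powerset_neg_one_pow_card]
  simp

end Arrangement

end EulerCalculus

namespace EulerCalculus

/-! ### Complements of coordinate hyperplanes in projective subspaces -/

variable {r : ℕ}

/-- The points of a projective subspace all of whose coordinates are different from zero. -/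
def projComplement (L : Submodule ℂ (Fin r → ℂ)) : Set (ℙ ℂ (Fin r → ℂ)) :=
  {q | ∃ a : Fin r → ℂ, ∃ ha : a ≠ 0, (a ∈ L ∧ ∀ i, a i ≠ 0) ∧ q = Projectivization.mk ℂ a ha}

/-- The subspace where some of the coordinates vanish. -/
def coordSubspace (I : Finset (Fin r)) : Submodule ℂ (Fin r → ℂ) :=
  ⨅ i ∈ I, LinearMap.ker (LinearMap.proj i : (Fin r → ℂ) →ₗ[ℂ] ℂ)

lemma mem_coordSubspace {I : Finset (Fin r)} {a : Fin r → ℂ} :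
    a ∈ coordSubspace I ↔ ∀ i ∈ I, a i = 0 := by
  simp [coordSubspace, Submodule.mem_iInf]

/-- The affine coordinates on the chart of the projective space where a coordinate is
different from zero. -/
def chart (i₀ : Fin r) (q : ℙ ℂ (Fin r → ℂ)) : Fin r → ℂ := (q.rep i₀)⁻¹ • q.rep

lemma chart_mk (i₀ : Fin r) (a : Fin r → ℂ) (ha : a ≠ 0) :
    chart i₀ (Projectivization.mk ℂ a ha) = (a i₀)⁻¹ • a := by
  obtain ⟨c, hc⟩ := Projectivization.exists_smul_eq_mk_rep ℂ a ha
  rw [chart, ← hc]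
  change (c • a i₀)⁻¹ • (c : ℂ) • a = _
  rw [Units.smul_def, smul_smul, smul_eq_mul, mul_inv, mul_right_comm, inv_mul_cancel₀ c.ne_zero,
    one_mul]

lemma isQuotientMap_mk' : IsQuotientMap (Projectivization.mk' ℂ (V := Fin r → ℂ)) :=
  ⟨⟨rfl⟩, fun q => ⟨⟨q.rep, q.rep_nonzero⟩, q.mk_rep⟩⟩

/-- The chart where a coordinate is different from zero. -/
def chartDomain (i₀ : Fin r) : Set (ℙ ℂ (Fin r → ℂ)) := {q | chart i₀ q i₀ ≠ 0}

lemma mk_mem_chartDomain {i₀ : Fin r} {a : Fin r → ℂ} (ha : a ≠ 0) :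
    Projectivization.mk ℂ a ha ∈ chartDomain i₀ ↔ a i₀ ≠ 0 := by
  change chart i₀ _ i₀ ≠ 0 ↔ _
  rw [chart_mk]
  simp

lemma preimage_chartDomain (i₀ : Fin r) :
    Projectivization.mk' ℂ ⁻¹' chartDomain i₀ = {a : {a : Fin r → ℂ // a ≠ 0} | a.1 i₀ ≠ 0} := by
  ext a
  exact mk_mem_chartDomain a.2

lemma isOpen_chartDomain (i₀ : Fin r) : IsOpen (chartDomain i₀) := by
  rw [← isQuotientMap_mk'.isOpen_preimage, preimage_chartDomain]
  exact isOpen_ne_fun ((continuous_apply i₀).comp continuous_subtype_val) continuous_const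

lemma continuousOn_chart (i₀ : Fin r) : ContinuousOn (chart i₀) (chartDomain i₀) := by
  rw [isQuotientMap_mk'.continuousOn_isOpen_iff (isOpen_chartDomain i₀), preimage_chartDomain]
  have h : chart i₀ ∘ Projectivization.mk' ℂ =
      fun a : {a : Fin r → ℂ // a ≠ 0} => (a.1 i₀)⁻¹ • a.1 := by
    funext a
    exact chart_mk i₀ a.1 a.2
  rw [h]
  refine ContinuousOn.smul (ContinuousOn.inv₀ ?_ fun a ha => ha) (by fun_prop)
  exact ((continuous_apply i₀).comp continuous_subtype_val).continuousOn

/-- The directions of the affine part of a projective subspace. -/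
def affineDirection (L : Submodule ℂ (Fin r → ℂ)) (i₀ : Fin r) : Submodule ℂ (Fin r → ℂ) :=
  L ⊓ LinearMap.ker (LinearMap.proj i₀ : (Fin r → ℂ) →ₗ[ℂ] ℂ)

lemma mem_affineDirection {L : Submodule ℂ (Fin r → ℂ)} {i₀ : Fin r} {v : Fin r → ℂ} :
    v ∈ affineDirection L i₀ ↔ v ∈ L ∧ v i₀ = 0 := by
  simp [affineDirection]

/-- The coordinates on the affine part of a projective subspace. -/
def affineCoord (L : Submodule ℂ (Fin r → ℂ)) (i₀ i : Fin r) : affineDirection L i₀ →L[ℂ] ℂ :=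
  (ContinuousLinearMap.proj i).comp (affineDirection L i₀).subtypeL

/-- The complement of the coordinate hyperplanes is contained in a chart. -/
def projComplementHomeomorph (L : Submodule ℂ (Fin r → ℂ)) (i₀ : Fin r) (p : Fin r → ℂ)
    (hp : p ∈ L) (hp1 : p i₀ = 1) :
    {v : affineDirection L i₀ | ∀ i, affineCoord L i₀ i v + p i ≠ 0} ≃ₜ projComplement L where
  toFun v := ⟨Projectivization.mk ℂ (v.1.1 + p) fun h => v.2 i₀ (congr_fun h i₀),
    v.1.1 + p, fun h => v.2 i₀ (congr_fun h i₀),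
    ⟨L.add_mem (mem_affineDirection.1 v.1.2).1 hp, v.2⟩, rfl⟩
  invFun q := ⟨⟨chart i₀ q - p, by
    obtain ⟨_, a, ha, ⟨haL, ha0⟩, rfl⟩ := q
    rw [chart_mk, mem_affineDirection]
    refine ⟨L.sub_mem (L.smul_mem _ haL) hp, ?_⟩
    simp [hp1, ha0 i₀]⟩, by
    obtain ⟨_, a, ha, ⟨haL, ha0⟩, rfl⟩ := q
    intro i
    change chart i₀ _ i - p i + p i ≠ 0
    rw [chart_mk]
    simp [ha0]⟩
  left_inv v := by
    have h0 := (mem_affineDirection.1 v.1.2).2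
    refine Subtype.ext (Subtype.ext ?_)
    change chart i₀ (Projectivization.mk ℂ (v.1.1 + p) _) - p = v.1.1
    rw [chart_mk]
    simp [h0, hp1]
  right_inv q := by
    obtain ⟨_, a, ha, ⟨haL, ha0⟩, rfl⟩ := q
    refine Subtype.ext ?_
    change Projectivization.mk ℂ (chart i₀ (Projectivization.mk ℂ a ha) - p + p) _ = _
    rw [Projectivization.mk_eq_mk_iff']
    exact ⟨(a i₀)⁻¹, by rw [chart_mk, sub_add_cancel]⟩
  continuous_toFun := by
    refine Continuous.subtype_mk ?_ _
    exact isQuotientMap_mk'.continuous.comp (f := fun v :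
      {v : affineDirection L i₀ | ∀ i, affineCoord L i₀ i v + p i ≠ 0} =>
      (⟨v.1.1 + p, fun h => v.2 i₀ (congr_fun h i₀)⟩ : {a : Fin r → ℂ // a ≠ 0})) (by fun_prop)
  continuous_invFun := by
    refine Continuous.subtype_mk (Continuous.subtype_mk (Continuous.sub ?_ continuous_const) _) _
    refine (continuousOn_chart i₀).comp_continuous continuous_subtype_val ?_
    rintro ⟨_, a, ha, ⟨haL, ha0⟩, rfl⟩
    exact (mk_mem_chartDomain ha).2 (ha0 i₀)

open Classical in
lemma finrank_inf_ker (M : Submodule ℂ (Fin r → ℂ)) (i₀ : Fin r) :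
    (Module.finrank ℂ M : ℤ) - Module.finrank ℂ
      (M ⊓ LinearMap.ker (LinearMap.proj i₀ : (Fin r → ℂ) →ₗ[ℂ] ℂ) : Submodule ℂ (Fin r → ℂ)) =
      if ∃ a ∈ M, a i₀ = 1 then 1 else 0 := by
  set f : M →ₗ[ℂ] ℂ := (LinearMap.proj i₀ : (Fin r → ℂ) →ₗ[ℂ] ℂ).domRestrict M with hf
  have h1 := f.finrank_range_add_finrank_ker
  have h2 : Module.finrank ℂ (LinearMap.ker f) = Module.finrank ℂ
      (M ⊓ LinearMap.ker (LinearMap.proj i₀ : (Fin r → ℂ) →ₗ[ℂ] ℂ) : Submodule ℂ (Fin r → ℂ)) := by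
    have e := LinearMap.ker_domRestrict M (LinearMap.proj i₀ : (Fin r → ℂ) →ₗ[ℂ] ℂ)
    rw [hf, e, ← Submodule.map_comap_subtype]
    exact (LinearEquiv.finrank_eq (Submodule.equivMapOfInjective _ M.injective_subtype _))
  rw [← h1, h2]
  push_cast
  rw [add_sub_cancel_right]
  split_ifs with h
  · obtain ⟨a, ha, ha1⟩ := h
    have : LinearMap.range f = ⊤ := by
      rw [eq_top_iff]
      rintro c -
      exact ⟨c • ⟨a, ha⟩, by simp [hf, ha1]⟩
    rw [this]
    simp
  · have : f = 0 := by
      ext ⟨a, ha⟩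
      by_contra h0
      refine h ⟨(a i₀)⁻¹ • a, M.smul_mem _ ha, ?_⟩
      exact inv_mul_cancel₀ h0
    rw [this, LinearMap.range_zero, finrank_bot, Nat.cast_zero]

open Classical in
lemma sum_finrank_coordSubspace (L : Submodule ℂ (Fin r → ℂ)) (i₀ : Fin r) :
    ∑ I : Finset (Fin r), (-1 : ℤ) ^ I.card *
      (Module.finrank ℂ (L ⊓ coordSubspace I : Submodule ℂ (Fin r → ℂ)) : ℤ) =
    ∑ I : Finset (Fin r), (-1) ^ I.card *
      if i₀ ∉ I ∧ ∃ a ∈ L ⊓ coordSubspace I, a i₀ = 1 then 1 else 0 := by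
  rw [← Finset.powerset_univ, ← Finset.insert_erase (Finset.mem_univ i₀),
    Finset.sum_powerset_insert (Finset.notMem_erase _ _),
    Finset.sum_powerset_insert (Finset.notMem_erase _ _), ← Finset.sum_add_distrib,
    ← Finset.sum_add_distrib]
  refine Finset.sum_congr rfl fun I hI => ?_
  have hI0 : i₀ ∉ I := fun h => Finset.notMem_erase i₀ _ (Finset.mem_powerset.1 hI h)
  have e : L ⊓ coordSubspace (insert i₀ I) = (L ⊓ coordSubspace I) ⊓
      LinearMap.ker (LinearMap.proj i₀ : (Fin r → ℂ) →ₗ[ℂ] ℂ) := by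
    ext a
    simp only [Submodule.mem_inf, mem_coordSubspace, Finset.forall_mem_insert, LinearMap.mem_ker,
      LinearMap.proj_apply]
    tauto
  have h := finrank_inf_ker (L ⊓ coordSubspace I) i₀
  rw [e, Finset.card_insert_of_notMem hI0, pow_succ]
  simp only [hI0, Finset.mem_insert_self, not_true_eq_false, not_false_eq_true, false_and, true_and,
    if_false, ← h]
  ring

/-- The Euler characteristic of the complement of the coordinate hyperplanes in a
projective subspace. -/
theorem eulerChar_projComplement (hr : 0 < r) (L : Submodule ℂ (Fin r → ℂ)) :
    CurveGerm.HasFiniteHomology (projComplement L) ∧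
      CurveGerm.eulerChar (projComplement L) =
        ∑ I : Finset (Fin r), (-1 : ℤ) ^ I.card *
          (Module.finrank ℂ (L ⊓ coordSubspace I : Submodule ℂ (Fin r → ℂ)) : ℤ) := by
  classical
  set i₀ : Fin r := ⟨0, hr⟩
  refine hasFiniteHomology_and_eulerChar ?_
  rw [sum_finrank_coordSubspace L i₀]
  by_cases h : ∃ p ∈ L, p i₀ = 1
  · obtain ⟨p, hp, hp1⟩ := h
    have h1 := Arrangement.spaceEuler_complement (affineCoord L i₀) p
    have h2 := h1.of_homeomorph (projComplementHomeomorph L i₀ p hp hp1).onePointCongr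
    convert h2 using 1
    rw [add_comm]
    congr 1
    refine Finset.sum_congr rfl fun I _ => ?_
    congr 1
    refine if_congr ?_ rfl rfl
    constructor
    · rintro ⟨-, a, ha, ha1⟩
      rw [Submodule.mem_inf, mem_coordSubspace] at ha
      refine ⟨⟨a - p, mem_affineDirection.2 ⟨L.sub_mem ha.1 hp, by simp [ha1, hp1]⟩⟩, ?_⟩
      intro i hi
      change a i - p i + p i = 0
      simp [ha.2 i hi]
    · rintro ⟨v, hv⟩
      obtain ⟨hvL, hv0⟩ := mem_affineDirection.1 v.2
      have hi₀ : v.1 i₀ + p i₀ = 1 := by rw [hv0, hp1, zero_add]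
      refine ⟨fun h0 => ?_, v.1 + p, ?_, hi₀⟩
      · have : v.1 i₀ + p i₀ = 0 := hv i₀ h0
        rw [hi₀] at this
        exact one_ne_zero this
      · rw [Submodule.mem_inf, mem_coordSubspace]
        exact ⟨L.add_mem hvL hp, hv⟩
  · have : IsEmpty (projComplement L) := by
      refine ⟨?_⟩
      rintro ⟨_, a, ha, ⟨haL, ha0⟩, rfl⟩
      exact h ⟨(a i₀)⁻¹ • a, L.smul_mem _ haL, by simp [ha0]⟩
    have : Subsingleton (OnePoint (projComplement L)) := inferInstanceAs (Subsingleton (Option _))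
    have : Nonempty (OnePoint (projComplement L)) := ⟨OnePoint.infty⟩
    have h0 := spaceEuler_of_contractible (OnePoint (projComplement L))
    convert h0 using 1
    rw [Finset.sum_eq_zero, zero_add]
    intro I _
    rw [if_neg, mul_zero]
    rintro ⟨-, a, ha, ha1⟩
    exact h ⟨a, ha.1, ha1⟩

end EulerCalculus

namespace AnalyticOrder

/-! ### Analytic functions of one variable with a common covering transformation -/

lemma exists_root {h : ℂ → ℂ} (hh : AnalyticAt ℂ h 0) (h0 : h 0 ≠ 0) {d : ℕ} (hd : d ≠ 0) :
    ∃ k : ℂ → ℂ, AnalyticAt ℂ k 0 ∧ k 0 ≠ 0 ∧ ∀ᶠ z in 𝓝 0, k z ^ d = h z := by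
  obtain ⟨c, hc⟩ := IsAlgClosed.exists_pow_nat_eq (h 0) (Nat.pos_of_ne_zero hd)
  have hc0 : c ≠ 0 := by
    rintro rfl
    rw [zero_pow hd] at hc
    exact h0 hc.symm
  refine ⟨fun z => c * Complex.exp (Complex.log (h z / h 0) / d), ?_, ?_, ?_⟩
  · refine analyticAt_const.mul (AnalyticAt.cexp ?_)
    refine (AnalyticAt.clog (hh.div analyticAt_const h0) ?_).div analyticAt_const
      (Nat.cast_ne_zero.2 hd)
    rw [Pi.div_apply, div_self h0]
    exact Complex.one_mem_slitPlane
  · exact mul_ne_zero hc0 (Complex.exp_ne_zero _)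
  · filter_upwards [hh.continuousAt.eventually_ne h0] with z hz
    rw [mul_pow, ← Complex.exp_nat_mul, mul_div_cancel₀ _ (Nat.cast_ne_zero.2 hd),
      Complex.exp_log (div_ne_zero hz h0), hc, mul_div_cancel₀ _ h0]

lemma exists_deck {u : ℂ → ℂ} (hu : AnalyticAt ℂ u 0) {d : ℕ} (hd : 2 ≤ d)
    (hud : analyticOrderAt u 0 = d) :
    ∃ w : ℂ → ℂ, AnalyticAt ℂ w 0 ∧ w 0 = 0 ∧ (∀ᶠ z in 𝓝 0, u (w z) = u z) ∧
      ∀ᶠ z in 𝓝[≠] 0, w z ≠ z := by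
  obtain ⟨h, hh, h0, hu'⟩ := hu.analyticOrderAt_eq_natCast.1 hud
  obtain ⟨k, hk, hk0, hkh⟩ := exists_root hh h0 (by lia : d ≠ 0)
  set s : ℂ → ℂ := fun z => z * k z with hs
  have hsa : AnalyticAt ℂ s 0 := analyticAt_id.mul hk
  have hs0 : s 0 = 0 := zero_mul _
  have hsd : deriv s 0 ≠ 0 := by
    have : HasDerivAt s (1 * k 0 + 0 * deriv k 0) 0 :=
      (hasDerivAt_id' (0 : ℂ)).mul hk.differentiableAt.hasDerivAt
    rw [this.deriv]
    simpa using hk0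
  have husd : ∀ᶠ z in 𝓝 0, u z = s z ^ d := by
    filter_upwards [hu', hkh] with z h1 h2
    rw [h1, hs, mul_pow, h2, sub_zero, smul_eq_mul]
  set ρ : ℂ → ℂ := hsa.hasStrictDerivAt.localInverse _ _ _ hsd
  have hρ : AnalyticAt ℂ ρ 0 := by
    have := hsa.analyticAt_localInverse hsd
    rwa [hs0] at this
  have hρ0 : ρ 0 = 0 := by
    have : ρ (s 0) = 0 := HasStrictFDerivAt.localInverse_apply_image ..
    rwa [hs0] at this
  have hright : ∀ᶠ y in 𝓝 0, s (ρ y) = y := by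
    have := HasStrictDerivAt.eventually_right_inverse hsa.hasStrictDerivAt hsd
    rwa [hs0] at this
  set ζ : ℂ := Complex.exp (2 * Real.pi * Complex.I / d)
  have hζ : IsPrimitiveRoot ζ d := Complex.isPrimitiveRoot_exp d (by lia)
  have hζs : AnalyticAt ℂ (fun z => ζ * s z) 0 := analyticAt_const.mul hsa
  have hζs0 : ζ * s 0 = 0 := by rw [hs0, mul_zero]
  have hζt : Tendsto (fun z => ζ * s z) (𝓝 0) (𝓝 0) := by
    have := hζs.continuousAt.tendsto
    rwa [hζs0] at this
  have hw : AnalyticAt ℂ (fun z => ρ (ζ * s z)) 0 :=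
    AnalyticAt.fun_comp (g := ρ) (by rwa [hζs0]) hζs
  have hw0 : ρ (ζ * s 0) = 0 := by rw [hζs0, hρ0]
  have hwt : Tendsto (fun z => ρ (ζ * s z)) (𝓝 0) (𝓝 0) := by
    have := hw.continuousAt.tendsto
    rwa [hw0] at this
  refine ⟨fun z => ρ (ζ * s z), hw, hw0, ?_, ?_⟩
  · filter_upwards [husd, hwt.eventually husd, hζt.eventually hright] with z h1 h2 h3
    rw [h2, h3, h1, mul_pow, hζ.pow_eq_one, one_mul]
  · have hk' := (hk.continuousAt.eventually_ne hk0).filter_mono (nhdsWithin_le_nhds (s := {0}ᶜ))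
    have hr' := (hζt.eventually hright).filter_mono (nhdsWithin_le_nhds (s := {0}ᶜ))
    filter_upwards [hk', hr', self_mem_nhdsWithin] with z h1 h2 h3 h4
    rw [h4] at h2
    have hsz : s z ≠ 0 := mul_ne_zero h3 h1
    exact hζ.ne_one (by lia) (mul_right_cancel₀ hsz (h2.symm.trans (one_mul _).symm))

lemma exists_sub_smul_order {f u : ℂ → ℂ} (hf : AnalyticAt ℂ f 0) (hu : AnalyticAt ℂ u 0) {m : ℕ}
    (hfm : m ≤ analyticOrderAt f 0) (hum : analyticOrderAt u 0 = m) :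
    ∃ c : ℂ, ((m + 1 : ℕ) : ℕ∞) ≤ analyticOrderAt (f - c • u) 0 := by
  rw [natCast_le_analyticOrderAt_iff_iteratedDeriv_eq_zero hf] at hfm
  rw [analyticOrderAt_eq_nat_iff_iteratedDeriv_eq_zero hu] at hum
  refine ⟨iteratedDeriv m f 0 / iteratedDeriv m u 0, ?_⟩
  rw [natCast_le_analyticOrderAt_iff_iteratedDeriv_eq_zero (hf.sub hu.const_smul)]
  intro i hi
  rw [iteratedDeriv_sub hf.contDiffAt hu.const_smul.contDiffAt,
    iteratedDeriv_const_smul hu.contDiffAt]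
  rcases (Nat.lt_succ_iff.1 hi).lt_or_eq with h | rfl
  · rw [hfm i h, hum.1 i h, smul_zero, sub_zero]
  · rw [smul_eq_mul, div_mul_cancel₀ _ hum.2, sub_self]

lemma le_order_comp {f w : ℂ → ℂ} (hf : AnalyticAt ℂ f 0) (hw : AnalyticAt ℂ w 0) (hw0 : w 0 = 0) :
    analyticOrderAt f 0 ≤ analyticOrderAt (f ∘ w) 0 := by
  have hf' : AnalyticAt ℂ f (w 0) := by rwa [hw0]
  rw [hf'.analyticOrderAt_comp hw, hw0]
  refine le_mul_of_one_le_right (zero_le) ?_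
  rw [Order.one_le_iff_ne_zero, AnalyticAt.analyticOrderAt_ne_zero]
  · simp [hw0]
  · exact hw.sub analyticAt_const

/-- If all orders of elements of an algebra of analytic functions are divisible by a number which
is the difference of two orders, then all elements are invariant under a common transformation. -/
theorem exists_invariance (R : Subalgebra ℂ (ℂ → ℂ)) (hR : ∀ F ∈ R, AnalyticAt ℂ F 0)
    {d k : ℕ} (hd : 2 ≤ d) (hdvd : ∀ F ∈ R, ∀ m : ℕ, analyticOrderAt F 0 = m → d ∣ m)
    {F₀ F₁ : ℂ → ℂ} (hF₀ : F₀ ∈ R) (hF₁ : F₁ ∈ R) (ho₀ : analyticOrderAt F₀ 0 = (d * k : ℕ))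
    (ho₁ : analyticOrderAt F₁ 0 = (d * (k + 1) : ℕ)) :
    ∃ w : ℂ → ℂ, AnalyticAt ℂ w 0 ∧ w 0 = 0 ∧ (∀ᶠ z in 𝓝[≠] 0, w z ≠ z) ∧
      ∀ g ∈ R, ∀ᶠ z in 𝓝 0, g (w z) = g z := by
  obtain ⟨u, hu, huF⟩ : ∃ u : ℂ → ℂ, AnalyticAt ℂ u 0 ∧ u * F₀ =ᶠ[𝓝 0] F₁ := by
    obtain ⟨h₀, hh₀, hn₀, he₀⟩ := (hR _ hF₀).analyticOrderAt_eq_natCast.1 ho₀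
    obtain ⟨h₁, hh₁, hn₁, he₁⟩ := (hR _ hF₁).analyticOrderAt_eq_natCast.1 ho₁
    refine ⟨fun z => z ^ d * (h₁ z / h₀ z), (analyticAt_id.pow d).mul (hh₁.div hh₀ hn₀), ?_⟩
    filter_upwards [he₀, he₁, hh₀.continuousAt.eventually_ne hn₀] with z h1 h2 h3
    rw [Pi.mul_apply, h1, h2, sub_zero, smul_eq_mul, smul_eq_mul]
    field_simp
    ring
  have hud : analyticOrderAt u 0 = d := by
    have h := analyticOrderAt_congr huF
    rw [analyticOrderAt_mul hu (hR _ hF₀), ho₀, ho₁] at h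
    rw [Nat.mul_succ, add_comm, Nat.cast_add] at h
    exact ENat.add_right_injective_of_ne_top (ENat.natCast_ne_top _) h
  obtain ⟨w, hw, hw0, huw, hne⟩ := exists_deck hu hd hud
  refine ⟨w, hw, hw0, hne, fun g hg => ?_⟩
  have key : ∀ M : ℕ, ∃ p : ℂ → ℂ, AnalyticAt ℂ p 0 ∧ (∀ᶠ z in 𝓝 0, p (w z) = p z) ∧
      (∃ G ∈ R, p * F₀ ^ M =ᶠ[𝓝 0] G) ∧ ((d * M : ℕ) : ℕ∞) ≤ analyticOrderAt (g - p) 0 := by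
    intro M
    induction M with
    | zero => exact ⟨0, analyticAt_const, by simp, ⟨0, R.zero_mem, by simp⟩, by simp⟩
    | succ M ih =>
      obtain ⟨p, hp, hpw, ⟨G, hG, hpG⟩, ho⟩ := ih
      have huM : analyticOrderAt (u ^ M) 0 = (d * M : ℕ) := by
        rw [analyticOrderAt_pow hu, hud, nsmul_eq_mul, mul_comm]
        push_cast
        rfl
      obtain ⟨c, hc⟩ := exists_sub_smul_order ((hR g hg).sub hp) (hu.pow M) ho huM
      have hG' : G * F₀ + c • (F₁ ^ M * F₀) ∈ R :=
        R.add_mem (R.mul_mem hG hF₀) (R.smul_mem (R.mul_mem (R.pow_mem hF₁ _) hF₀) c)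
      have hpG' : (p + c • u ^ M) * F₀ ^ (M + 1) =ᶠ[𝓝 0] G * F₀ + c • (F₁ ^ M * F₀) := by
        filter_upwards [hpG, huF] with z h1 h2
        simp only [Pi.mul_apply, Pi.add_apply, Pi.smul_apply, Pi.pow_apply, smul_eq_mul] at h1 h2 ⊢
        rw [← h1, ← h2]
        ring
      have hp' : AnalyticAt ℂ (p + c • u ^ M) 0 := hp.add (hu.pow M).const_smul
      refine ⟨p + c • u ^ M, hp', ?_, ⟨_, hG', hpG'⟩, ?_⟩
      · filter_upwards [hpw, huw] with z h1 h2
        simp [h1, h2]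
      · rw [← sub_sub]
        have hq : AnalyticAt ℂ (g - p - c • u ^ M) 0 := ((hR g hg).sub hp).sub (hu.pow M).const_smul
        rcases eq_or_ne (analyticOrderAt (g - p - c • u ^ M) 0) ⊤ with htop | htop
        · rw [htop]
          exact le_top
        obtain ⟨a, ha⟩ := ENat.ne_top_iff_exists.1 htop
        rw [← ha] at hc ⊢
        have hmem : g * F₀ ^ (M + 1) - (G * F₀ + c • (F₁ ^ M * F₀)) ∈ R :=
          R.sub_mem (R.mul_mem hg (R.pow_mem hF₀ _)) hG'
        have hcongr : (g - p - c • u ^ M) * F₀ ^ (M + 1) =ᶠ[𝓝 0]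
            g * F₀ ^ (M + 1) - (G * F₀ + c • (F₁ ^ M * F₀)) := by
          filter_upwards [hpG'] with z h1
          rw [Pi.sub_apply (g * _), ← h1]
          simp only [Pi.mul_apply, Pi.add_apply, Pi.sub_apply]
          ring
        have hdv := hdvd _ hmem (a + (M + 1) * (d * k)) (by
          rw [← analyticOrderAt_congr hcongr, analyticOrderAt_mul hq ((hR _ hF₀).pow _), ← ha,
            analyticOrderAt_pow (hR _ hF₀), ho₀, nsmul_eq_mul]
          push_cast
          rfl)
        have hda : d ∣ a := by
          rwa [Nat.dvd_add_left (Dvd.intro _ (by ring : d * ((M + 1) * k) = _))] at hdv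
        obtain ⟨b, rfl⟩ := hda
        have hc' : d * M + 1 ≤ d * b := by exact_mod_cast hc
        have : M < b := Nat.lt_of_mul_lt_mul_left (by lia : d * M < d * b)
        exact_mod_cast Nat.mul_le_mul_left d this
  have hgw : AnalyticAt ℂ g (w 0) := by
    rw [hw0]
    exact hR g hg
  have htop : analyticOrderAt (g ∘ w - g) 0 = ⊤ := by
    rw [ENat.eq_top_iff_forall_ge]
    intro M
    obtain ⟨p, hp, hpw, -, ho⟩ := key M
    have hcongr : g ∘ w - g =ᶠ[𝓝 0] (g - p) ∘ w - (g - p) := by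
      filter_upwards [hpw] with z h
      simp [h]
    rw [analyticOrderAt_congr hcongr]
    have hM : (M : ℕ∞) ≤ analyticOrderAt (g - p) 0 := by
      refine le_trans ?_ ho
      exact_mod_cast Nat.le_mul_of_pos_left M (by lia)
    exact le_trans (le_min (hM.trans (le_order_comp ((hR g hg).sub hp) hw hw0)) hM)
      le_analyticOrderAt_sub
  filter_upwards [analyticOrderAt_eq_top.1 htop] with z hz
  exact sub_eq_zero.1 hz

end AnalyticOrder

namespace AnalyticOrder

/-! ### Orders of functions on an irreducible curve -/

variable {n : ℕ}

lemma analyticAt_comp {φ : ℂ → Fin n → ℂ} (hφ : AnalyticAt ℂ φ 0) (hφ0 : φ 0 = 0)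
    {f : (Fin n → ℂ) → ℂ} (hf : AnalyticAt ℂ f 0) : AnalyticAt ℂ (f ∘ φ) 0 :=
  AnalyticAt.comp (by rwa [hφ0]) hφ

/-- The functions on a parametrized curve, as functions of the parameter. -/
def pullbackAlgebra (φ : ℂ → Fin n → ℂ) : Subalgebra ℂ (ℂ → ℂ) where
  carrier := {F | ∃ f : (Fin n → ℂ) → ℂ, AnalyticAt ℂ f 0 ∧ f ∘ φ = F}
  mul_mem' := by
    rintro _ _ ⟨f, hf, rfl⟩ ⟨g, hg, rfl⟩
    exact ⟨f * g, hf.mul hg, rfl⟩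
  add_mem' := by
    rintro _ _ ⟨f, hf, rfl⟩ ⟨g, hg, rfl⟩
    exact ⟨f + g, hf.add hg, rfl⟩
  algebraMap_mem' c := ⟨fun _ => c, analyticAt_const, rfl⟩

/-- The semigroup of orders of analytic functions. -/
def orderSemigroup (R : Subalgebra ℂ (ℂ → ℂ)) (hR : ∀ F ∈ R, AnalyticAt ℂ F 0) :
    AddSubmonoid ℕ where
  carrier := {k | ∃ F ∈ R, analyticOrderAt F 0 = k}
  zero_mem' := ⟨1, R.one_mem, by
    rw [Nat.cast_zero, (hR 1 R.one_mem).analyticOrderAt_eq_zero]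
    exact one_ne_zero⟩
  add_mem' := by
    rintro k l ⟨F, hF, hk⟩ ⟨G, hG, hl⟩
    refine ⟨F * G, R.mul_mem hF hG, ?_⟩
    rw [analyticOrderAt_mul (hR F hF) (hR G hG), hk, hl, Nat.cast_add]

/-- All large numbers are orders of functions on a curve with an injective parametrization. -/
theorem exists_order_eq_of_large {φ : ℂ → Fin n → ℂ} (hφ : AnalyticAt ℂ φ 0) (hφ0 : φ 0 = 0)
    {D : Set ℂ} (hD : D ∈ 𝓝 0) (hinj : Set.InjOn φ D) :
    ∃ N : ℕ, ∀ k ≥ N, ∃ f : (Fin n → ℂ) → ℂ, AnalyticAt ℂ f 0 ∧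
      analyticOrderAt (f ∘ φ) 0 = k := by
  have hR : ∀ F ∈ pullbackAlgebra φ, AnalyticAt ℂ F 0 := by
    rintro _ ⟨f, hf, rfl⟩
    exact analyticAt_comp hφ hφ0 hf
  have hcoord : ∀ j, (fun z => φ z j) ∈ pullbackAlgebra φ := fun j =>
    ⟨fun x => x j, (ContinuousLinearMap.proj (R := ℂ) (φ := fun _ : Fin n => ℂ) j).analyticAt 0, rfl⟩
  have hcontra : ¬ ∃ w : ℂ → ℂ, Tendsto w (𝓝 0) (𝓝 0) ∧ (∀ᶠ z in 𝓝[≠] 0, w z ≠ z) ∧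
      ∀ᶠ z in 𝓝 0, φ (w z) = φ z := by
    rintro ⟨w, hw, hne, heq⟩
    have h1 : ∀ᶠ z in 𝓝[≠] (0 : ℂ), False := by
      filter_upwards [hne, nhdsWithin_le_nhds heq, nhdsWithin_le_nhds hD,
        nhdsWithin_le_nhds (hw.eventually hD)] with z h1 h2 h3 h4
      exact h1 (hinj h4 h3 h2)
    exact h1.exists.elim fun _ h => h
  set S := orderSemigroup (pullbackAlgebra φ) hR with hS
  obtain ⟨N, hN⟩ := Nat.exists_mem_closure_of_ge (S : Set ℕ)
  rw [AddSubmonoid.closure_eq] at hN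
  set d := Nat.setGcd (S : Set ℕ) with hd
  have hd0 : d ≠ 0 := by
    intro h0
    rw [hd, Nat.setGcd_eq_zero_iff] at h0
    refine hcontra ⟨0, tendsto_const_nhds, ?_, ?_⟩
    · filter_upwards [self_mem_nhdsWithin] with z hz using fun h => hz h.symm
    · have : ∀ j, ∀ᶠ z in 𝓝 0, φ z j = 0 := by
        intro j
        rw [← analyticOrderAt_eq_top]
        by_contra htop
        obtain ⟨a, ha⟩ := ENat.ne_top_iff_exists.1 htop
        have ha0 : a = 0 := h0 (⟨_, hcoord j, ha.symm⟩ : a ∈ S)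
        rw [ha0, Nat.cast_zero, eq_comm, (hR _ (hcoord j)).analyticOrderAt_eq_zero, hφ0] at ha
        exact ha rfl
      filter_upwards [eventually_all.2 this] with z hz
      rw [Pi.zero_apply, hφ0]
      exact (funext hz).symm
  rcases (by lia : d = 1 ∨ 2 ≤ d) with h1 | h2
  · refine ⟨N, fun k hk => ?_⟩
    obtain ⟨_, ⟨f, hf, rfl⟩, hk⟩ := hN k hk (h1 ▸ one_dvd k)
    exact ⟨f, hf, hk⟩
  · exfalso
    obtain ⟨F₀, hF₀, ho₀⟩ := hN (d * N) (Nat.le_mul_of_pos_left N (by lia)) (dvd_mul_right _ _)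
    obtain ⟨F₁, hF₁, ho₁⟩ := hN (d * (N + 1))
      ((Nat.le_succ N).trans (Nat.le_mul_of_pos_left _ (by lia))) (dvd_mul_right _ _)
    obtain ⟨w, hw, hw0, hne, hinv⟩ := exists_invariance _ hR h2
      (fun F hF m hm => Nat.setGcd_dvd_of_mem (s := (S : Set ℕ)) ⟨F, hF, hm⟩) hF₀ hF₁ ho₀ ho₁
    have hwt := hw.continuousAt.tendsto
    rw [hw0] at hwt
    refine hcontra ⟨w, hwt, hne, ?_⟩
    filter_upwards [eventually_all.2 fun j => hinv _ (hcoord j)] with z hz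
    exact funext hz

end AnalyticOrder

namespace CurveSingularity

open CurveGerm AnalyticOrder

variable {n r : ℕ} (C : CurveSingularity n r)

lemma analyticAt_comp_param (i : Fin r) {f : (Fin n → ℂ) → ℂ} (hf : AnalyticAt ℂ f 0) :
    AnalyticAt ℂ (f ∘ C.param i) 0 :=
  analyticAt_comp (C.isUniformization i).analyticAt (C.isUniformization i).map_zero hf

lemma eventually_param_mem (i : Fin r) : ∀ᶠ t in 𝓝 0, C.param i t ∈ C.branch i := by
  have : ∀ᶠ z in 𝓝[C.branch i] 0, z ∈ C.branch i := self_mem_nhdsWithin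
  rwa [← (C.isUniformization i).map_nhds] at this

lemma exists_vanishing_on_branch {i j : Fin r} (hij : i ≠ j) :
    ∃ f : (Fin n → ℂ) → ℂ, AnalyticAt ℂ f 0 ∧ analyticOrderAt (f ∘ C.param i) 0 ≠ ⊤ ∧
      ∀ᶠ t in 𝓝 0, f (C.param j t) = 0 := by
  obtain ⟨U, hU, h0, k, f, hf, hfU⟩ := (C.branch_irreducible j).1
  have hUi : ∀ l, ∀ᶠ t in 𝓝 0, C.param l t ∈ U := fun l =>
    (C.param_tendsto l).eventually (hU.mem_nhds h0)
  by_contra! h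
  refine C.not_le i j hij ?_
  have hzero : ∀ m, ∀ᶠ t in 𝓝 0, f m (C.param i t) = 0 := by
    intro m
    by_contra hm
    refine h (f m) (hf m 0 h0) (fun htop => hm (analyticOrderAt_eq_top.1 htop)) ?_
    filter_upwards [hUi j, C.eventually_param_mem j] with t h1 h2
    have : C.param j t ∈ C.branch j ∩ U := ⟨h2, h1⟩
    rw [hfU] at this
    exact not_not.2 (this.2 m)
  have : ∀ᶠ z in 𝓝[C.branch i] 0, z ∈ C.branch j := by
    rw [← (C.isUniformization i).map_nhds, eventually_map]
    filter_upwards [hUi i, eventually_all.2 hzero] with t h1 h2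
    have : C.param i t ∈ C.branch j ∩ U := by
      rw [hfU]
      exact ⟨h1, h2⟩
    exact this.1
  exact eventually_nhdsWithin_iff.1 this

lemma exists_separating (i : Fin r) :
    ∃ f : (Fin n → ℂ) → ℂ, AnalyticAt ℂ f 0 ∧ analyticOrderAt (f ∘ C.param i) 0 ≠ ⊤ ∧
      ∀ j, j ≠ i → ∀ᶠ t in 𝓝 0, f (C.param j t) = 0 := by
  have h : ∀ s : Finset (Fin r), i ∉ s → ∃ f : (Fin n → ℂ) → ℂ, AnalyticAt ℂ f 0 ∧
      analyticOrderAt (f ∘ C.param i) 0 ≠ ⊤ ∧ ∀ j ∈ s, ∀ᶠ t in 𝓝 0, f (C.param j t) = 0 := by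
    intro s
    induction s using Finset.induction_on with
    | empty =>
      refine fun _ => ⟨fun _ => 1, analyticAt_const, ?_, by simp⟩
      rw [ne_eq, analyticOrderAt_eq_top]
      intro h
      exact one_ne_zero h.self_of_nhds
    | insert j s hj ih =>
      intro hi
      rw [Finset.mem_insert, not_or] at hi
      obtain ⟨f, hf, hfi, hfs⟩ := ih hi.2
      obtain ⟨g, hg, hgi, hgj⟩ := C.exists_vanishing_on_branch hi.1
      refine ⟨f * g, hf.mul hg, ?_, ?_⟩
      · change analyticOrderAt ((f ∘ C.param i) * (g ∘ C.param i)) 0 ≠ ⊤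
        rw [analyticOrderAt_mul (C.analyticAt_comp_param i hf) (C.analyticAt_comp_param i hg)]
        exact WithTop.add_ne_top.2 ⟨hfi, hgi⟩
      · intro l hl
        rcases Finset.mem_insert.1 hl with rfl | hl
        · filter_upwards [hgj] with t ht
          rw [Pi.mul_apply, ht, mul_zero]
        · filter_upwards [hfs l hl] with t ht
          rw [Pi.mul_apply, ht, zero_mul]
  obtain ⟨f, hf, hfi, hfs⟩ := h (Finset.univ.erase i) (Finset.notMem_erase _ _)
  exact ⟨f, hf, hfi, fun j hj => hfs j (Finset.mem_erase.2 ⟨hj, Finset.mem_univ _⟩)⟩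

/-- The existence of a conductor. -/
theorem exists_conductor : ∃ N : ℕ, ∀ i, ∀ k ≥ N, ∃ f : (Fin n → ℂ) → ℂ, AnalyticAt ℂ f 0 ∧
    analyticOrderAt (f ∘ C.param i) 0 = k ∧ ∀ j, j ≠ i → ∀ᶠ t in 𝓝 0, f (C.param j t) = 0 := by
  have h : ∀ i, ∃ N : ℕ, ∀ k ≥ N, ∃ f : (Fin n → ℂ) → ℂ, AnalyticAt ℂ f 0 ∧
      analyticOrderAt (f ∘ C.param i) 0 = k ∧
      ∀ j, j ≠ i → ∀ᶠ t in 𝓝 0, f (C.param j t) = 0 := by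
    intro i
    obtain ⟨D, hD, hinj, -⟩ := (C.isUniformization i).iso_off_zero
    obtain ⟨N, hN⟩ := exists_order_eq_of_large (C.isUniformization i).analyticAt
      (C.isUniformization i).map_zero hD hinj
    obtain ⟨g, hg, hgi, hgj⟩ := C.exists_separating i
    obtain ⟨m, hm⟩ := ENat.ne_top_iff_exists.1 hgi
    refine ⟨N + m, fun k hk => ?_⟩
    obtain ⟨f, hf, hfk⟩ := hN (k - m) (by lia)
    refine ⟨f * g, hf.mul hg, ?_, fun j hj => ?_⟩
    · change analyticOrderAt ((f ∘ C.param i) * (g ∘ C.param i)) 0 = k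
      rw [analyticOrderAt_mul (C.analyticAt_comp_param i hf) (C.analyticAt_comp_param i hg), hfk,
        ← hm, ← Nat.cast_add, Nat.sub_add_cancel (by lia)]
    · filter_upwards [hgj j hj] with t ht
      rw [Pi.mul_apply, ht, mul_zero]
  choose N hN using h
  exact ⟨Finset.univ.sup N, fun i k hk => hN i k ((Finset.le_sup (Finset.mem_univ i)).trans hk)⟩

end CurveSingularity

namespace CurveGerm

/-! ### Taylor coefficients -/

/-- The Taylor coefficients of a germ of a function of one variable. -/
def germCoeff (k : ℕ) (G : Germ (𝓝 (0 : ℂ)) ℂ) : ℂ :=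
  G.liftOn (fun f => iteratedDeriv k f 0 / k.factorial) fun _ _ h => by
    simp only [h.iteratedDeriv_eq k]

lemma le_order_iff {f : ℂ → ℂ} (hf : AnalyticAt ℂ f 0) (m : ℕ) :
    m ≤ analyticOrderAt f 0 ↔ ∀ k < m, germCoeff k (Germ.ofFun f) = 0 := by
  rw [natCast_le_analyticOrderAt_iff_iteratedDeriv_eq_zero hf]
  refine forall₂_congr fun k _ => ?_
  change _ ↔ iteratedDeriv k f 0 / k.factorial = 0
  rw [div_eq_zero_iff, or_iff_left (Nat.cast_ne_zero.2 k.factorial_ne_zero)]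

lemma exists_eq_pow_mul {f : ℂ → ℂ} (hf : AnalyticAt ℂ f 0) {m : ℕ}
    (hm : m ≤ analyticOrderAt f 0) : ∃ h : ℂ → ℂ, AnalyticAt ℂ h 0 ∧
      h 0 = germCoeff m (Germ.ofFun f) ∧ ∀ᶠ z in 𝓝 0, f z = z ^ m * h z := by
  rw [natCast_le_analyticOrderAt_iff_iteratedDeriv_eq_zero hf] at hm
  obtain ⟨F, hF, hfF⟩ := hf.exists_eventuallyEq_sum_add_pow_mul (m + 1)
  refine ⟨fun z => iteratedDeriv m f 0 / m.factorial + z * F z,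
    analyticAt_const.add (analyticAt_id.mul hF), ?_, ?_⟩
  · simp only [zero_mul, add_zero]
    rfl
  · filter_upwards [hfF] with z hz
    rw [hz, Finset.sum_range_succ, Finset.sum_eq_zero fun i hi => by
      rw [hm i (Finset.mem_range.1 hi), smul_zero]]
    simp only [smul_eq_mul]
    ring

lemma hasLeadingTerm_iff {f : ℂ → ℂ} (hf : AnalyticAt ℂ f 0) {m : ℕ} {a : ℂ} :
    HasLeadingTerm (Germ.ofFun f) m a ↔
      a ≠ 0 ∧ m ≤ analyticOrderAt f 0 ∧ germCoeff m (Germ.ofFun f) = a := by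
  refine and_congr_right fun _ => ⟨?_, ?_⟩
  · rintro ⟨h, hh, h0, hfh⟩
    have hfh' : ∀ᶠ z in 𝓝 0, f z = z ^ m * h z := Germ.coe_eq.1 hfh
    have hm : m ≤ analyticOrderAt f 0 := by
      rw [natCast_le_analyticOrderAt hf]
      refine ⟨h, hh, ?_⟩
      filter_upwards [hfh'] with z hz
      rw [hz, sub_zero, smul_eq_mul]
    refine ⟨hm, ?_⟩
    obtain ⟨k, hk, hk0, hfk⟩ := exists_eq_pow_mul hf hm
    rw [← hk0, ← h0]
    have heq : k =ᶠ[𝓝[≠] 0] h := by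
      filter_upwards [nhdsWithin_le_nhds hfh', nhdsWithin_le_nhds hfk, self_mem_nhdsWithin]
        with z h1 h2 h3
      exact mul_left_cancel₀ (pow_ne_zero m h3) (h2.symm.trans h1)
    have hk' := hk.continuousAt.tendsto.mono_left (nhdsWithin_le_nhds (s := {0}ᶜ))
    have hh' := hh.continuousAt.tendsto.mono_left (nhdsWithin_le_nhds (s := {0}ᶜ))
    exact tendsto_nhds_unique hk' (hh'.congr' heq.symm)
  · rintro ⟨hm, rfl⟩
    obtain ⟨k, hk, hk0, hfk⟩ := exists_eq_pow_mul hf hm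
    exact ⟨k, hk, hk0, Germ.coe_eq.2 hfk⟩

end CurveGerm

namespace CurveOrders

/-! ### Dimensions of quotients -/

variable {M N N' : Type*} [AddCommGroup M] [Module ℂ M] [AddCommGroup N] [Module ℂ N]
  [AddCommGroup N'] [Module ℂ N']

/-- Linear maps with the same kernel have ranges of the same dimension. -/
def rangeEquivOfKerEq {f : M →ₗ[ℂ] N} {g : M →ₗ[ℂ] N'}
    (h : LinearMap.ker f = LinearMap.ker g) : LinearMap.range f ≃ₗ[ℂ] LinearMap.range g :=
  f.quotKerEquivRange.symm.trans ((Submodule.quotEquivOfEq _ _ h).trans g.quotKerEquivRange)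

lemma finrank_map_mkQ_add {S T : Submodule ℂ M} (h : S ≤ T) [Module.Finite ℂ (M ⧸ S)] :
    Module.finrank ℂ (T.map S.mkQ) + Module.finrank ℂ (M ⧸ T) = Module.finrank ℂ (M ⧸ S) := by
  rw [← (T.map S.mkQ).finrank_quotient_add_finrank, add_comm,
    (Submodule.quotientQuotientEquivQuotient S T h).finrank_eq]

lemma finrank_map_add {S T : Submodule ℂ M} (f : M →ₗ[ℂ] N) (h : S = T ⊓ LinearMap.ker f)
    [Module.Finite ℂ (M ⧸ S)] :
    Module.finrank ℂ (T.map f) + Module.finrank ℂ (M ⧸ T) = Module.finrank ℂ (M ⧸ S) := by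
  have hST : S ≤ T := h ▸ inf_le_left
  rw [← finrank_map_mkQ_add hST, Nat.add_right_cancel_iff]
  have hker : LinearMap.ker (f.domRestrict T) = LinearMap.ker (S.mkQ.domRestrict T) := by
    ext x
    simp [h]
  have e := (rangeEquivOfKerEq hker).finrank_eq
  rwa [LinearMap.range_domRestrict, LinearMap.range_domRestrict] at e

end CurveOrders

namespace CurveSingularity

open CurveGerm CurveOrders EulerCalculus

variable {n r : ℕ} (C : CurveSingularity n r)

/-! ### Coefficients along the branches -/

/-- The coefficients of a function along a branch. -/
def coeff (i : Fin r) (k : ℕ) : holoGerms n →ₗ[ℂ] ℂ where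
  toFun g := germCoeff k (C.pullback i g)
  map_add' := by
    rintro ⟨_, f, hf, rfl⟩ ⟨_, g, hg, rfl⟩
    have hf' := C.analyticAt_comp_param i hf
    have hg' := C.analyticAt_comp_param i hg
    change iteratedDeriv k (f ∘ C.param i + g ∘ C.param i) 0 / k.factorial =
      iteratedDeriv k (f ∘ C.param i) 0 / k.factorial +
        iteratedDeriv k (g ∘ C.param i) 0 / k.factorial
    rw [iteratedDeriv_add hf'.contDiffAt hg'.contDiffAt, add_div]
  map_smul' := by
    rintro c ⟨_, f, hf, rfl⟩
    have hf' := C.analyticAt_comp_param i hf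
    change iteratedDeriv k (c • (f ∘ C.param i)) 0 / k.factorial =
      c • (iteratedDeriv k (f ∘ C.param i) 0 / k.factorial)
    rw [iteratedDeriv_const_smul hf'.contDiffAt, smul_div_assoc]

lemma le_order_iff_coeff (i : Fin r) (g : holoGerms n) (m : ℕ) :
    m ≤ C.order i g ↔ ∀ k < m, C.coeff i k g = 0 := by
  obtain ⟨_, f, hf, rfl⟩ := g
  exact le_order_iff (C.analyticAt_comp_param i hf) m

lemma hasLeadingTerm_pullback_iff (i : Fin r) (g : holoGerms n) {m : ℕ} {a : ℂ} :
    HasLeadingTerm (C.pullback i g) m a ↔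
      a ≠ 0 ∧ (∀ k < m, C.coeff i k g = 0) ∧ C.coeff i m g = a := by
  rw [← le_order_iff_coeff]
  obtain ⟨_, f, hf, rfl⟩ := g
  exact hasLeadingTerm_iff (C.analyticAt_comp_param i hf)

/-- The ideals of the valuation filtration, as subspaces of the space of holomorphic germs. -/
def filtration (w : Fin r → ℕ) : Submodule ℂ (holoGerms n) :=
  ⨅ p : Σ i, Fin (w i), LinearMap.ker (C.coeff p.1 p.2)

lemma mem_filtration {w : Fin r → ℕ} {g : holoGerms n} :
    g ∈ C.filtration w ↔ ∀ i, ∀ k < w i, C.coeff i k g = 0 := by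
  simp only [filtration, Submodule.mem_iInf, LinearMap.mem_ker, Sigma.forall]
  exact forall_congr' fun i => ⟨fun h k hk => h ⟨k, hk⟩, fun h k => h k k.2⟩

lemma filtration_antitone {w w' : Fin r → ℕ} (h : w ≤ w') : C.filtration w' ≤ C.filtration w :=
  fun _ hg => C.mem_filtration.2 fun i k hk => C.mem_filtration.1 hg i k (hk.trans_le (h i))

instance finite_quotient_filtration (w : Fin r → ℕ) :
    Module.Finite ℂ (holoGerms n ⧸ C.filtration w) := by
  set f : holoGerms n →ₗ[ℂ] ((Σ i, Fin (w i)) → ℂ) := LinearMap.pi fun p => C.coeff p.1 p.2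
  have hf : C.filtration w = LinearMap.ker f := by
    rw [LinearMap.ker_pi]
    rfl
  rw [hf]
  exact Module.Finite.equiv f.quotKerEquivRange.symm

/-- The codimension of an ideal of the valuation filtration. -/
def codim (w : Fin r → ℕ) : ℕ := Module.finrank ℂ (holoGerms n ⧸ C.filtration w)

lemma J_eq_map (v : Fin r → ℤ) :
    C.J v = (C.filtration fun i => (v i).toNat).map (holoGerms n).subtype := by
  ext g
  constructor
  · rintro ⟨hg, h⟩
    exact ⟨⟨g, hg⟩, C.mem_filtration.2 fun i => (C.le_order_iff_coeff i ⟨g, hg⟩ _).1 (h i), rfl⟩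
  · rintro ⟨g, hg, rfl⟩
    exact ⟨g.2, fun i => (C.le_order_iff_coeff i g _).2 (C.mem_filtration.1 hg i)⟩

lemma mem_J_iff {v : Fin r → ℤ} (g : holoGerms n) :
    (g : Germ (𝓝 (0 : Fin n → ℂ)) ℂ) ∈ C.J v ↔ g ∈ C.filtration fun i => (v i).toNat := by
  rw [J_eq_map]
  exact (holoGerms n).subtype_injective.mem_set_image

/-- The graded pieces, as subspaces of a finite dimensional quotient. -/
def gradedPieceEquiv (v : Fin r → ℤ) : C.gradedPiece v ≃ₗ[ℂ]
    (C.filtration fun i => (v i).toNat).map (C.filtration fun i => ((v + 1) i).toNat).mkQ := by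
  set i₁ : C.J v →ₗ[ℂ] holoGerms n := Submodule.inclusion (fun _ hg => hg.1)
  set f : C.J v →ₗ[ℂ] holoGerms n ⧸ C.filtration fun i => ((v + 1) i).toNat :=
    (C.filtration fun i => ((v + 1) i).toNat).mkQ ∘ₗ i₁ with hf
  have hker : (C.J (v + 1)).submoduleOf (C.J v) = LinearMap.ker f := by
    ext g
    rw [hf, LinearMap.mem_ker, LinearMap.comp_apply, Submodule.mkQ_apply,
      Submodule.Quotient.mk_eq_zero, ← mem_J_iff]
    rfl
  have hrange : LinearMap.range f = (C.filtration fun i => (v i).toNat).map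
      (C.filtration fun i => ((v + 1) i).toNat).mkQ := by
    rw [hf, LinearMap.range_comp]
    congr 1
    ext g
    constructor
    · rintro ⟨h, rfl⟩
      exact (C.mem_J_iff _).1 h.2
    · intro hg
      exact ⟨⟨g, (C.mem_J_iff g).2 hg⟩, rfl⟩
  exact (Submodule.quotEquivOfEq _ _ hker).trans
    (f.quotKerEquivRange.trans (LinearEquiv.ofEq _ _ hrange))

lemma finite_gradedPiece (v : Fin r → ℤ) : Module.Finite ℂ (C.gradedPiece v) :=
  Module.Finite.equiv (C.gradedPieceEquiv v).symm

lemma dimSeries_apply (v : Fin r → ℤ) : C.dimSeries v =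
    C.codim (fun i => ((v + 1) i).toNat) - C.codim (fun i => (v i).toNat) := by
  have hle : C.filtration (fun i => ((v + 1) i).toNat) ≤ C.filtration fun i => (v i).toNat :=
    C.filtration_antitone fun i => Int.toNat_le_toNat (by simp)
  have h := finrank_map_mkQ_add hle
  rw [← (C.gradedPieceEquiv v).finrank_eq] at h
  rw [dimSeries, codim, codim, ← h]
  push_cast
  ring

/-! ### Leading coefficients -/

/-- The coefficients of given degrees along all branches. -/
def leading (w : Fin r → ℕ) : holoGerms n →ₗ[ℂ] (Fin r → ℂ) :=
  LinearMap.pi fun i => C.coeff i (w i)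

/-- Raise the coordinates in a set by one. -/
def raise (w : Fin r → ℕ) (I : Finset (Fin r)) : Fin r → ℕ := fun i => if i ∈ I then w i + 1 else w i

lemma mem_filtration_raise {w : Fin r → ℕ} {I : Finset (Fin r)} {g : holoGerms n} :
    g ∈ C.filtration (raise w I) ↔ g ∈ C.filtration w ∧ ∀ i ∈ I, C.coeff i (w i) g = 0 := by
  simp only [mem_filtration, raise]
  constructor
  · intro h
    refine ⟨fun i k hk => h i k ?_, fun i hi => h i _ ?_⟩
    · split_ifs <;> lia
    · rw [if_pos hi]
      lia
  · rintro ⟨h1, h2⟩ i k hk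
    split_ifs at hk with hi
    · rcases (Nat.lt_succ_iff.1 hk).lt_or_eq with h | rfl
      · exact h1 i k h
      · exact h2 i hi
    · exact h1 i k hk

lemma map_leading_inf (w : Fin r → ℕ) (I : Finset (Fin r)) :
    (C.filtration w).map (C.leading w) ⊓ coordSubspace I =
      (C.filtration (raise w I)).map (C.leading w) := by
  ext a
  constructor
  · rintro ⟨⟨g, hg, rfl⟩, ha⟩
    exact ⟨g, C.mem_filtration_raise.2 ⟨hg, mem_coordSubspace.1 ha⟩, rfl⟩
  · rintro ⟨g, hg, rfl⟩
    have := C.mem_filtration_raise.1 hg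
    exact ⟨⟨g, this.1, rfl⟩, mem_coordSubspace.2 this.2⟩

lemma finrank_map_leading_inf (w : Fin r → ℕ) (I : Finset (Fin r)) :
    (Module.finrank ℂ ((C.filtration w).map (C.leading w) ⊓ coordSubspace I :
      Submodule ℂ (Fin r → ℂ)) : ℤ) =
      C.codim (raise w Finset.univ) - C.codim (raise w I) := by
  have h : C.filtration (raise w Finset.univ) =
      C.filtration (raise w I) ⊓ LinearMap.ker (C.leading w) := by
    ext g
    rw [Submodule.mem_inf, mem_filtration_raise, mem_filtration_raise, LinearMap.mem_ker,
      funext_iff]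
    change _ ↔ _ ∧ ∀ i, C.coeff i (w i) g = 0
    simp only [Finset.mem_univ, true_implies]
    tauto
  rw [map_leading_inf, codim, codim, ← finrank_map_add _ h]
  push_cast
  ring

lemma projFibre_eq (w : Fin r → ℕ) :
    C.projFibre w = projComplement ((C.filtration w).map (C.leading w)) := by
  have h : ∀ a, a ∈ C.fibre w ↔ a ∈ (C.filtration w).map (C.leading w) ∧ ∀ i, a i ≠ 0 := by
    intro a
    constructor
    · rintro ⟨g, hg, h⟩
      have h' := fun i => (C.hasLeadingTerm_pullback_iff i ⟨g, hg⟩).1 (h i)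
      exact ⟨⟨⟨g, hg⟩, C.mem_filtration.2 fun i => (h' i).2.1, funext fun i => (h' i).2.2⟩,
        fun i => (h' i).1⟩
    · rintro ⟨⟨g, hg, rfl⟩, ha⟩
      exact ⟨g, g.2, fun i => (C.hasLeadingTerm_pullback_iff i g).2
        ⟨ha i, C.mem_filtration.1 hg i, rfl⟩⟩
  ext q
  simp only [projFibre, projComplement, Set.mem_ofPred_eq, h]

/-- The Euler characteristic of a projectivized fibre in terms of codimensions of ideals. -/
theorem eulerChar_projFibre (hr : 0 < r) (w : Fin r → ℕ) :
    HasFiniteHomology (C.projFibre w) ∧ eulerChar (C.projFibre w) =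
      -∑ I : Finset (Fin r), (-1 : ℤ) ^ I.card * C.codim (raise w I) := by
  have h := eulerChar_projComplement hr ((C.filtration w).map (C.leading w))
  rw [← projFibre_eq] at h
  refine ⟨h.1, h.2.trans ?_⟩
  have hne : (Finset.univ : Finset (Fin r)) ≠ ∅ := Finset.ne_empty_of_mem (Finset.mem_univ ⟨0, hr⟩)
  simp only [finrank_map_leading_inf, mul_sub, Finset.sum_sub_distrib, ← Finset.sum_mul]
  rw [← Finset.powerset_univ, Finset.sum_powerset_neg_one_pow_card, if_neg hne, zero_mul, zero_sub]

/-- Above the conductor the codimension grows by one in each step. -/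
theorem exists_codim_raise : ∃ N : ℕ, ∀ (w : Fin r → ℕ) (i : Fin r), N ≤ w i →
    C.codim (raise w {i}) = C.codim w + 1 := by
  obtain ⟨N, hN⟩ := C.exists_conductor
  refine ⟨N, fun w i hw => ?_⟩
  obtain ⟨f, hf, hfi, hfj⟩ := hN i (w i) hw
  set g : holoGerms n := ⟨Germ.ofFun f, f, hf, rfl⟩
  have hgi : C.order i g = w i := hfi
  have hgj : ∀ j, j ≠ i → C.order j g = ⊤ := fun j hj => analyticOrderAt_eq_top.2 (hfj j hj)
  have hg : g ∈ C.filtration w := by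
    rw [mem_filtration]
    intro j
    rw [← le_order_iff_coeff]
    rcases eq_or_ne j i with rfl | hj
    · exact hgi.ge
    · rw [hgj j hj]
      exact le_top
  have hg0 : C.coeff i (w i) g ≠ 0 := by
    intro h0
    have h1 := C.mem_filtration_raise.2 ⟨hg, fun j hj => by
      rw [Finset.mem_singleton] at hj
      rw [hj, h0]⟩
    have h2 := (C.le_order_iff_coeff i g _).2 (C.mem_filtration.1 h1 i)
    rw [hgi, raise, if_pos (Finset.mem_singleton_self i)] at h2
    have : w i + 1 ≤ w i := by exact_mod_cast h2
    lia
  have hker : C.filtration (raise w {i}) = C.filtration w ⊓ LinearMap.ker (C.coeff i (w i)) := by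
    ext x
    rw [Submodule.mem_inf, mem_filtration_raise, LinearMap.mem_ker]
    simp
  have htop : (C.filtration w).map (C.coeff i (w i)) = ⊤ := by
    rw [eq_top_iff]
    rintro c -
    refine ⟨(c / C.coeff i (w i) g) • g, (C.filtration w).smul_mem _ hg, ?_⟩
    rw [map_smul, smul_eq_mul, div_mul_cancel₀ _ hg0]
  have h := finrank_map_add _ hker
  rw [htop, finrank_top, Module.finrank_self, add_comm] at h
  exact h.symm

end CurveSingularity

namespace CurveGerm

/-! ### Polynomials and Laurent series -/

variable {r : ℕ}

lemma polyMul_eq_sum {p : MvPolynomial (Fin r) ℤ} {s : Finset (Fin r →₀ ℕ)} (hs : p.support ⊆ s)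
    (L : LaurentSeries r) (v : Fin r → ℤ) :
    polyMul p L v = ∑ m ∈ s, p.coeff m * L (fun i => v i - (m i : ℤ)) := by
  refine Finset.sum_subset hs fun m _ hm => ?_
  rw [MvPolynomial.notMem_support_iff.1 hm, zero_mul]

lemma polyMul_add (p q : MvPolynomial (Fin r) ℤ) (L : LaurentSeries r) (v : Fin r → ℤ) :
    polyMul (p + q) L v = polyMul p L v + polyMul q L v := by
  classical
  rw [polyMul_eq_sum MvPolynomial.support_add, polyMul_eq_sum (p := p) Finset.subset_union_left,
    polyMul_eq_sum (p := q) Finset.subset_union_right, ← Finset.sum_add_distrib]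
  refine Finset.sum_congr rfl fun m _ => ?_
  rw [MvPolynomial.coeff_add, add_mul]

lemma polyMul_zero (L : LaurentSeries r) (v : Fin r → ℤ) : polyMul 0 L v = 0 := by
  simp [polyMul]

lemma polyMul_sum {κ : Type*} (s : Finset κ) (p : κ → MvPolynomial (Fin r) ℤ) (L : LaurentSeries r)
    (v : Fin r → ℤ) : polyMul (∑ k ∈ s, p k) L v = ∑ k ∈ s, polyMul (p k) L v := by
  classical
  induction s using Finset.induction_on with
  | empty => simp [polyMul_zero]
  | insert k s hk ih => rw [Finset.sum_insert hk, Finset.sum_insert hk, polyMul_add, ih]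

lemma polyMul_monomial (m : Fin r →₀ ℕ) (a : ℤ) (L : LaurentSeries r) (v : Fin r → ℤ) :
    polyMul (MvPolynomial.monomial m a) L v = a * L (fun i => v i - (m i : ℤ)) := by
  classical
  rw [polyMul_eq_sum MvPolynomial.support_monomial_subset, Finset.sum_singleton,
    MvPolynomial.coeff_monomial, if_pos rfl]

/-- The exponent of a square-free monomial. -/
def indicatorExponent (I : Finset (Fin r)) : Fin r →₀ ℕ := ∑ i ∈ I, Finsupp.single i 1

lemma indicatorExponent_apply (I : Finset (Fin r)) (i : Fin r) :
    indicatorExponent I i = if i ∈ I then 1 else 0 := by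
  classical
  simp [indicatorExponent, Finsupp.finsetSum_apply, Finsupp.single_apply]

lemma prod_X_eq_monomial (I : Finset (Fin r)) :
    ∏ i ∈ I, (MvPolynomial.X i : MvPolynomial (Fin r) ℤ) =
      MvPolynomial.monomial (indicatorExponent I) 1 := by
  rw [indicatorExponent, MvPolynomial.monomial_sum_one]
  rfl

lemma polyMul_prod_X_sub_one (L : LaurentSeries r) (v : Fin r → ℤ) :
    polyMul (∏ i, (MvPolynomial.X i - 1)) L v =
      ∑ K : Finset (Fin r), (-1) ^ K.card * L (fun i => v i - if i ∈ K then 0 else 1) := by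
  classical
  simp only [sub_eq_add_neg, Finset.prod_add]
  rw [polyMul_sum, Finset.powerset_univ]
  refine Fintype.sum_equiv (Function.Involutive.toPerm _ compl_involutive) _ _ fun I => ?_
  have h : (∏ i ∈ I, MvPolynomial.X i) * ∏ i ∈ Finset.univ \ I, (-1 : MvPolynomial (Fin r) ℤ) =
      MvPolynomial.monomial (indicatorExponent I) ((-1) ^ (Iᶜ).card) := by
    rw [prod_X_eq_monomial, Finset.prod_const, ← Finset.compl_eq_univ_sdiff]
    rw [← mul_one ((-1 : ℤ) ^ (Iᶜ).card), ← MvPolynomial.C_mul_monomial, mul_comm]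
    simp
  rw [h, polyMul_monomial]
  congr 2
  funext i
  by_cases hi : i ∈ I <;> simp [indicatorExponent_apply, hi, sub_eq_add_neg]

lemma exists_polynomial (p : (Fin r →₀ ℕ) → ℤ) (B : ℕ) (h : ∀ m i, B < m i → p m = 0) :
    ∃ Q : MvPolynomial (Fin r) ℤ, ∀ m, MvPowerSeries.coeff m (Q : MvPowerSeries (Fin r) ℤ) = p m := by
  classical
  refine ⟨∑ m ∈ Finset.Iic (Finsupp.equivFunOnFinite.symm fun _ => B), MvPolynomial.monomial m (p m),
    fun m => ?_⟩
  rw [MvPolynomial.coeff_coe, MvPolynomial.coeff_sum]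
  simp only [MvPolynomial.coeff_monomial, Finset.sum_ite_eq', Finset.mem_Iic]
  split_ifs with hm
  · rfl
  · rw [Finsupp.le_def] at hm
    push Not at hm
    obtain ⟨i, hi⟩ := hm
    exact (h m i hi).symm

end CurveGerm

namespace CurveSingularity

open CurveGerm

variable {n r : ℕ} (C : CurveSingularity n r)

/-! ### The Poincaré series -/

/-- Raise the coordinates in a set by one and truncate the negative ones. -/
def raiseToNat (v : Fin r → ℤ) (K : Finset (Fin r)) : Fin r → ℕ :=
  fun i => (v i + if i ∈ K then 1 else 0).toNat

/-- The alternating sum of the codimensions of the ideals at the vertices of a cube. -/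
def alternatingCodim (v : Fin r → ℤ) : ℤ :=
  ∑ K : Finset (Fin r), (-1) ^ K.card * (C.codim (raiseToNat v K) : ℤ)

lemma alternatingCodim_eq (v : Fin r → ℤ) (i : Fin r) :
    C.alternatingCodim v = ∑ K ∈ (Finset.univ.erase i).powerset, (-1) ^ K.card *
      ((C.codim (raiseToNat v K) : ℤ) - C.codim (raiseToNat v (insert i K))) := by
  rw [alternatingCodim, ← Finset.powerset_univ, ← Finset.insert_erase (Finset.mem_univ i),
    Finset.sum_powerset_insert (Finset.notMem_erase _ _), ← Finset.sum_add_distrib]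
  rw [Finset.insert_erase (Finset.mem_univ i)]
  refine Finset.sum_congr rfl fun K hK => ?_
  have hi : i ∉ K := fun h => Finset.notMem_erase i _ (Finset.mem_powerset.1 hK h)
  rw [Finset.card_insert_of_notMem hi]
  ring

lemma alternatingCodim_of_neg {v : Fin r → ℤ} {i : Fin r} (hi : v i < 0) :
    C.alternatingCodim v = 0 := by
  rw [C.alternatingCodim_eq v i]
  refine Finset.sum_eq_zero fun K _ => ?_
  have h : raiseToNat v (insert i K) = raiseToNat v K := by
    funext j
    rcases eq_or_ne j i with rfl | hj
    · simp only [raiseToNat]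
      split_ifs <;> lia
    · simp only [raiseToNat, Finset.mem_insert, hj, false_or]
  rw [h, sub_self, mul_zero]

lemma exists_alternatingCodim_of_large : ∃ N : ℕ, ∀ (v : Fin r → ℤ) (i : Fin r), (N : ℤ) ≤ v i →
    C.alternatingCodim v = if 1 < r then 0 else -1 := by
  obtain ⟨N, hN⟩ := C.exists_codim_raise
  refine ⟨N, fun v i hi => ?_⟩
  have h : ∀ K ∈ (Finset.univ.erase i).powerset, (-1) ^ K.card *
      ((C.codim (raiseToNat v K) : ℤ) - C.codim (raiseToNat v (insert i K))) =
      (-1) ^ K.card * (-1) := by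
    intro K hK
    have hiK : i ∉ K := fun h => Finset.notMem_erase i _ (Finset.mem_powerset.1 hK h)
    have h1 : raiseToNat v (insert i K) = raise (raiseToNat v K) {i} := by
      funext j
      rcases eq_or_ne j i with rfl | hj
      · simp only [raiseToNat, raise, Finset.mem_insert_self, Finset.mem_singleton, hiK, if_true,
          if_false]
        lia
      · simp only [raiseToNat, raise, Finset.mem_insert, Finset.mem_singleton, hj, false_or,
          if_false]
    rw [h1, hN]
    · push_cast
      ring
    · simp only [raiseToNat, hiK, if_false]
      lia
  rw [C.alternatingCodim_eq v i, Finset.sum_congr rfl h, ← Finset.sum_mul,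
    Finset.sum_powerset_neg_one_pow_card]
  have hcard : Finset.univ.erase i = ∅ ↔ ¬ 1 < r := by
    rw [← Finset.card_eq_zero, Finset.card_erase_of_mem (Finset.mem_univ i), Finset.card_univ,
      Fintype.card_fin]
    have := i.pos
    lia
  simp only [hcard]
  split_ifs <;> simp_all

lemma poincareNumerator_apply (v : Fin r → ℤ) :
    C.poincareNumerator v = C.alternatingCodim v - C.alternatingCodim (v - 1) := by
  rw [poincareNumerator, polyMul_prod_X_sub_one, alternatingCodim, alternatingCodim,
    ← Finset.sum_sub_distrib]
  refine Finset.sum_congr rfl fun K _ => ?_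
  rw [← mul_sub, dimSeries_apply]
  congr 4
  · funext i
    simp only [raiseToNat, Pi.add_apply, Pi.one_apply]
    split_ifs <;> congr 1 <;> ring
  · funext i
    simp only [raiseToNat, Pi.sub_apply, Pi.one_apply]
    split_ifs <;> congr 1 <;> ring

lemma poincareNumerator_of_neg {v : Fin r → ℤ} {i : Fin r} (hi : v i < 0) :
    C.poincareNumerator v = 0 := by
  rw [poincareNumerator_apply, C.alternatingCodim_of_neg hi, C.alternatingCodim_of_neg (i := i),
    sub_zero]
  rw [Pi.sub_apply, Pi.one_apply]
  lia

lemma exists_poincareNumerator_of_large : ∃ N : ℕ, ∀ (v : Fin r → ℤ) (i : Fin r), (N : ℤ) < v i →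
    C.poincareNumerator v = 0 := by
  obtain ⟨N, hN⟩ := C.exists_alternatingCodim_of_large
  refine ⟨N, fun v i hi => ?_⟩
  rw [poincareNumerator_apply, hN v i hi.le, hN (v - 1) i, sub_self]
  rw [Pi.sub_apply, Pi.one_apply]
  lia

theorem exists_polynomial_poincareNumerator : ∃ Q : MvPolynomial (Fin r) ℤ,
    C.poincareNumerator = toLaurent (Q : MvPowerSeries (Fin r) ℤ) := by
  obtain ⟨N, hN⟩ := C.exists_poincareNumerator_of_large
  obtain ⟨Q, hQ⟩ := exists_polynomial (fun m => C.poincareNumerator fun i => (m i : ℤ)) N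
    fun m i hi => hN _ i (by exact_mod_cast hi)
  refine ⟨Q, funext fun v => ?_⟩
  rw [toLaurent]
  split_ifs with hv
  · rw [hQ]
    congr 1
    funext i
    simp [hv i]
  · push Not at hv
    obtain ⟨i, hi⟩ := hv
    exact C.poincareNumerator_of_neg hi

lemma eulerSeries_coeff (hr : 0 < r) (m : Fin r →₀ ℕ) :
    MvPowerSeries.coeff m C.eulerSeries = -C.alternatingCodim fun i => (m i : ℤ) := by
  refine (C.eulerChar_projFibre hr m).2.trans ?_
  rw [alternatingCodim]
  congr 1
  refine Finset.sum_congr rfl fun I _ => ?_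
  congr 3
  funext i
  simp only [raise, raiseToNat]
  split_ifs <;> lia

lemma mul_eulerSeries (hr : 0 < r) : ((∏ i, MvPowerSeries.X i) - 1) * C.eulerSeries =
    (show MvPowerSeries (Fin r) ℤ from fun m => C.poincareNumerator fun i => (m i : ℤ)) := by
  have hX : (∏ i, MvPowerSeries.X i : MvPowerSeries (Fin r) ℤ) =
      MvPowerSeries.monomial (indicatorExponent Finset.univ) 1 := by
    rw [← MvPolynomial.coe_monomial, ← prod_X_eq_monomial]
    have := map_prod (MvPolynomial.coeToMvPowerSeries.ringHom (σ := Fin r) (R := ℤ))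
      (fun i => MvPolynomial.X i) Finset.univ
    simp only [MvPolynomial.coeToMvPowerSeries.ringHom_apply, MvPolynomial.coe_X] at this
    exact this.symm
  ext m
  rw [sub_mul, one_mul, map_sub, hX, MvPowerSeries.coeff_monomial_mul, one_mul]
  change _ = C.poincareNumerator fun i => (m i : ℤ)
  rw [poincareNumerator_apply, C.eulerSeries_coeff hr m, sub_neg_eq_add]
  split_ifs with h
  · rw [C.eulerSeries_coeff hr]
    have h' : (fun i => (((m - indicatorExponent Finset.univ : Fin r →₀ ℕ) i : ℕ) : ℤ)) =
        (fun i => (m i : ℤ)) - 1 := by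
      funext i
      have hi := h i
      rw [indicatorExponent_apply, if_pos (Finset.mem_univ i)] at hi
      rw [Finsupp.tsub_apply, indicatorExponent_apply, if_pos (Finset.mem_univ i), Pi.sub_apply,
        Pi.one_apply]
      lia
    rw [h']
    ring
  · rw [Finsupp.le_def] at h
    push Not at h
    obtain ⟨i, hi⟩ := h
    rw [indicatorExponent_apply, if_pos (Finset.mem_univ i)] at hi
    rw [C.alternatingCodim_of_neg (v := (fun i => (m i : ℤ)) - 1) (i := i)]
    · ring
    · rw [Pi.sub_apply, Pi.one_apply]
      lia

theorem eulerSeries_eq_poincareSeries (hr : 0 < r) : C.eulerSeries = C.poincareSeries := by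
  have : Nonempty (Fin r) := ⟨⟨0, hr⟩⟩
  rw [poincareSeries, ← C.mul_eulerSeries hr, mul_right_comm, MvPowerSeries.mul_invOfUnit, one_mul]
  simp [map_prod, Finset.prod_const, hr.ne']

theorem exists_polynomial_poincareSeries (hr : 1 < r) : ∃ Q : MvPolynomial (Fin r) ℤ,
    C.poincareSeries = (Q : MvPowerSeries (Fin r) ℤ) := by
  have hr0 : 0 < r := by lia
  obtain ⟨N, hN⟩ := C.exists_alternatingCodim_of_large
  obtain ⟨Q, hQ⟩ := exists_polynomial (fun m => MvPowerSeries.coeff m C.eulerSeries) N (by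
    intro m i hi
    rw [C.eulerSeries_coeff hr0, hN _ i (by exact_mod_cast hi.le), if_pos hr, neg_zero])
  refine ⟨Q, ?_⟩
  rw [← C.eulerSeries_eq_poincareSeries hr0]
  ext m
  exact (hQ m).symm

end CurveSingularity

end

theorem theorem2 {n r : ℕ} (hr : 0 < r) (C : CurveSingularity n r) :
    -- the numbers `c(v)` and `χ(ℙF_v)` are well defined
    (∀ v : Fin r → ℤ, Module.Finite ℂ (C.gradedPiece v)) ∧
    (∀ v : Fin r → ℕ, CurveGerm.HasFiniteHomology (C.projFibre v)) ∧
    -- `P'_C` is a polynomial, and so is `P_C` if `r > 1`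
    (∃ Q : MvPolynomial (Fin r) ℤ,
      C.poincareNumerator = CurveGerm.toLaurent (Q : MvPowerSeries (Fin r) ℤ)) ∧
    (1 < r → ∃ Q : MvPolynomial (Fin r) ℤ,
      C.poincareSeries = (Q : MvPowerSeries (Fin r) ℤ)) ∧
    -- the equality of the two series
    C.eulerSeries = C.poincareSeries := by
  refine ⟨C.finite_gradedPiece, fun v => (C.eulerChar_projFibre hr v).1,
    C.exists_polynomial_poincareNumerator, C.exists_polynomial_poincareSeries,
    C.eulerSeries_eq_poincareSeries hr⟩
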